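/- **Model.** In an $n$-round binary interactive insertion-deletion channel between intermediaries $C_A$ and $C_B$, each of the two can send at most $\lfloor n/2\rfloor$ bits, and the communication is message-driven: an intermediary acts only when it has received a symbol. A fully adaptive adversary may perform up to $n\delta$ edit corruptions; an edit corruption deletes the bit that is being sent and then inserts an arbitrary bit, which is delivered either to the intended receiver or to the sender (who takes it for a reply). The channel use ends when the intermediary that has to send has used up its $\lfloor n/2\rfloor$ bits. Deterministic intermediaries $C_A,C_B$ *simulate* $n'$ rounds ($n'$ even) of a binary interactive corruption channel between Alice and Bob over this channel as follows. Alice first gives a bit to $C_A$. Whenever it is an intermediary's turn (after receiving a bit from its party or from the channel), it either reveals a bit to its party (Alice for $C_A$, Bob for $C_B$) or sends a bit through the channel. A party to whom a bit is revealed responds with a new bit, which may depend on all bits revealed to it so far; only Alice does not respond to the $(n'/2)$-th bit, after which $C_A$ carries on by itself. Regardless of the parties and of the adversary, each intermediary has to reveal exactly $n'/2$ bits. Let $X_i$ be the $i$-th bit given by Alice, $\tilde X_i$ the $i$-th bit revealed to Bob, $Y_i$ the $i$-th bit given by Bob and $\tilde Y_i$ the $i$-th bit revealed to Alice, $1\le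 i\le n'/2$. The rounds, in the order $(X_1,\tilde X_1),(Y_1,\tilde Y_1),(X_2,\tilde X_2),\dots$, are corrupted when the two entries differ. The simulated channel is a $(\delta',r)$-*block corruption channel* if at most $n'\delta'$ rounds are corrupted and they can be covered by $n'\delta'/r$ blocks of $r$ consecutive rounds. An *$\varepsilon$-synchronization string* is a string $S$ such that for all $i<j<k\le |S|+1$ the edit distance (number of insertions and deletions) of $S[i,j)$ and $S[j,k)$ exceeds $(1-\varepsilon)(k-i)$. A family $(S_N)_{N}$ of strings $S_N$ of length $N$ over a fixed finite alphabet is *efficient* if the symbol $S_N[i]$ is computable from $(N,i)$ in time polynomial in $N$. **Theorem.** Let $c>0$ be a constant, and write $r=\sqrt{(1/\delta)\log(1/\delta)}$ and $s=\lceil c\log(1/\delta)\rceil$, with $\log=\log_2$ and lengths $r$ rounded up to integers. (1) There are functions $\theta_1(\delta),\theta_2(\delta)=\Theta\big(\sqrt{\delta\log(1/\delta)}\big)$ as $\delta\to0^+$ such that, for all sufficiently small $\delta>0$ and all $n$, it is possible to deterministically simulate, over $n$ rounds of a binary interactive insertion-deletion channel with up to $n\delta$ edit corruptions, $n(1-\theta_1(\delta))$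 rounds (rounded down to an even number) of a binary interactive $(\theta_2(\delta),r)$-block corruption channel between Alice and Bob, assuming that all substrings of the form $10^{s-1}$ in the stream of bits that Alice sends can be covered by $n\delta$ intervals of $r$ consecutive rounds of the simulated channel. (2) The simulation is efficient if the synchronization string is: for every $\varepsilon\in(0,1)$ and every efficient family $(S_N)_N$ in which $S_N$ is an $\varepsilon$-synchronization string of length $N$ over a fixed finite alphabet, there are $\theta_1,\theta_2$ as above (depending on $c$ and on the family), a polynomial $T$ and, for all sufficiently small $\delta>0$, such simulations for all $n$ for which a fixed program for $C_A$ and a fixed program for $C_B$ compute the next action of the intermediary from $n$ and the record of its communication so far, of length $\ell$, in at most $T(n+\ell)$ steps. -/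

import Mathlib

open Filter Topology Asymptotics

namespace InsDel

/-! ### Interactive insertion-deletion channel and channel simulation -/

/-- The two ends: `A` is Alice together with her intermediary `C_A`, `B` is Bob with `C_B`. -/
inductive Side
  | A
  | B
  deriving DecidableEq

def Side.other : Side → Side
  | .A => .B
  | .B => .A

/-- What an intermediary may do when it is its turn: reveal a bit of the simulated channel to its
own user (Alice for `C_A`, Bob for `C_B`), or send a bit through the insertion-deletion channel. -/
inductive Action
  | reveal (b : Bool)
  | send (b : Bool)

/-- The entries of the local record of an intermediary: a bit handed over by its user, a bit
received from the channel, or an action that it performed itself. -/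
inductive Event
  | user (b : Bool)
  | channel (b : Bool)
  | did (a : Action)

/-- A deterministic intermediary: its next action as a function of its local record, which is in
chronological order. -/
abbrev Strategy := List Event → Action

/-- The bits that the user has handed over to the intermediary. -/
def given (h : List Event) : List Bool :=
  h.filterMap fun e => match e with
    | .user b => some b
    | _ => none

/-- The bits that the intermediary has revealed to its user. -/
def revealed (h : List Event) : List Bool :=
  h.filterMap fun e => match e with
    | .did (.reveal b) => some b
    | _ => none

/-- The bits that the intermediary has put on the insertion-deletion channel. -/
def sent (h : List Event) : List Bool :=
  h.filterMap fun e => match e with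
    | .did (.send b) => some b
    | _ => none

/-- A state of the whole system: whose intermediary has to act, the two local records, and the
number of edit corruptions that the adversary has made so far. -/
structure Config where
  turn : Side
  hist : Side → List Event
  edits : ℕ

/-- The user's reaction to the revealed bits `l`: a new bit, except that Alice does not react to
the `m`-th bit (`C_A` then just goes on). -/
def response (m : ℕ) (user : Side → List Bool → Bool) (p : Side) (l : List Bool) : List Event :=
  if p = .A ∧ m ≤ l.length then [] else [.user (user p l)]

/-- One step of a simulation of `2 * m` rounds over `n` rounds of a binary interactive
insertion-deletion channel. The users are arbitrary adaptive deterministic parties: `user p l` is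
the next bit of user `p` after the bits `l` were revealed to him. Each intermediary can send
`n / 2` symbols. The adversary either delivers a symbol or makes an edit corruption: a deletion
followed by an insertion, which may be aimed at either end (at the receiver: `substitute`; at the
sender himself, who takes the inserted symbol for a reply: `bounce`). -/
inductive Step (n m : ℕ) (user : Side → List Bool → Bool) (C : Side → Strategy) :
    Config → Config → Prop
  | reveal (cfg : Config) (b : Bool)
      (act : C cfg.turn (cfg.hist cfg.turn) = .reveal b) :
      Step n m user C cfg
        ⟨cfg.turn,
          Function.update cfg.hist cfg.turn
            (cfg.hist cfg.turn ++ [.did (.reveal b)] ++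
              response m user cfg.turn (revealed (cfg.hist cfg.turn) ++ [b])),
          cfg.edits⟩
  | deliver (cfg : Config) (b : Bool)
      (act : C cfg.turn (cfg.hist cfg.turn) = .send b)
      (left : (sent (cfg.hist cfg.turn)).length < n / 2) :
      Step n m user C cfg
        ⟨cfg.turn.other,
          Function.update
            (Function.update cfg.hist cfg.turn (cfg.hist cfg.turn ++ [.did (.send b)]))
            cfg.turn.other (cfg.hist cfg.turn.other ++ [.channel b]),
          cfg.edits⟩
  | substitute (cfg : Config) (b b' : Bool)
      (act : C cfg.turn (cfg.hist cfg.turn) = .send b)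
      (left : (sent (cfg.hist cfg.turn)).length < n / 2) :
      Step n m user C cfg
        ⟨cfg.turn.other,
          Function.update
            (Function.update cfg.hist cfg.turn (cfg.hist cfg.turn ++ [.did (.send b)]))
            cfg.turn.other (cfg.hist cfg.turn.other ++ [.channel b']),
          cfg.edits + 1⟩
  | bounce (cfg : Config) (b b' : Bool)
      (act : C cfg.turn (cfg.hist cfg.turn) = .send b)
      (left : (sent (cfg.hist cfg.turn)).length < n / 2) :
      Step n m user C cfg
        ⟨cfg.turn,
          Function.update cfg.hist cfg.turn
            (cfg.hist cfg.turn ++ [.did (.send b), .channel b']),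
          cfg.edits + 1⟩

/-- The communication starts when Alice gives her first bit to `C_A`. -/
def initial (user : Side → List Bool → Bool) : Config where
  turn := .A
  hist := fun p => match p with
    | .A => [.user (user .A [])]
    | .B => []
  edits := 0

/-- The system can be in state `cfg`, for some behaviour of the adversary. -/
def Reachable (n m : ℕ) (user : Side → List Bool → Bool) (C : Side → Strategy)
    (cfg : Config) : Prop :=
  Relation.ReflTransGen (Step n m user C) (initial user) cfg

/-- The run is over: the intermediary to act wants to send, but has used up its `n / 2` symbols. -/
def Halted (n m : ℕ) (user : Side → List Bool → Bool) (C : Side → Strategy)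
    (cfg : Config) : Prop :=
  ∀ cfg', ¬ Step n m user C cfg cfg'

/-- The symbol that enters the simulated channel in round `k`; Alice speaks in the rounds
`0, 2, 4, …` and Bob in the rounds `1, 3, 5, …`. -/
def roundIn (cfg : Config) (k : ℕ) : Option Bool :=
  if k % 2 = 0 then (given (cfg.hist .A))[k / 2]? else (given (cfg.hist .B))[k / 2]?

/-- The symbol that leaves the simulated channel in round `k`. -/
def roundOut (cfg : Config) (k : ℕ) : Option Bool :=
  if k % 2 = 0 then (revealed (cfg.hist .B))[k / 2]? else (revealed (cfg.hist .A))[k / 2]?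

/-- The corrupted rounds among the `2 * m` rounds of the simulated channel. -/
def corrupted (m : ℕ) (cfg : Config) : Finset ℕ :=
  (Finset.range (2 * m)).filter fun k => roundOut cfg k ≠ roundIn cfg k

/-- `P` can be covered by at most `k` intervals of `L` consecutive integers. -/
def CoveredBy (P : Set ℕ) (k : ℝ) (L : ℕ) : Prop :=
  ∃ starts : Finset ℕ, (starts.card : ℝ) ≤ k ∧ ∀ x ∈ P, ∃ a ∈ starts, a ≤ x ∧ x < a + L

/-- The corruption patterns that an `n'`-round `(δ', r)`-block corruption channel allows. -/
def BlockCorruption (n' : ℕ) (δ' r : ℝ) (P : Finset ℕ) : Prop :=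
  (P.card : ℝ) ≤ n' * δ' ∧ CoveredBy (P : Set ℕ) (n' * δ' / r) ⌈r⌉₊

/-- The rounds of the simulated channel that are occupied by substrings `1 0^(s-1)` of Alice's
stream `X`, whose `i`-th bit is sent in round `2 * i`. -/
def patternRounds (s : ℕ) (X : List Bool) : Set ℕ :=
  {k | ∃ i j, (true :: List.replicate (s - 1) false) <+: X.drop i ∧ j < s ∧ k = 2 * (i + j)}

/-- The intermediaries `C` deterministically simulate `2 * m` rounds of a binary interactive
corruption channel over `n` rounds of a binary interactive insertion-deletion channel with at most
`n * δ` edit corruptions: whatever the users and the adversary do, both intermediaries reveal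
exactly `m` bits; and whenever the stream of bits sent by Alice is `admissible`, the set of
corrupted rounds is `allowed`. -/
def Simulates (n m : ℕ) (δ : ℝ) (C : Side → Strategy)
    (admissible : List Bool → Prop) (allowed : Finset ℕ → Prop) : Prop :=
  ∀ (user : Side → List Bool → Bool) (cfg : Config),
    Reachable n m user C cfg → (cfg.edits : ℝ) ≤ n * δ →
      (∀ p, (revealed (cfg.hist p)).length ≤ m) ∧
      (Halted n m user C cfg →
        (∀ p, (revealed (cfg.hist p)).length = m) ∧
        (admissible (given (cfg.hist .A)) → allowed (corrupted m cfg)))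

/-- `√(δ log (1/δ))` -/
noncomputable def lossRate (δ : ℝ) : ℝ := √(δ * Real.logb 2 (1 / δ))

/-- `√((1/δ) log (1/δ))` -/
noncomputable def blockLength (δ : ℝ) : ℝ := √((1 / δ) * Real.logb 2 (1 / δ))

/-- Half of `n (1 - θ)`, rounded down. -/
noncomputable def halfRounds (n : ℕ) (θ : ℝ) : ℕ := ⌊(n : ℝ) * (1 - θ) / 2⌋₊

/-- Over `n` rounds of a binary interactive insertion-deletion channel with a `δ` fraction of edit
corruptions, `C` simulates `n (1 - θ₁)` rounds (rounded down to an even number) of a binary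
interactive `(θ₂, √((1/δ) log (1/δ)))`-block corruption channel, provided that the substrings
`1 0^(s-1)`, `s = c log (1/δ)`, of Alice's stream can be covered by `n δ` intervals of
`√((1/δ) log (1/δ))` consecutive rounds. -/
def SimulatesBlockChannel (c δ : ℝ) (n : ℕ) (θ₁ θ₂ : ℝ) (C : Side → Strategy) : Prop :=
  Simulates n (halfRounds n θ₁) δ C
    (fun X => CoveredBy (patternRounds ⌈c * Real.logb 2 (1 / δ)⌉₊ X) (n * δ) ⌈blockLength δ⌉₊)
    (BlockCorruption (2 * halfRounds n θ₁) θ₂ (blockLength δ))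

/-! ### Running time

Programs compute on binary trees (LISP data), with unit cost for every elementary operation. This
is polynomially equivalent to Turing machine time. -/

inductive Data
  | nil
  | cons (a b : Data)

def Data.hd : Data → Data
  | .nil => .nil
  | .cons a _ => a

def Data.tl : Data → Data
  | .nil => .nil
  | .cons _ b => b

inductive Prog
  | id
  | const (d : Data)
  | hd
  | tl
  | cons (f g : Prog)
  | comp (f g : Prog)
  | ite (b f g : Prog)
  | loop (b f : Prog)

/-- `Eval P x y t`: on input `x` the program `P` halts after exactly `t` steps with output `y`.
`ite b f g` runs `f` if the value of `b` is not `nil`, and `g` otherwise; `loop b f` applies `f` as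
long as the value of `b` is not `nil`. -/
inductive Eval : Prog → Data → Data → ℕ → Prop
  | id (x) : Eval .id x x 1
  | const (d x) : Eval (.const d) x d 1
  | hd (x) : Eval .hd x x.hd 1
  | tl (x) : Eval .tl x x.tl 1
  | cons {f g x y z s t} : Eval f x y s → Eval g x z t →
      Eval (.cons f g) x (.cons y z) (s + t + 1)
  | comp {f g x y z s t} : Eval g x y s → Eval f y z t → Eval (.comp f g) x z (s + t + 1)
  | iteTrue {b f g x v y s t} : Eval b x v s → v ≠ .nil → Eval f x y t →
      Eval (.ite b f g) x y (s + t + 1)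
  | iteFalse {b f g x y s t} : Eval b x .nil s → Eval g x y t →
      Eval (.ite b f g) x y (s + t + 1)
  | loopDone {b f x s} : Eval b x .nil s → Eval (.loop b f) x x (s + 1)
  | loopNext {b f x v y z s t u} : Eval b x v s → v ≠ .nil → Eval f x y t →
      Eval (.loop b f) y z u → Eval (.loop b f) x z (s + t + u + 1)

def encodeList : List Data → Data
  | [] => .nil
  | d :: l => .cons d (encodeList l)

/-- Natural numbers are written in unary. -/
def encodeNat (n : ℕ) : Data := encodeList (List.replicate n .nil)

def encodeBool (b : Bool) : Data := encodeNat b.toNat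

def encodeAction : Action → Data
  | .reveal b => .cons (encodeNat 0) (encodeBool b)
  | .send b => .cons (encodeNat 1) (encodeBool b)

def encodeEvent : Event → Data
  | .user b => .cons (encodeNat 0) (encodeBool b)
  | .channel b => .cons (encodeNat 1) (encodeBool b)
  | .did a => .cons (encodeNat 2) (encodeAction a)

/-- The family `C` (`C n` is an intermediary for `n` rounds) is computable by a single program in
time `T`: from `n` and the local record of length `l`, the program finds the next action in at most
`T (n + l)` steps. -/
def RunsInTime (C : ℕ → Strategy) (T : Polynomial ℕ) : Prop :=
  ∃ P : Prog, ∀ (n : ℕ) (h : List Event), ∃ t ≤ T.eval (n + h.length),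
    Eval P (.cons (encodeNat n) (encodeList (h.map encodeEvent))) (encodeAction (C n h)) t

/-! ### Synchronization strings -/

/-- The edit distance: the least number of insertions and deletions that turn `u` into `v`, that
is, delete from `u` what is not in a common subsequence `w`, and insert the rest of `v`. -/
noncomputable def editDist {α : Type*} (u v : List α) : ℕ :=
  sInf {d | ∃ w : List α, w.Sublist u ∧ w.Sublist v ∧
    d = (u.length - w.length) + (v.length - w.length)}

/-- `S` is an `ε`-synchronization string. -/
def IsSyncString {α : Type*} (ε : ℝ) (S : List α) : Prop :=
  ∀ i j k : ℕ, i < j → j < k → k ≤ S.length →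
    (1 - ε) * ((k : ℝ) - i) <
      editDist ((S.drop i).take (j - i)) ((S.drop j).take (k - j))

/-- `S` gives an `ε`-synchronization string of every length. -/
def IsSyncFamily {q : ℕ} (ε : ℝ) (S : ℕ → List (Fin q)) : Prop :=
  ∀ N, (S N).length = N ∧ IsSyncString ε (S N)

/-- The symbols of the strings `S N` are computable in time polynomial in `N`. -/
def IsEfficientFamily {q : ℕ} (S : ℕ → List (Fin q)) : Prop :=
  ∃ (P : Prog) (T : Polynomial ℕ), ∀ (N i : ℕ) (a : Fin q), (S N)[i]? = some a →
    ∃ t ≤ T.eval N, Eval P (.cons (encodeNat N) (encodeNat i)) (encodeNat a) t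

end InsDel

namespace InsDel

/-! ### Self-matchings of synchronization strings -/

/-! Alice's intermediary obeys only its own clock, the number of bits it has sent. It cuts its bits
into blocks of about r bits. A block starts with a header of Θ(log(1/δ)) bits: a 1, the codeword of
the next symbol of a synchronization string, and the pattern 1 0^(s-1). The other rounds of the
block carry Alice's bits, and what comes back in them is revealed to her. Bob's intermediary looks
for the pattern, reads the words in front of it, and infers from the sequence of words how many
headers Alice has completed; together with the time since the last detection this estimates her
clock. He reveals bits until the number of revealed bits reaches the estimate. Headers cost a
fraction log(1/δ)/r of the rounds, and O(nδ) spoilt blocks cost a fraction O(δr); the length r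
balances the two, and both are Θ(√(δ log(1/δ))).

The number of headers is estimated by a q that maximizes 2·lcs - q, where lcs compares the detected
words with the first q symbols of the string. A synchronization string has few matchings of itself
that avoid the diagonal (`IsSyncString.self_matching`). Hence, behind the last correctly matched
word, the decoding error is bounded by the number of false and missing words (`decoding_error`). The
invariant `Ghost.Inv` charges each of these to trouble in a nearby block, that is, to a channel
error or to a pattern inside Alice's data.

Call block k good if every window of blocks ending at k has little trouble for its length. In a good
block the estimate is exact (`Ghost.Inv.decode_eq`) and the exchanges are undisturbed, so all of its
rounds are correct (`Outcome.round_eq`). The number of blocks that are not good is at most a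
constant times the total trouble (`Ghost.card_not_good_le`), which the edit budget and the covering
assumption on Alice's stream bound by 3nδ. `simulates_of_scheme` collects these facts; for n < 1/δ
no edit is possible and plain forwarding works.

For efficiency, everything is composed from functions in `PolyTime`, the longest common subsequences
being computed row by row. The polynomial must not depend on δ; this is why small n are served from
a table inside the program (`exists_runsInTime`). The first claim also needs synchronization strings
to exist, which a counting argument shows for ε = 1/2 (`card_goodWords`). -/

theorem filterMap_getElem?_range' {α : Type*} (S : List α) (i n : ℕ) (h : i + n ≤ S.length) :
    (List.range' i n).filterMap (S[·]?) = (S.drop i).take n := by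
  induction n generalizing i with
  | zero => simp
  | succ n ih =>
    have hi : i < S.length := by omega
    rw [List.range'_succ, List.filterMap_cons, List.drop_eq_getElem_cons hi, List.take_succ_cons,
      ← ih (i + 1) (by omega)]
    simp [hi]

theorem filterMap_getElem?_sublist {α : Type*} (S : List α) (l : List ℕ) (i j : ℕ)
    (hl : l.Pairwise (· < ·)) (hij : ∀ x ∈ l, i ≤ x ∧ x < j) (hi : i ≤ j) (hj : j ≤ S.length) :
    (l.filterMap (S[·]?)).Sublist ((S.drop i).take (j - i)) := by
  rw [← filterMap_getElem?_range' S i (j - i) (by omega)]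
  apply List.Sublist.filterMap
  apply List.sublist_of_subperm_of_pairwise (r := (· < ·)) _ hl (List.pairwise_lt_range' ..)
  apply List.subperm_of_subset (hl.imp fun h => h.ne)
  intro x hx
  have := hij x hx
  rw [List.mem_range'_1]
  omega

theorem length_filterMap_getElem? {α : Type*} (S : List α) (l : List ℕ)
    (h : ∀ x ∈ l, x < S.length) : (l.filterMap (S[·]?)).length = l.length := by
  induction l with
  | nil => rfl
  | cons a l ih =>
    simp only [List.forall_mem_cons] at h
    rw [List.filterMap_cons]
    simp [h.1, ih h.2]

theorem editDist_le {α : Type*} {u v w : List α} (hu : w.Sublist u) (hv : w.Sublist v) :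
    editDist u v ≤ (u.length - w.length) + (v.length - w.length) :=
  Nat.sInf_le ⟨w, hu, hv, rfl⟩

/-- A strictly increasing sequence of pairs. -/
abbrev Increasing (Q : List (ℕ × ℕ)) : Prop := Q.Pairwise fun p q => p.1 < q.1 ∧ p.2 < q.2

/-- The matched symbols form a common subsequence of S[i,j) and S[j,k), so the edit distance of
these factors is at most (k - i) - 2|G|, while the synchronization property keeps it above (1 - ε)(k
- i). -/
theorem IsSyncString.group_le {α : Type*} {ε : ℝ} {S : List α} (hS : IsSyncString ε S)
    {G : List (ℕ × ℕ)} (hG : Increasing G) {i j k : ℕ} (hij : i < j) (hjk : j < k)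
    (hk : k ≤ S.length) (h1 : ∀ p ∈ G, i ≤ p.1 ∧ p.1 < j) (h2 : ∀ p ∈ G, j ≤ p.2 ∧ p.2 < k)
    (h3 : ∀ p ∈ G, S[p.1]? = S[p.2]?) : 2 * (G.length : ℝ) ≤ ε * ((k : ℝ) - i) := by
  have hs1 := filterMap_getElem?_sublist S (G.map Prod.fst) i j
    (List.pairwise_map.2 (hG.imp fun h => h.1)) (by simpa using fun a b h => h1 (a, b) h)
    hij.le (by omega)
  have hs2 := filterMap_getElem?_sublist S (G.map Prod.snd) j k
    (List.pairwise_map.2 (hG.imp fun h => h.2))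
    (by intro x hx; obtain ⟨p, hp, rfl⟩ := List.mem_map.1 hx; exact h2 p hp) hjk.le hk
  have heq : (G.map Prod.fst).filterMap (S[·]?) = (G.map Prod.snd).filterMap (S[·]?) := by
    rw [List.filterMap_map, List.filterMap_map]
    exact List.filterMap_congr fun p hp => h3 p hp
  have hl := length_filterMap_getElem? S (G.map Prod.fst) (by
    intro x hx; obtain ⟨p, hp, rfl⟩ := List.mem_map.1 hx; have := h1 p hp; omega)
  rw [← heq] at hs2
  have h := editDist_le hs1 hs2
  have hlt := hS i j k hij hjk hk
  have e1 := hs1.length_le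
  have e2 := hs2.length_le
  have l1 : ((S.drop i).take (j - i)).length = j - i := by simp; omega
  have l2 : ((S.drop j).take (k - j)).length = k - j := by simp; omega
  rw [l1, l2, hl, List.length_map] at h
  rw [hl, List.length_map, l1] at e1
  rw [hl, List.length_map, l2] at e2
  have h' : (editDist ((S.drop i).take (j - i)) ((S.drop j).take (k - j)) : ℝ)
      ≤ (k : ℝ) - i - 2 * G.length := by
    have : editDist ((S.drop i).take (j - i)) ((S.drop j).take (k - j)) + i + 2 * G.length ≤ k := by
      omega
    have : ((editDist ((S.drop i).take (j - i)) ((S.drop j).take (k - j)) + i + 2 * G.length : ℕ) : ℝ)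
      ≤ k := by exact_mod_cast this
    push_cast at this
    linarith
  linarith

/-- The longest initial run of pairs with first entry below b, ending in (x, y), matches S[a,b) with
S[b,y+1) and costs ε(y + 1 - a) = ε((b - a) + (y + 1 - b)). This is exactly what the bound loses
when the two starts move from (a, b) to (b, y + 1), behind which the remaining pairs lie. For this
telescoping the two sides need separate starts. -/
theorem IsSyncString.length_le_of_lt {α : Type*} {ε : ℝ} {S : List α} (hS : IsSyncString ε S)
    {n M u₁ u₂ : ℕ} (hε : 0 ≤ ε) (hM : M ≤ S.length)
    (ih : ∀ (Q : List (ℕ × ℕ)) (u₁ u₂ : ℕ), Q.length ≤ n → Increasing Q → u₁ ≤ M → u₂ ≤ M →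
      (∀ p ∈ Q, u₁ ≤ p.1 ∧ p.1 < M ∧ u₂ ≤ p.2 ∧ p.2 < M ∧ p.1 ≠ p.2 ∧ S[p.1]? = S[p.2]?) →
      2 * (Q.length : ℝ) ≤ ε * (((M : ℝ) - u₁) + ((M : ℝ) - u₂)))
    {a b : ℕ} {Q : List (ℕ × ℕ)} (hn : Q.length ≤ n) (hQ : Increasing ((a, b) :: Q))
    (h : ∀ p ∈ (a, b) :: Q, u₁ ≤ p.1 ∧ p.1 < M ∧ u₂ ≤ p.2 ∧ p.2 < M ∧ p.1 ≠ p.2 ∧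
      S[p.1]? = S[p.2]?) (hab : a < b) :
    2 * (((a, b) :: Q).length : ℝ) ≤ ε * (((M : ℝ) - u₁) + ((M : ℝ) - u₂)) := by
  set T := Q.takeWhile (fun p => decide (p.1 < b)) with hT
  set R := Q.dropWhile (fun p => decide (p.1 < b)) with hR
  have hTR : T ++ R = Q := List.takeWhile_append_dropWhile
  obtain ⟨G, ⟨x, y⟩, hG⟩ : ∃ G l, (a, b) :: T = G ++ [l] := by
    rcases List.eq_nil_or_concat ((a, b) :: T) with h | ⟨L, l, h⟩
    · simp at h
    · exact ⟨L, l, by simpa using h⟩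
  have hsplit : (a, b) :: Q = (G ++ [(x, y)]) ++ R := by rw [← hG, List.cons_append, hTR]
  have hxy : (x, y) ∈ (a, b) :: Q := by rw [hsplit]; simp
  have hQ' := hQ
  rw [hsplit, Increasing, List.pairwise_append] at hQ'
  have hyM := (h _ hxy).2.2.2.1
  have hb := h (a, b) (by simp)
  simp only at hb hyM
  have hby : b ≤ y := by
    rcases List.mem_cons.1 hxy with h | h
    · simp at h; omega
    · have := (List.pairwise_cons.1 hQ).1 _ h; simp at this; omega
  have hg : 2 * ((G ++ [(x, y)]).length : ℝ) ≤ ε * (((y + 1 : ℕ) : ℝ) - a) := by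
    apply hS.group_le hQ'.1 (i := a) (j := b) (k := y + 1) hab (by omega) (by omega)
    · rw [← hG]
      intro p hp
      rcases List.mem_cons.1 hp with rfl | hp
      · simp; omega
      · have h1 := List.mem_takeWhile_imp hp
        have h2 := (List.pairwise_cons.1 hQ).1 p (by rw [← hTR]; simp [hp])
        simp at h1 h2 ⊢; omega
    · intro p hp
      constructor
      · rw [← hG] at hp
        rcases List.mem_cons.1 hp with rfl | hp
        · exact le_rfl
        · have h2 := (List.pairwise_cons.1 hQ).1 p (by rw [← hTR]; simp [hp])
          simp at h2; omega
      · have := List.pairwise_append.1 hQ'.1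
        rcases List.mem_append.1 hp with hp | hp
        · have := this.2.2 p hp (x, y) (by simp); simp at this; omega
        · simp at hp; simp [hp]
    · intro p hp
      exact (h p (by rw [hsplit]; simp only [List.mem_append] at hp ⊢; exact Or.inl hp)).2.2.2.2.2
  have hr := ih R b (y + 1) (by rw [← hTR] at hn; simp at hn; omega) hQ'.2.1
    (by omega) (by omega) (by
      intro p hp
      have hp' := h p (by rw [hsplit]; simp [hp])
      have h2 := hQ'.2.2 (x, y) (by simp) p hp
      refine ⟨?_, hp'.2.1, by simp at h2; omega, hp'.2.2.2⟩
      have hne : R ≠ [] := List.ne_nil_of_mem hp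
      have hhead := List.head_dropWhile_not (fun p : ℕ × ℕ => decide (p.1 < b))
        (l := Q) (by rwa [← hR])
      rw [decide_eq_false_iff_not, not_lt] at hhead
      change b ≤ (R.head hne).1 at hhead
      rcases hRR : R with _ | ⟨r, R'⟩
      · exact absurd hRR hne
      · simp only [hRR, List.head_cons] at hhead
        rw [hRR] at hp
        rcases List.mem_cons.1 hp with rfl | hp
        · exact hhead
        · have := (List.pairwise_cons.1 (hRR ▸ hQ'.2.1)).1 p hp
          omega)
  have hlen : (((a, b) :: Q).length : ℝ) = (G ++ [(x, y)]).length + R.length := by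
    rw [hsplit]; push_cast [List.length_append]; ring
  rw [hlen]
  have h1 : (u₁ : ℝ) ≤ a := by exact_mod_cast hb.1
  have h2 : (u₂ : ℝ) ≤ b := by exact_mod_cast hb.2.2.1
  push_cast at hg hr ⊢
  nlinarith

/-- Induction that splits off one group after the other. A first pair below the diagonal is reduced
to one above it by swapping coordinates, as the bound is symmetric in the two starts. -/
theorem IsSyncString.length_le {α : Type*} {ε : ℝ} {S : List α} (hS : IsSyncString ε S)
    {M : ℕ} (hε : 0 ≤ ε) (hM : M ≤ S.length) (n : ℕ) :
    ∀ (Q : List (ℕ × ℕ)) (u₁ u₂ : ℕ), Q.length ≤ n → Increasing Q → u₁ ≤ M → u₂ ≤ M →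
      (∀ p ∈ Q, u₁ ≤ p.1 ∧ p.1 < M ∧ u₂ ≤ p.2 ∧ p.2 < M ∧ p.1 ≠ p.2 ∧ S[p.1]? = S[p.2]?) →
      2 * (Q.length : ℝ) ≤ ε * (((M : ℝ) - u₁) + ((M : ℝ) - u₂)) := by
  induction n with
  | zero =>
    intro Q u₁ u₂ hn _ h1 h2 _
    have h1' : (u₁ : ℝ) ≤ M := by exact_mod_cast h1
    have h2' : (u₂ : ℝ) ≤ M := by exact_mod_cast h2
    simp only [Nat.le_zero, List.length_eq_zero_iff] at hn
    subst hn
    simp only [List.length_nil, Nat.cast_zero, mul_zero]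
    exact mul_nonneg hε (by linarith)
  | succ n ih =>
    intro Q u₁ u₂ hn hQ h1 h2 h
    rcases Q with _ | ⟨⟨a, b⟩, Q⟩
    · exact ih [] u₁ u₂ (by simp) (by simp) h1 h2 (by simp)
    · simp only [List.length_cons, Nat.add_le_add_iff_right] at hn
      have hne := (h (a, b) (by simp)).2.2.2.2.1
      rcases lt_or_gt_of_ne hne with hab | hab
      · exact hS.length_le_of_lt hε hM ih hn hQ h hab
      · have hs := hS.length_le_of_lt (u₁ := u₂) (u₂ := u₁) (a := b) (b := a)
          (Q := Q.map Prod.swap) hε hM ih (by simpa using hn)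
          (by
            have : (b, a) :: Q.map Prod.swap = ((a, b) :: Q).map Prod.swap := by simp
            rw [this, Increasing, List.pairwise_map]
            exact hQ.imp fun h => ⟨h.2, h.1⟩)
          (by
            have : (b, a) :: Q.map Prod.swap = ((a, b) :: Q).map Prod.swap := by simp
            rw [this]
            intro p hp
            obtain ⟨p', hp', rfl⟩ := List.mem_map.1 hp
            have := h p' hp'
            exact ⟨this.2.2.1, this.2.2.2.1, this.1, this.2.1, this.2.2.2.2.1.symm,
              this.2.2.2.2.2.symm⟩) hab
        simp only [List.length_cons, List.length_map] at hs ⊢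
        linarith

/-- The self-matching property: few symbols of two overlapping windows with the same start can be
matched without matching a position to itself. -/
theorem IsSyncString.self_matching {α : Type*} {ε : ℝ} {S : List α} (hS : IsSyncString ε S)
    (hε : 0 ≤ ε) {u K q : ℕ} (hK : K ≤ S.length) (hq : q ≤ S.length) (huK : u ≤ K) (huq : u ≤ q)
    {Q : List (ℕ × ℕ)} (hQ : Increasing Q)
    (h : ∀ p ∈ Q, u ≤ p.1 ∧ p.1 < K ∧ u ≤ p.2 ∧ p.2 < q ∧ p.1 ≠ p.2 ∧ S[p.1]? = S[p.2]?) :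
    (1 + ε) * (2 * (Q.length : ℝ)) ≤ 2 * ε * (((K : ℝ) - u) + ((q : ℝ) - u)) := by
  have h1 : Q.length ≤ K - u := by
    have := List.subperm_of_subset (l₁ := Q.map Prod.fst) (l₂ := List.range' u (K - u))
      (List.pairwise_map.2 (hQ.imp fun h => h.1.ne)) (by
        intro x hx
        obtain ⟨p, hp, rfl⟩ := List.mem_map.1 hx
        have := h p hp
        rw [List.mem_range'_1]; omega)
    simpa using this.length_le
  have h2 : Q.length ≤ q - u := by
    have := List.subperm_of_subset (l₁ := Q.map Prod.snd) (l₂ := List.range' u (q - u))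
      (List.pairwise_map.2 (hQ.imp fun h => h.2.ne)) (by
        intro x hx
        obtain ⟨p, hp, rfl⟩ := List.mem_map.1 hx
        have := h p hp
        rw [List.mem_range'_1]; omega)
    simpa using this.length_le
  have h3 := hS.length_le hε (M := max K q) (by omega) Q.length Q u u le_rfl hQ (by omega) (by omega)
    (by intro p hp; have := h p hp; refine ⟨this.1, by omega, this.2.2.1, by omega, this.2.2.2.2⟩)
  have h1' : (Q.length : ℝ) ≤ (K : ℝ) - u := by
    rw [← Nat.cast_sub huK]; exact_mod_cast h1
  have h2' : (Q.length : ℝ) ≤ (q : ℝ) - u := by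
    rw [← Nat.cast_sub huq]; exact_mod_cast h2
  -- With M the larger of K and q, the matching bound reads |Q| ≤ ε(M - u). Adding ε times the
  -- trivial bound by the shorter window yields the factor 1 + ε and the sum of both window lengths.
  rcases le_total K q with hle | hle
  · rw [max_eq_right hle] at h3; nlinarith
  · rw [max_eq_left hle] at h3; nlinarith

end InsDel

namespace InsDel

/-! ### Decoding a position by longest common subsequences -/

/-- The next row of the table of longest common subsequences. -/
def nextRow {β : Type*} [DecidableEq β] (W : ℕ → β) (y : β) (row : ℕ → ℕ) : ℕ → ℕ
  | 0 => 0
  | q + 1 => max (nextRow W y row q) (max (row (q + 1)) (row q + if W q = y then 1 else 0))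

/-- The length of a longest common subsequence of `ys` (in reversed order) and
`W 0, …, W (q - 1)`. -/
def lcs {β : Type*} [DecidableEq β] (W : ℕ → β) (ys : List β) : ℕ → ℕ :=
  ys.foldr (nextRow W) fun _ => 0

/-- A strictly decreasing sequence of pairs. -/
abbrev Decreasing (Q : List (ℕ × ℕ)) : Prop := Q.Pairwise fun p q => q.1 < p.1 ∧ q.2 < p.2

section
variable {β : Type*} [DecidableEq β] {W : ℕ → β}

/-- A common subsequence of `ys` (in reversed order) and `W`, as a list of pairs of positions. -/
def IsMatching (W : ℕ → β) (ys : List β) (q : ℕ) (Q : List (ℕ × ℕ)) : Prop :=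
  Decreasing Q ∧ ∀ p ∈ Q, p.2 < q ∧ ys.reverse[p.1]? = some (W p.2)

theorem lcs_cons (y : β) (ys : List β) : lcs W (y :: ys) = nextRow W y (lcs W ys) := rfl

/-- Follows the recursion of `nextRow`: the latest pair of a matching avoids the last column, or
avoids the latest symbol, or consists of both. -/
theorem IsMatching.length_le {ys : List β} : ∀ {q : ℕ} {Q : List (ℕ × ℕ)},
    IsMatching W ys q Q → Q.length ≤ lcs W ys q := by
  induction ys with
  | nil =>
    intro q Q h
    rcases Q with _ | ⟨p, Q⟩
    · simp
    · have := h.2 p (by simp)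
      simp at this
  | cons y ys ih =>
    intro q
    induction q with
    | zero =>
      intro Q h
      rcases Q with _ | ⟨p, Q⟩
      · simp
      · have := h.2 p (by simp)
        simp at this
    | succ q ihq =>
      intro Q h
      rw [lcs_cons, nextRow, ← lcs_cons]
      rcases Q with _ | ⟨⟨p, u⟩, Q⟩
      · simp
      have hp := h.2 (p, u) (by simp)
      have hlt := (List.pairwise_cons.1 h.1).1
      simp only at hp hlt
      have hpl : p < ys.length + 1 := by
        have := (List.getElem?_eq_some_iff.1 hp.2).1
        simpa using this
      have hold : ∀ i < ys.length, (y :: ys).reverse[i]? = ys.reverse[i]? := by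
        intro i hi
        rw [List.reverse_cons, List.getElem?_append_left (by simpa using hi)]
      by_cases hu : u < q
      · refine le_max_of_le_left (ihq ⟨h.1, ?_⟩)
        intro r hr
        refine ⟨?_, (h.2 r hr).2⟩
        rcases List.mem_cons.1 hr with rfl | hr
        · exact hu
        · have := hlt r hr; omega
      · refine le_max_of_le_right ?_
        by_cases hpy : p < ys.length
        · refine le_max_of_le_left (ih ⟨h.1, ?_⟩)
          intro r hr
          refine ⟨(h.2 r hr).1, ?_⟩
          rw [← hold, (h.2 r hr).2]
          rcases List.mem_cons.1 hr with rfl | hr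
          · exact hpy
          · have := hlt r hr; omega
        · have hu : u = q := by omega
          have hpe : p = ys.length := by omega
          refine le_max_of_le_right ?_
          subst hu hpe
          have hy : W u = y := by
            have := hp.2
            rw [List.reverse_cons, List.getElem?_append_right (by simp)] at this
            simpa using this.symm
          rw [if_pos hy, List.length_cons]
          refine Nat.succ_le_succ (ih ⟨(List.pairwise_cons.1 h.1).2, ?_⟩)
          intro r hr
          have h1 := hlt r hr
          refine ⟨by omega, ?_⟩
          rw [← hold _ (by omega), (h.2 r (by simp [hr])).2]

/-- The branch of the maximum in `nextRow` that is attained tells how to build an optimal matching.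
-/
theorem exists_isMatching (W : ℕ → β) (ys : List β) : ∀ q : ℕ,
    ∃ Q, IsMatching W ys q Q ∧ Q.length = lcs W ys q := by
  induction ys with
  | nil => exact fun q => ⟨[], ⟨by simp, by simp⟩, rfl⟩
  | cons y ys ih =>
    intro q
    induction q with
    | zero => exact ⟨[], ⟨by simp, by simp⟩, rfl⟩
    | succ q ihq =>
      rw [lcs_cons, nextRow, ← lcs_cons]
      have hold : ∀ {i : ℕ} {b : β}, ys.reverse[i]? = some b → (y :: ys).reverse[i]? = some b := by
        intro i b h
        rw [List.reverse_cons, List.getElem?_append_left, h]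
        exact (List.getElem?_eq_some_iff.1 h).1
      rcases max_choice (lcs W (y :: ys) q)
        (max (lcs W ys (q + 1)) (lcs W ys q + if W q = y then 1 else 0)) with h | h
      · obtain ⟨Q, hQ, hl⟩ := ihq
        exact ⟨Q, ⟨hQ.1, fun p hp => ⟨(hQ.2 p hp).1.trans (Nat.lt_succ_self _), (hQ.2 p hp).2⟩⟩,
          hl.trans h.symm⟩
      · rw [h]
        rcases max_choice (lcs W ys (q + 1)) (lcs W ys q + if W q = y then 1 else 0) with h | h
        · obtain ⟨Q, hQ, hl⟩ := ih (q + 1)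
          exact ⟨Q, ⟨hQ.1, fun p hp => ⟨(hQ.2 p hp).1, hold (hQ.2 p hp).2⟩⟩, hl.trans h.symm⟩
        · rw [h]
          obtain ⟨Q, hQ, hl⟩ := ih q
          by_cases hy : W q = y
          · refine ⟨(ys.length, q) :: Q, ⟨List.pairwise_cons.2 ⟨?_, hQ.1⟩, ?_⟩, by simp [hl, hy]⟩
            · intro p hp
              refine ⟨?_, (hQ.2 p hp).1⟩
              have := (List.getElem?_eq_some_iff.1 (hQ.2 p hp).2).1
              simpa using this
            · intro p hp
              rcases List.mem_cons.1 hp with rfl | hp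
              · refine ⟨Nat.lt_succ_self _, ?_⟩
                rw [List.reverse_cons, List.getElem?_append_right (by simp)]
                simp [hy]
              · exact ⟨(hQ.2 p hp).1.trans (Nat.lt_succ_self _), hold (hQ.2 p hp).2⟩
          · exact ⟨Q, ⟨hQ.1, fun p hp => ⟨(hQ.2 p hp).1.trans (Nat.lt_succ_self _),
              hold (hQ.2 p hp).2⟩⟩, by simp [hl, hy]⟩

/-- Matchings list their latest pair first, so if P says that a word is matched to its true
position, the split is at the last correct pair. -/
theorem exists_split_of_decreasing (P : ℕ × ℕ → Prop) (Q : List (ℕ × ℕ)) :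
    (∀ p ∈ Q, ¬ P p) ∨ ∃ B p A, Q = B ++ p :: A ∧ P p ∧ ∀ r ∈ B, ¬ P r := by
  induction Q with
  | nil => simp
  | cons x Q ih =>
    by_cases hx : P x
    · exact Or.inr ⟨[], x, Q, rfl, hx, by simp⟩
    · rcases ih with h | ⟨B, p, A, rfl, hp, hB⟩
      · left; simpa [hx] using h
      · exact Or.inr ⟨x :: B, p, A, rfl, hp, by simpa [hx] using hB⟩

/-- If few of the received symbols are not genuine and few genuine symbols are missing, then a
position that maximizes the score is close to the true position. -/
theorem decoding_error {ε : ℝ} {N : ℕ}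
    (hW : ∀ (u K q : ℕ) (Q : List (ℕ × ℕ)), K ≤ N → q ≤ N → u ≤ K → u ≤ q → Increasing Q →
      (∀ p ∈ Q, u ≤ p.1 ∧ p.1 < K ∧ u ≤ p.2 ∧ p.2 < q ∧ p.1 ≠ p.2 ∧ W p.1 = W p.2) →
      2 * (Q.length : ℝ) ≤ ε * (((K : ℝ) - u) + ((q : ℝ) - u)))
    {ys : List β} {gen : ℕ → Option ℕ} {K q : ℕ} (hK : K ≤ N) (hq : q ≤ N)
    (hgen : ∀ p k, p < ys.length → gen p = some k → ys.reverse[p]? = some (W k) ∧ k < K)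
    (hmono : ∀ p p' k k', p < p' → p' < ys.length → gen p = some k → gen p' = some k' → k < k')
    (hmax : 2 * lcs W ys K + q ≤ 2 * lcs W ys q + K) :
    ∃ p u, ((p = 0 ∧ u = 0) ∨ (0 < p ∧ 0 < u ∧ p ≤ ys.length ∧ gen (p - 1) = some (u - 1))) ∧
      u ≤ K ∧ u ≤ q ∧ (1 - ε) * (((K : ℝ) - u) + ((q : ℝ) - u)) ≤
        2 * (((Finset.Ico p ys.length).filter fun i => gen i = none).card +
          ((Finset.Ico u K).filter fun k => ∀ i < ys.length, gen i ≠ some k).card) := by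
  classical
  obtain ⟨Q, ⟨hQd, hQ⟩, hl⟩ := exists_isMatching W ys q
  have hlt : ∀ r ∈ Q, r.1 < ys.length := by
    intro r hr
    have := (List.getElem?_eq_some_iff.1 (hQ r hr).2).1
    simpa using this
  -- (p, u) lies just behind the last pair of an optimal matching that puts a genuine word at its
  -- true position; it is (0, 0) if there is none. A is the matching up to there, and B, the part
  -- behind, has no correct pair.
  obtain ⟨p, u, B, A, hQe, hpu, hB, hA, hBn⟩ : ∃ (p u : ℕ) (B A : List (ℕ × ℕ)), Q = B ++ A ∧
      ((p = 0 ∧ u = 0) ∨ (0 < p ∧ 0 < u ∧ p ≤ ys.length ∧ gen (p - 1) = some (u - 1) ∧ u ≤ q)) ∧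
      (∀ r ∈ B, p ≤ r.1 ∧ u ≤ r.2) ∧ (∀ r ∈ A, r.1 < p ∧ r.2 < u) ∧
      ∀ r ∈ B, gen r.1 ≠ some r.2 := by
    rcases exists_split_of_decreasing (fun r => gen r.1 = some r.2) Q with h |
      ⟨B, ⟨p, u⟩, A, hQe, hp, hB⟩
    · exact ⟨0, 0, Q, [], by simp, Or.inl ⟨rfl, rfl⟩, by simp, by simp, h⟩
    · have hpm : (p, u) ∈ Q := by simp [hQe]
      have h1 := hlt _ hpm
      have h2 := (hQ _ hpm).1
      rw [hQe, Decreasing, List.pairwise_append, List.pairwise_cons] at hQd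
      refine ⟨p + 1, u + 1, B, (p, u) :: A, hQe, Or.inr ⟨by omega, by omega, h1, hp, h2⟩, ?_, ?_, hB⟩
      · intro r hr
        exact hQd.2.2 r hr (p, u) (by simp)
      · intro r hr
        rcases List.mem_cons.1 hr with rfl | hr
        · simp
        · have := hQd.2.1.1 r hr
          simp only at this; omega
  have huq : u ≤ q := by omega
  have hpt : p ≤ ys.length := by omega
  have huK : u ≤ K := by
    rcases hpu with h | h
    · omega
    · have := (hgen _ _ (by omega) h.2.2.2.1).2; omega
  refine ⟨p, u, by tauto, huK, huq, ?_⟩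
  have hbefore : ∀ i k, i < p → gen i = some k → k < u := by
    intro i k hi hk
    rcases hpu with h | h
    · omega
    · rcases Nat.lt_or_ge i (p - 1) with h' | h'
      · have := hmono i (p - 1) k (u - 1) h' (by omega) hk h.2.2.2.1; omega
      · have : i = p - 1 := by omega
        subst this
        rw [h.2.2.2.1] at hk
        injection hk; omega
  have hafter : ∀ i k, p ≤ i → i < ys.length → gen i = some k → u ≤ k := by
    intro i k hi hit hk
    rcases hpu with h | h
    · omega
    · have := hmono (p - 1) i (u - 1) k (by omega) hit h.2.2.2.1 hk; omega
  set ng := ((Finset.Ico p ys.length).filter fun i => gen i = none).card with hng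
  set miss := ((Finset.Ico u K).filter fun k => ∀ i < ys.length, gen i ≠ some k).card with hmiss
  have hQB : Decreasing B := (List.pairwise_append.1 (hQe ▸ hQd)).1
  -- the genuine symbols after the start
  set G : List (ℕ × ℕ) := ((List.range ys.length).reverse.filterMap
    fun i => if p ≤ i then (gen i).map (fun k => (i, k)) else none) with hG
  have hGmem : ∀ r, r ∈ G ↔ p ≤ r.1 ∧ r.1 < ys.length ∧ gen r.1 = some r.2 := by
    rintro ⟨i, k⟩
    simp only [hG, List.mem_filterMap, List.mem_reverse, List.mem_range]
    constructor
    · rintro ⟨j, hj, hjk⟩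
      split_ifs at hjk with hpj
      rw [Option.map_eq_some_iff] at hjk
      obtain ⟨k', hk', h⟩ := hjk
      simp only [Prod.mk.injEq] at h
      obtain ⟨rfl, rfl⟩ := h
      exact ⟨hpj, hj, hk'⟩
    · rintro ⟨h1, h2, h3⟩
      exact ⟨i, h2, by simp [h1, h3]⟩
  have hGd : Decreasing G := by
    rw [hG, Decreasing, List.pairwise_filterMap]
    have : (List.range ys.length).reverse.Pairwise (fun a b => b < a ∧ a < ys.length) := by
      rw [List.pairwise_reverse]
      exact List.pairwise_lt_range.imp_of_mem fun _ hb h => ⟨h, List.mem_range.1 hb⟩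
    refine this.imp ?_
    intro a b hab r hr r' hr'
    split_ifs at hr with h1
    split_ifs at hr' with h2
    obtain ⟨k, hk, rfl⟩ := Option.map_eq_some_iff.1 hr
    obtain ⟨k', hk', rfl⟩ := Option.map_eq_some_iff.1 hr'
    exact ⟨hab.1, hmono _ _ _ _ hab.1 hab.2 hk' hk⟩
  -- The competitor keeps A and then matches every later genuine word correctly. As q maximizes
  -- 2·lcs - q, this gives 2|G| + q ≤ 2|B| + K.
  have hGA : IsMatching W ys K (G ++ A) := by
    refine ⟨List.pairwise_append.2 ⟨hGd, (List.pairwise_append.1 (hQe ▸ hQd)).2.1, ?_⟩, ?_⟩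
    · intro g hg a ha
      have h1 := (hGmem g).1 hg
      have h2 := hA a ha
      have := hafter _ _ h1.1 h1.2.1 h1.2.2
      omega
    · intro r hr
      rcases List.mem_append.1 hr with hr | hr
      · have h1 := (hGmem r).1 hr
        exact (hgen _ _ h1.2.1 h1.2.2).symm
      · exact ⟨by have := hA r hr; omega, (hQ r (by rw [hQe]; simp [hr])).2⟩
  have hGA' := hGA.length_le
  rw [List.length_append] at hGA'
  have hGc : K - u ≤ G.length + miss := by
    have : Finset.Ico u K ⊆ (G.map Prod.snd).toFinset ∪
        ((Finset.Ico u K).filter fun k => ∀ i < ys.length, gen i ≠ some k) := by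
      intro k hk
      rw [Finset.mem_union, Finset.mem_filter]
      by_cases h : ∀ i < ys.length, gen i ≠ some k
      · exact Or.inr ⟨hk, h⟩
      · push Not at h
        obtain ⟨i, hi, hik⟩ := h
        left
        rw [List.mem_toFinset, List.mem_map]
        refine ⟨(i, k), (hGmem _).2 ⟨?_, hi, hik⟩, rfl⟩
        by_contra hip
        have := hbefore i k (by simpa using hip) hik
        rw [Finset.mem_Ico] at hk; omega
    have h1 := Finset.card_le_card this
    have h2 := Finset.card_union_le (G.map Prod.snd).toFinset
      ((Finset.Ico u K).filter fun k => ∀ i < ys.length, gen i ≠ some k)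
    have h3 := List.toFinset_card_le (G.map Prod.snd)
    rw [Nat.card_Ico] at h1
    rw [List.length_map] at h3
    omega
  -- the matched symbols after the start
  have hBlen : B.length = (B.filter fun r => gen r.1 = none).length +
      (B.filter fun r => ¬ gen r.1 = none).length := by
    simpa using (List.length_eq_length_filter_add (l := B) fun r => decide (gen r.1 = none))
  have hB1 : (B.filter fun r => gen r.1 = none).length ≤ ng := by
    have hnd : ((B.filter fun r => gen r.1 = none).map Prod.fst).Nodup := by
      rw [List.Nodup, List.pairwise_map]
      exact (hQB.filter _).imp fun h => h.1.ne'
    rw [← List.length_map (f := Prod.fst), ← List.toFinset_card_of_nodup hnd]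
    refine Finset.card_le_card ?_
    intro i hi
    rw [List.mem_toFinset, List.mem_map] at hi
    obtain ⟨r, hr, rfl⟩ := hi
    rw [List.mem_filter] at hr
    rw [Finset.mem_filter, Finset.mem_Ico]
    exact ⟨⟨(hB r hr.1).1, hlt r (by rw [hQe]; simp [hr.1])⟩, by simpa using hr.2⟩
  -- The genuine words in B are matched to wrong positions carrying the same word. Replacing each
  -- received index by the true position turns them into an off-diagonal self-matching, to which
  -- `hW` applies.
  have hB2 : 2 * (((B.filter fun r => ¬ gen r.1 = none).length : ℕ) : ℝ) ≤
      ε * (((K : ℝ) - u) + ((q : ℝ) - u)) := by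
    have := hW u K q ((B.filter fun r => ¬ gen r.1 = none).map
      fun r => ((gen r.1).getD 0, r.2)).reverse hK hq huK huq ?_ ?_
    · simpa using this
    · rw [Increasing, List.pairwise_reverse, List.pairwise_map]
      have hp2 := hQB.filter (fun r => ¬ gen r.1 = none)
      refine List.Pairwise.imp_of_mem ?_ hp2
      intro r r' hr hr' h
      rw [List.mem_filter] at hr hr'
      simp only [decide_not, Bool.not_eq_eq_eq_not, Bool.not_true, decide_eq_false_iff_not] at hr hr'
      obtain ⟨k, hk⟩ := Option.ne_none_iff_exists'.1 hr.2
      obtain ⟨k', hk'⟩ := Option.ne_none_iff_exists'.1 hr'.2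
      simp only [hk, hk', Option.getD_some]
      exact ⟨hmono _ _ _ _ h.1 (hlt r (by rw [hQe]; simp [hr.1])) hk' hk, h.2⟩
    · intro r hr
      rw [List.mem_reverse, List.mem_map] at hr
      obtain ⟨⟨i, v⟩, hr, rfl⟩ := hr
      rw [List.mem_filter] at hr
      simp only [decide_not, Bool.not_eq_eq_eq_not, Bool.not_true, decide_eq_false_iff_not] at hr
      obtain ⟨k, hk⟩ := Option.ne_none_iff_exists'.1 hr.2
      have hm : (i, v) ∈ Q := by rw [hQe]; simp [hr.1]
      have h1 := hB _ hr.1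
      have h2 := hlt _ hm
      have h3 := hgen _ _ h2 hk
      have h4 := hQ _ hm
      simp only [hk, Option.getD_some] at h1 h3 h4 ⊢
      refine ⟨hafter _ _ h1.1 h2 hk, h3.2, h1.2, h4.1, ?_, ?_⟩
      · rintro rfl
        exact hBn _ hr.1 hk
      · have := h3.1.symm.trans h4.2
        injection this
  rw [← hl, hQe, List.length_append] at hmax
  have e1 : (2 * (G.length : ℝ)) + q ≤ 2 * B.length + K := by
    have : 2 * G.length + q ≤ 2 * B.length + K := by omega
    exact_mod_cast this
  have e2 : (K : ℝ) - u ≤ G.length + miss := by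
    rw [← Nat.cast_sub huK]; exact_mod_cast hGc
  have e3 : (B.length : ℝ) ≤ ng + (B.filter fun r => ¬ gen r.1 = none).length := by
    rw [hBlen]; push_cast
    have : (((B.filter fun r => gen r.1 = none).length : ℕ) : ℝ) ≤ ng := by exact_mod_cast hB1
    linarith
  -- The weight 2 of lcs in the score pays off here: 2(K - u) + q - K is (K - u) + (q - u), so
  -- excess on either side is controlled.
  linarith

end
end InsDel

namespace InsDel

/-! ### The two strategies and their local histories -/

/-- The bits that the intermediary has received from the channel. -/
def received (h : List Event) : List Bool :=
  h.filterMap fun e => match e with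
    | .channel b => some b
    | _ => none

section
variable (h h' : List Event) (b : Bool)

@[simp] theorem given_append : given (h ++ h') = given h ++ given h' := List.filterMap_append
@[simp] theorem revealed_append : revealed (h ++ h') = revealed h ++ revealed h' :=
  List.filterMap_append
@[simp] theorem sent_append : sent (h ++ h') = sent h ++ sent h' := List.filterMap_append
@[simp] theorem received_append : received (h ++ h') = received h ++ received h' :=
  List.filterMap_append
@[simp] theorem given_nil : given [] = [] := rfl
@[simp] theorem revealed_nil : revealed [] = [] := rfl
@[simp] theorem sent_nil : sent [] = [] := rfl
@[simp] theorem received_nil : received [] = [] := rfl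
@[simp] theorem given_user : given (.user b :: h) = b :: given h := rfl
@[simp] theorem given_channel : given (.channel b :: h) = given h := rfl
@[simp] theorem given_reveal : given (.did (.reveal b) :: h) = given h := rfl
@[simp] theorem given_send : given (.did (.send b) :: h) = given h := rfl
@[simp] theorem revealed_user : revealed (.user b :: h) = revealed h := rfl
@[simp] theorem revealed_channel : revealed (.channel b :: h) = revealed h := rfl
@[simp] theorem revealed_reveal : revealed (.did (.reveal b) :: h) = b :: revealed h := rfl
@[simp] theorem revealed_send : revealed (.did (.send b) :: h) = revealed h := rfl
@[simp] theorem sent_user : sent (.user b :: h) = sent h := rfl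
@[simp] theorem sent_channel : sent (.channel b :: h) = sent h := rfl
@[simp] theorem sent_reveal : sent (.did (.reveal b) :: h) = sent h := rfl
@[simp] theorem sent_send : sent (.did (.send b) :: h) = b :: sent h := rfl
@[simp] theorem received_user : received (.user b :: h) = received h := rfl
@[simp] theorem received_channel : received (.channel b :: h) = b :: received h := rfl
@[simp] theorem received_reveal : received (.did (.reveal b) :: h) = received h := rfl
@[simp] theorem received_send : received (.did (.send b) :: h) = received h := rfl

end

/-- The bit that Alice's intermediary sends next. -/
def aliceBit (isData header : ℕ → Bool) (h : List Event) : Bool :=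
  if isData (sent h).length then (given h).getLastD true else header (sent h).length

/-- Alice's intermediary works by its own clock, the number of bits sent so far. In the rounds of
the set `isData` it transmits Alice's bits and reveals the replies; in the other rounds it sends
the bits of `header`. -/
def aliceStrategy (isData header : ℕ → Bool) (m : ℕ) : Strategy := fun h =>
  match h.getLast? with
  | some (.channel b) =>
    if isData ((sent h).length - 1) ∧ (revealed h).length < m then .reveal b
    else .send (aliceBit isData header h)
  | _ => .send (aliceBit isData header h)

theorem aliceStrategy_of_reveal {isData header : ℕ → Bool} {m : ℕ} {h : List Event} {b : Bool}
    (hact : aliceStrategy isData header m h = .reveal b) : h.getLast? = some (.channel b) ∧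
      isData ((sent h).length - 1) ∧ (revealed h).length < m := by
  unfold aliceStrategy at hact
  split at hact
  · rename_i b' hb'
    by_cases hc : isData ((sent h).length - 1) ∧ (revealed h).length < m
    · rw [if_pos hc] at hact
      injection hact with e
      exact ⟨e ▸ hb', hc⟩
    · rw [if_neg hc] at hact
      cases hact
  · cases hact

theorem aliceStrategy_of_send {isData header : ℕ → Bool} {m : ℕ} {h : List Event} {b : Bool}
    (hact : aliceStrategy isData header m h = .send b) : b = aliceBit isData header h ∧
      ∀ b', h.getLast? = some (.channel b') →
        ¬ (isData ((sent h).length - 1) ∧ (revealed h).length < m) := by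
  unfold aliceStrategy at hact
  split at hact
  · rename_i b' hb'
    by_cases hc : isData ((sent h).length - 1) ∧ (revealed h).length < m
    · rw [if_pos hc] at hact
      cases hact
    · rw [if_neg hc] at hact
      injection hact with e
      exact ⟨e.symm, fun _ _ => hc⟩
  · rename_i hne
    injection hact with e
    exact ⟨e.symm, fun b' hb' => absurd hb' (hne b')⟩

/-- Bob's intermediary reveals the last received bit until `target` bits are revealed, and sends
the last bit given by Bob. -/
def bobStrategy (target : List Bool → ℕ) (m : ℕ) : Strategy := fun h =>
  if (revealed h).length < min m (target (received h)) then
    .reveal ((received h).getLastD false)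
  else .send ((given h).getLastD false)

/-- Alice's local histories at the times when her intermediary has to act. -/
inductive AliceHistory (C : Strategy) (m : ℕ) (user : Side → List Bool → Bool) :
    List Event → Prop
  | start (b : Bool) : AliceHistory C m user [.user b]
  | reveal {h b} : AliceHistory C m user h → C h = .reveal b →
      AliceHistory C m user
        (h ++ [.did (.reveal b)] ++ response m user .A (revealed h ++ [b]))
  | send {h b b'} : AliceHistory C m user h → C h = .send b →
      AliceHistory C m user (h ++ [.did (.send b), .channel b'])

/-- Bob's local histories at the times when his intermediary has to act. -/
inductive BobHistory (C : Strategy) (m : ℕ) (user : Side → List Bool → Bool) :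
    List Event → Prop
  | start (b : Bool) : BobHistory C m user [.channel b]
  | reveal {h b} : BobHistory C m user h → C h = .reveal b →
      BobHistory C m user
        (h ++ [.did (.reveal b)] ++ response m user .B (revealed h ++ [b]))
  | send {h b b'} : BobHistory C m user h → C h = .send b →
      BobHistory C m user (h ++ [.did (.send b), .channel b'])

/-- What holds for Alice's local history; `P` is the number of completely processed rounds. -/
structure AliceInv (isData header : ℕ → Bool) (m : ℕ) (h : List Event) (P : ℕ) : Prop where
  sent_length : (sent h).length = (received h).length
  processed : P = (received h).length ∨
    (P + 1 = (received h).length ∧ ∃ b, h.getLast? = some (.channel b) ∧ isData P ∧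
      (revealed h).length < m)
  pending : ∀ b, h.getLast? = some (.channel b) → (received h)[(received h).length - 1]? = some b ∧
    0 < (received h).length ∧ (isData ((received h).length - 1) → (revealed h).length < m →
      P + 1 = (received h).length)
  revealed_length : (revealed h).length = min m (Nat.count (fun a => isData a) P)
  given_length : (given h).length = max 1 (min m ((revealed h).length + 1))
  revealed_eq : ∀ a < P, isData a → Nat.count (fun a => isData a) a < m →
    (revealed h)[Nat.count (fun a => isData a) a]? = (received h)[a]?
  sent_data : ∀ a < (sent h).length, isData a → Nat.count (fun a => isData a) a < m →
    (sent h)[a]? = (given h)[Nat.count (fun a => isData a) a]?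
  sent_header : ∀ a < (sent h).length, isData a = false → (sent h)[a]? = some (header a)

/-- In Alice's history every sent bit is followed by a received one, be it a reply or a bounced
symbol, so equal positions in the two streams belong to the same tick of her clock. Only between the
receipt of a data reply and its revelation does P lag behind by one. The `max 1` in `given_length`
is there for m = 0, because her first bit is given in any case. -/
theorem aliceInv {isData header : ℕ → Bool} {m : ℕ} {user : Side → List Bool → Bool}
    {h : List Event} (hh : AliceHistory (aliceStrategy isData header m) m user h) :
    ∃ P, AliceInv isData header m h P := by
  induction hh with
  | start b =>
    refine ⟨0, ⟨rfl, Or.inl rfl, by simp, by simp, ?_, by simp, by simp, by simp⟩⟩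
    simp
  | @reveal h b hh hact ih =>
    obtain ⟨P, ih⟩ := ih
    have hb : h.getLast? = some (.channel b) ∧ isData ((sent h).length - 1) ∧
        (revealed h).length < m := aliceStrategy_of_reveal hact
    have hp := ih.pending b hb.1
    have hP : P + 1 = (received h).length := hp.2.2 (by rw [← ih.sent_length]; exact hb.2.1) hb.2.2
    have hdP : isData P = true := by
      have := hb.2.1
      rw [ih.sent_length, ← hP] at this
      simpa using this
    have hcnt : Nat.count (fun a => isData a) (P + 1) = Nat.count (fun a => isData a) P + 1 := by
      rw [Nat.count_succ, if_pos hdP]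
    have hlt : Nat.count (fun a => isData a) P < m := by
      have := ih.revealed_length
      have := hb.2.2
      omega
    have hrl : (revealed h).length = Nat.count (fun a => isData a) P := by
      rw [ih.revealed_length]; omega
    -- `l` is Alice's response, which is missing after the m-th revealed bit.
    have key : ∀ l, (l = [] ∧ m ≤ (revealed h).length + 1 ∨ ∃ u, l = [Event.user u] ∧
        (revealed h).length + 1 < m) → AliceInv isData header m (h ++ [.did (.reveal b)] ++ l)
          (P + 1) := by
      intro l hl
      have el : sent l = [] ∧ received l = [] ∧ revealed l = [] := by
        rcases hl with ⟨rfl, -⟩ | ⟨u, rfl, -⟩ <;> simp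
      obtain ⟨el1, el2, el3⟩ := el
      have hlast : ∀ b', (h ++ [Event.did (.reveal b)] ++ l).getLast? ≠ some (.channel b') := by
        rcases hl with ⟨rfl, -⟩ | ⟨u, rfl, -⟩ <;> simp
      refine ⟨?_, ?_, fun b' hb' => absurd hb' (hlast b'), ?_, ?_, ?_, ?_, ?_⟩
      · simpa [el1, el2] using ih.sent_length
      · left; simp [el2, hP]
      · simp only [revealed_append, revealed_reveal, revealed_nil, el3, List.append_nil,
          List.length_append, List.length_singleton, hcnt]
        omega
      · have := ih.given_length
        rcases hl with ⟨rfl, h'⟩ | ⟨u, rfl, h'⟩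
        · simp
          omega
        · simp
          omega
      · intro a ha hda hca
        simp only [revealed_append, revealed_reveal, revealed_nil, el3, List.append_nil,
          received_append, received_reveal, received_nil, el2]
        rcases Nat.lt_succ_iff_lt_or_eq.1 ha with ha' | rfl
        · rw [List.getElem?_append_left, ih.revealed_eq a ha' hda hca]
          have := Nat.count_strict_mono (p := fun a => isData a = true) hda ha'
          omega
        · rw [← hrl, List.getElem?_append_right le_rfl]
          have := hp.1
          rw [← hP] at this
          simpa using this.symm
      · intro a ha hda hca
        simp only [sent_append, sent_reveal, sent_nil, el1, List.append_nil] at ha ⊢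
        rw [ih.sent_data a ha hda hca]
        simp only [given_append, given_reveal, given_nil, List.append_nil]
        rw [List.getElem?_append_left]
        have h1 : a < P + 1 := by rw [hP, ← ih.sent_length]; exact ha
        have h2 : Nat.count (fun a => isData a) a ≤ Nat.count (fun a => isData a) P :=
          Nat.count_monotone _ (by omega)
        have := ih.given_length
        omega
      · intro a ha hda
        simp only [sent_append, sent_reveal, sent_nil, el1, List.append_nil] at ha ⊢
        exact ih.sent_header a ha hda
    refine ⟨P + 1, key _ ?_⟩
    have hr := hb.2.2
    by_cases hm : m ≤ (revealed h).length + 1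
    · left; simp [response, hm]
    · right; exact ⟨user .A (revealed h ++ [b]), by simp [response, hm], by omega⟩
  | @send h b b' hh hact ih =>
    obtain ⟨P, ih⟩ := ih
    -- nothing is pending
    obtain ⟨hbit, hnp⟩ := aliceStrategy_of_send hact
    have hP : P = (received h).length := by
      rcases ih.processed with hP | ⟨hP, b₀, hb₀, hd, hr⟩
      · exact hP
      · refine absurd ⟨?_, hr⟩ (hnp b₀ hb₀)
        rw [ih.sent_length, ← hP, Nat.add_sub_cancel, hd]
    rw [aliceBit] at hbit
    have hlen : (received (h ++ [.did (.send b), .channel b'])).length = P + 1 := by simp [hP]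
    have hrev : revealed (h ++ [.did (.send b), .channel b']) = revealed h := by simp
    have hgiv : given (h ++ [.did (.send b), .channel b']) = given h := by simp
    have hlastP : (received (h ++ [.did (.send b), .channel b']))[P]? = some b' := by
      simp [hP]
    -- P' is P if the new bit still has to be revealed, and P + 1 if the round is finished at once.
    have common : ∀ P', (P' = P ∨ (P' = P + 1 ∧ (isData P = false ∨ m ≤ (revealed h).length))) →
        (P' = P → isData P = true ∧ (revealed h).length < m) →
        AliceInv isData header m (h ++ [.did (.send b), .channel b']) P' := by
      intro P' hP' hPP
      have hcnt : min m (Nat.count (fun a => isData a) P') =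
          min m (Nat.count (fun a => isData a) P) := by
        rcases hP' with rfl | ⟨rfl, h' | h'⟩
        · rfl
        · rw [Nat.count_succ]; simp [h']
        · have := ih.revealed_length
          have := Nat.count_monotone (fun a => isData a = true) (Nat.le_add_right P 1)
          omega
      refine ⟨by simp [ih.sent_length], ?_, ?_, ?_, ?_, ?_, ?_, ?_⟩
      · rw [hlen, hrev]
        rcases hP' with rfl | ⟨rfl, h'⟩
        · exact Or.inr ⟨rfl, b', by simp, hPP rfl⟩
        · exact Or.inl rfl
      · intro b₀ hb₀
        rw [hlen]
        have : b' = b₀ := by simpa using hb₀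
        subst this
        refine ⟨by simpa using hlastP, by omega, ?_⟩
        intro h1 h2
        simp only [Nat.add_sub_cancel] at h1
        rw [hrev] at h2
        rcases hP' with rfl | ⟨rfl, h' | h'⟩
        · rfl
        · simp [h1] at h'
        · omega
      · rw [hrev, hcnt, ih.revealed_length]
      · rw [hrev, hgiv, ih.given_length]
      · intro a ha hda hca
        have haP : a < P := by
          rcases hP' with rfl | ⟨rfl, h' | h'⟩
          · exact ha
          · rcases Nat.lt_succ_iff_lt_or_eq.1 ha with h | rfl
            · exact h
            · simp [hda] at h'
          · rcases Nat.lt_succ_iff_lt_or_eq.1 ha with h | rfl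
            · exact h
            · have := ih.revealed_length
              omega
        rw [hrev, ih.revealed_eq a haP hda hca, received_append,
          List.getElem?_append_left (by omega)]
      · intro a ha hda hca
        rw [hgiv]
        simp only [sent_append, sent_send, sent_channel, sent_nil, List.length_append,
          List.length_singleton] at ha ⊢
        rcases Nat.lt_succ_iff_lt_or_eq.1 ha with h' | rfl
        · rw [List.getElem?_append_left h', ih.sent_data a h' hda hca]
        · rw [List.getElem?_append_right le_rfl]
          rw [if_pos hda] at hbit
          have h1 := ih.given_length
          have h2 := ih.revealed_length
          rw [ih.sent_length, ← hP] at hca ⊢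
          have h3 : Nat.count (fun a => isData a) P = (given h).length - 1 := by omega
          rw [h3, ← List.getLast?_eq_getElem?]
          have hne : given h ≠ [] := by
            intro h0; rw [h0] at h1; simp at h1; omega
          rw [List.getLast?_eq_getLast_of_ne_nil hne, hbit, List.getLastD_eq_getLast?,
            List.getLast?_eq_getLast_of_ne_nil hne]
          simp
      · intro a ha hda
        simp only [sent_append, sent_send, sent_channel, sent_nil, List.length_append,
          List.length_singleton] at ha ⊢
        rcases Nat.lt_succ_iff_lt_or_eq.1 ha with h' | rfl
        · rw [List.getElem?_append_left h', ih.sent_header a h' hda]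
        · rw [List.getElem?_append_right le_rfl]
          simp [hbit, hda]
    by_cases hpend : isData P = true ∧ (revealed h).length < m
    · exact ⟨P, common P (Or.inl rfl) fun _ => hpend⟩
    · refine ⟨P + 1, common (P + 1) (Or.inr ⟨rfl, ?_⟩) (by omega)⟩
      by_contra hc
      push Not at hc
      exact hpend ⟨by simpa using hc.1, hc.2⟩

/-- The number of bits that Bob's intermediary reveals up to its `τ`-th received bit. -/
def revealedUpTo (target : List Bool → ℕ) (m : ℕ) (c : List Bool) (τ : ℕ) : ℕ :=
  (Finset.Icc 1 τ).sup fun t => min m (target (c.take t))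

theorem revealedUpTo_succ (target : List Bool → ℕ) (m : ℕ) (c : List Bool) (τ : ℕ) :
    revealedUpTo target m c (τ + 1) =
      max (revealedUpTo target m c τ) (min m (target (c.take (τ + 1)))) := by
  unfold revealedUpTo
  rw [← Finset.insert_Icc_right_eq_Icc_add_one (by omega), Finset.sup_insert, max_comm]

theorem revealedUpTo_append (target : List Bool → ℕ) (m : ℕ) (c c' : List Bool) {τ : ℕ}
    (h : τ ≤ c.length) : revealedUpTo target m (c ++ c') τ = revealedUpTo target m c τ := by
  unfold revealedUpTo
  refine Finset.sup_congr rfl fun t ht => ?_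
  rw [Finset.mem_Icc] at ht
  rw [List.take_append_of_le_length (by omega)]

theorem revealedUpTo_le (target : List Bool → ℕ) (m : ℕ) (c : List Bool) (τ : ℕ) :
    revealedUpTo target m c τ ≤ m :=
  Finset.sup_le fun _ _ => min_le_left _ _

/-- What holds for Bob's local history. -/
structure BobInv (target : List Bool → ℕ) (m : ℕ) (h : List Event) : Prop where
  sent_length : (sent h).length + 1 = (received h).length
  given_length : (given h).length = (revealed h).length
  lower : revealedUpTo target m (received h) (sent h).length ≤ (revealed h).length
  upper : (revealed h).length ≤ revealedUpTo target m (received h) (received h).length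
  revealed_eq : ∀ τ < (received h).length, ∀ i < (revealed h).length,
    revealedUpTo target m (received h) τ ≤ i → i < revealedUpTo target m (received h) (τ + 1) →
    (revealed h)[i]? = (received h)[τ]?
  sent_eq : ∀ τ < (sent h).length, ∀ i, revealedUpTo target m (received h) (τ + 1) = i + 1 →
    (sent h)[τ]? = (given h)[i]?

/-- The targets may fall, but revealed bits cannot be taken back, so the number of revealed bits
follows the running maximum of the capped targets. All bits revealed upon one reception are copies
of the bit received then, and the bit sent back is Bob's answer to the last revealed one. -/
theorem bobInv {target : List Bool → ℕ} {m : ℕ} {user : Side → List Bool → Bool}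
    {h : List Event} (hh : BobHistory (bobStrategy target m) m user h) :
    BobInv target m h := by
  induction hh with
  | start b =>
    refine ⟨by simp, by simp, ?_, by simp, by simp, by simp⟩
    simp [revealedUpTo]
  | @reveal h b hh hact ih =>
    have hb : (revealed h).length < min m (target (received h)) ∧
        b = (received h).getLastD false := by
      unfold bobStrategy at hact
      split_ifs at hact with hc
      injection hact with e
      exact ⟨hc, e.symm⟩
    have hresp : response m user .B (revealed h ++ [b]) = [.user (user .B (revealed h ++ [b]))] := by
      simp [response]
    rw [hresp]
    have e1 : revealed (h ++ [.did (.reveal b)] ++ [.user (user .B (revealed h ++ [b]))]) =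
      revealed h ++ [b] := by simp
    have e2 : received (h ++ [.did (.reveal b)] ++ [.user (user .B (revealed h ++ [b]))]) =
      received h := by simp
    have e3 : sent (h ++ [.did (.reveal b)] ++ [.user (user .B (revealed h ++ [b]))]) =
      sent h := by simp
    have hup : min m (target (received h)) ≤
        revealedUpTo target m (received h) (received h).length := by
      rw [← ih.sent_length, revealedUpTo_succ, ih.sent_length, List.take_length]
      exact le_max_right _ _
    refine ⟨?_, ?_, ?_, ?_, ?_, ?_⟩
    · rw [e2, e3, ih.sent_length]
    · simp [ih.given_length]
    · rw [e1, e2, e3]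
      simpa using ih.lower.trans (Nat.le_succ _)
    · rw [e1, e2]; simp; omega
    · rw [e1, e2]
      intro τ hτ i hi h1 h2
      simp only [List.length_append, List.length_singleton] at hi
      rcases Nat.lt_succ_iff_lt_or_eq.1 hi with h' | rfl
      · rw [List.getElem?_append_left h', ih.revealed_eq τ hτ i h' h1 h2]
      -- The bit revealed now belongs to the latest reception, since by `lower` the quota of all
      -- earlier ones is already filled.
      · have hτe : τ = (sent h).length := by
          by_contra hne
          have hlt : τ + 1 ≤ (sent h).length := by have := ih.sent_length; omega
          have := ih.lower
          have hm : revealedUpTo target m (received h) (τ + 1) ≤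
              revealedUpTo target m (received h) (sent h).length :=
            Finset.sup_mono (Finset.Icc_subset_Icc le_rfl hlt)
          omega
        rw [List.getElem?_append_right le_rfl, Nat.sub_self]
        have hne : received h ≠ [] := by
          intro h0; have := ih.sent_length; rw [h0] at this; simp at this
        have : τ = (received h).length - 1 := by have := ih.sent_length; omega
        rw [this, ← List.getLast?_eq_getElem?, hb.2, List.getLastD_eq_getLast?,
          List.getLast?_eq_getLast_of_ne_nil hne]
        simp
    · rw [e2, e3]
      intro τ hτ i hi
      rw [ih.sent_eq τ hτ i hi]
      simp only [given_append, given_reveal, given_nil, List.append_nil]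
      rw [List.getElem?_append_left]
      have := ih.lower
      have hm : revealedUpTo target m (received h) (τ + 1) ≤
          revealedUpTo target m (received h) (sent h).length :=
        Finset.sup_mono (Finset.Icc_subset_Icc le_rfl hτ)
      have := ih.given_length
      omega
  | @send h b b' hh hact ih =>
    have hb : min m (target (received h)) ≤ (revealed h).length ∧
        b = (given h).getLastD false := by
      unfold bobStrategy at hact
      split_ifs at hact with hc
      injection hact with e
      exact ⟨not_lt.1 hc, e.symm⟩
    have hrl : (revealed h).length =
        revealedUpTo target m (received h) (received h).length := by
      refine le_antisymm ih.upper ?_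
      rw [← ih.sent_length, revealedUpTo_succ, ih.sent_length, List.take_length]
      exact max_le ih.lower hb.1
    have e1 : revealed (h ++ [.did (.send b), .channel b']) = revealed h := by simp
    have e2 : received (h ++ [.did (.send b), .channel b']) = received h ++ [b'] := by simp
    have e3 : sent (h ++ [.did (.send b), .channel b']) = sent h ++ [b] := by simp
    have e4 : given (h ++ [.did (.send b), .channel b']) = given h := by simp
    have hup : ∀ τ ≤ (received h).length, revealedUpTo target m (received h ++ [b']) τ =
        revealedUpTo target m (received h) τ := fun τ hτ => revealedUpTo_append _ _ _ _ hτ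
    refine ⟨?_, ?_, ?_, ?_, ?_, ?_⟩
    · rw [e2, e3]; simp [ih.sent_length]
    · rw [e1, e4, ih.given_length]
    · rw [e1, e2, e3, hup _ (by simp [ih.sent_length])]
      simp [ih.sent_length, hrl]
    · rw [e1, e2, hrl, ← hup _ le_rfl]
      exact Finset.sup_mono (Finset.Icc_subset_Icc le_rfl (by simp))
    · rw [e1, e2]
      intro τ hτ i hi h1 h2
      simp only [List.length_append, List.length_singleton] at hτ
      rcases Nat.lt_succ_iff_lt_or_eq.1 hτ with h' | rfl
      · rw [hup _ (by omega)] at h1 h2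
        rw [List.getElem?_append_left h', ih.revealed_eq τ h' i hi h1 h2]
      · rw [hup _ le_rfl] at h1
        omega
    · rw [e2, e3, e4]
      intro τ hτ i hi
      simp only [List.length_append, List.length_singleton] at hτ
      have hs := ih.sent_length
      rw [hup _ (by omega)] at hi
      rcases Nat.lt_succ_iff_lt_or_eq.1 hτ with h' | rfl
      · rw [List.getElem?_append_left h', ih.sent_eq τ h' i hi]
      · rw [List.getElem?_append_right le_rfl, Nat.sub_self]
        rw [hs, ← hrl, ← ih.given_length] at hi
        have hne : given h ≠ [] := by
          intro h0; rw [h0] at hi; simp at hi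
        have : i = (given h).length - 1 := by omega
        rw [this, ← List.getLast?_eq_getElem?, hb.2, List.getLastD_eq_getLast?,
          List.getLast?_eq_getLast_of_ne_nil hne]
        simp

end InsDel

namespace InsDel

/-! ### Traces of the insertion-deletion channel -/

/-- A use of the channel: `b` is sent and `b'` is delivered, to the other end or to the sender. -/
inductive Transmission
  | forward (b b' : Bool)
  | reply (b b' : Bool)
  | bounceA (b b' : Bool)
  | bounceB (b b' : Bool)

namespace Transmission

/-- The transmission was certainly corrupted. -/
def isError : Transmission → Bool
  | forward b b' => b != b'
  | reply b b' => b != b'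
  | bounceA _ _ => true
  | bounceB _ _ => true

def sentA : Transmission → Option Bool
  | forward b _ => some b
  | bounceA b _ => some b
  | _ => none

def sentB : Transmission → Option Bool
  | reply b _ => some b
  | bounceB b _ => some b
  | _ => none

def recvA : Transmission → Option Bool
  | reply _ b => some b
  | bounceA _ b => some b
  | _ => none

def recvB : Transmission → Option Bool
  | forward _ b => some b
  | bounceB _ b => some b
  | _ => none

end Transmission

open Transmission

/-- The sequences of transmissions after which it is the turn of the given side. -/
inductive Trace : Side → List Transmission → Prop
  | nil : Trace .A []
  | forward {tr} (b b' : Bool) : Trace .A tr → Trace .B (tr ++ [.forward b b'])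
  | reply {tr} (b b' : Bool) : Trace .B tr → Trace .A (tr ++ [.reply b b'])
  | bounceA {tr} (b b' : Bool) : Trace .A tr → Trace .A (tr ++ [.bounceA b b'])
  | bounceB {tr} (b b' : Bool) : Trace .B tr → Trace .B (tr ++ [.bounceB b b'])

theorem Trace.lengths {s : Side} {tr : List Transmission} (h : Trace s tr) :
    (s = .A → (tr.filterMap sentA).length = (tr.filterMap recvA).length ∧
      (tr.filterMap sentB).length = (tr.filterMap recvB).length) ∧
    (s = .B → (tr.filterMap sentA).length = (tr.filterMap recvA).length + 1 ∧
      (tr.filterMap sentB).length + 1 = (tr.filterMap recvB).length) := by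
  induction h <;> simp_all [sentA, sentB, recvA, recvB, List.filterMap_cons]

/-- Cuts a trace at a transmission, so that the counts of `Trace.lengths` become available in the
middle of a run. -/
theorem Trace.append {s : Side} {tr : List Transmission} (h : Trace s tr) :
    ∀ tr₁ e tr₂, tr = tr₁ ++ e :: tr₂ → ∃ s', Trace s' tr₁ ∧ Trace (match e with
      | .forward _ _ => .B | .reply _ _ => .A | .bounceA _ _ => .A | .bounceB _ _ => .B)
        (tr₁ ++ [e]) ∧ (s' = .A ↔ (sentA e).isSome) := by
  have key : ∀ (s s' : Side) (tr : List Transmission) (e : Transmission), Trace s tr →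
      (s = .A ↔ (sentA e).isSome) → Trace (match e with
      | .forward _ _ => .B | .reply _ _ => .A | .bounceA _ _ => .A | .bounceB _ _ => .B)
        (tr ++ [e]) → (∀ tr₁ e tr₂, tr = tr₁ ++ e :: tr₂ → ∃ s', Trace s' tr₁ ∧ Trace (match e with
      | .forward _ _ => .B | .reply _ _ => .A | .bounceA _ _ => .A | .bounceB _ _ => .B)
        (tr₁ ++ [e]) ∧ (s' = .A ↔ (sentA e).isSome)) →
      ∀ tr₁ e' tr₂, tr ++ [e] = tr₁ ++ e' :: tr₂ → ∃ s', Trace s' tr₁ ∧ Trace (match e' with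
      | .forward _ _ => .B | .reply _ _ => .A | .bounceA _ _ => .A | .bounceB _ _ => .B)
        (tr₁ ++ [e']) ∧ (s' = .A ↔ (sentA e').isSome) := by
    intro s s' tr e htr hs htr' ih tr₁ e' tr₂ heq
    rcases List.eq_nil_or_concat tr₂ with rfl | ⟨L, l, rfl⟩
    · obtain ⟨rfl, h2⟩ := List.append_inj' heq rfl
      simp only [List.cons.injEq, and_true] at h2
      subst h2
      exact ⟨s, htr, htr', hs⟩
    · rw [List.concat_eq_append, ← List.cons_append, ← List.append_assoc] at heq
      obtain ⟨h1, -⟩ := List.append_inj' heq rfl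
      exact ih _ _ _ h1
  induction h with
  | nil => simp
  | forward b b' h ih => exact key _ .A _ _ h (by simp [sentA]) (.forward b b' h) ih
  | reply b b' h ih => exact key _ .A _ _ h (by simp [sentA]) (.reply b b' h) ih
  | bounceA b b' h ih => exact key _ .A _ _ h (by simp [sentA]) (.bounceA b b' h) ih
  | bounceB b b' h ih => exact key _ .A _ _ h (by simp [sentA]) (.bounceB b b' h) ih

/-- A forward raises both counts and a reply neither; only the two kinds of bounce, which are
errors, shift them against each other. -/
theorem length_recvB_le (tr : List Transmission) :
    (tr.filterMap recvB).length ≤ (tr.filterMap sentA).length + (tr.filter isError).length ∧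
    (tr.filterMap sentA).length ≤ (tr.filterMap recvB).length + (tr.filter isError).length := by
  induction tr with
  | nil => simp
  | cons e tr ih =>
    cases e with
    | forward b b' => by_cases h : b = b' <;> simp [sentA, recvB, isError, h, List.filter_cons] <;> omega
    | reply b b' => by_cases h : b = b' <;> simp [sentA, recvB, isError, h, List.filterMap_cons, List.filter_cons] <;> omega
    | bounceA b b' => simp [sentA, recvB, isError, List.filterMap_cons, List.filter_cons]; omega
    | bounceB b b' => simp [sentA, recvB, isError, List.filterMap_cons, List.filter_cons]; omega

/-- What holds in every reachable state. -/
structure RunInv (n m : ℕ) (user : Side → List Bool → Bool) (C : Side → Strategy) (cfg : Config)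
    (tr : List Transmission) : Prop where
  trace : Trace cfg.turn tr
  errors : (tr.filter isError).length ≤ cfg.edits
  sentA_eq : tr.filterMap sentA = sent (cfg.hist .A)
  sentB_eq : tr.filterMap sentB = sent (cfg.hist .B)
  recvA_eq : tr.filterMap recvA = received (cfg.hist .A)
  recvB_eq : tr.filterMap recvB = received (cfg.hist .B)
  limitA : (sent (cfg.hist .A)).length ≤ n / 2
  limitB : (sent (cfg.hist .B)).length ≤ n / 2
  turnA : cfg.turn = .A → AliceHistory (C .A) m user (cfg.hist .A) ∧ (cfg.hist .B = [] ∨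
    ∃ h b, BobHistory (C .B) m user h ∧ C .B h = .send b ∧ cfg.hist .B = h ++ [.did (.send b)])
  turnB : cfg.turn = .B → BobHistory (C .B) m user (cfg.hist .B) ∧
    ∃ h b, AliceHistory (C .A) m user h ∧ C .A h = .send b ∧ cfg.hist .A = h ++ [.did (.send b)]

theorem sent_response (m : ℕ) (user : Side → List Bool → Bool) (p : Side) (l : List Bool) :
    sent (response m user p l) = [] := by
  unfold response; split_ifs <;> simp

theorem received_response (m : ℕ) (user : Side → List Bool → Bool) (p : Side) (l : List Bool) :
    received (response m user p l) = [] := by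
  unfold response; split_ifs <;> simp

/-- Serves `deliver` (k = 0) and `substitute` (k = 1) together. A substitution that happens to
deliver the sent bit is no error of the trace, so `errors` is only an inequality. -/
theorem RunInv.transmit {n m : ℕ} {user : Side → List Bool → Bool} {C : Side → Strategy}
    {cfg : Config} {tr : List Transmission} (ih : RunInv n m user C cfg tr) (b b' : Bool) (k : ℕ)
    (act : C cfg.turn (cfg.hist cfg.turn) = .send b)
    (left : (sent (cfg.hist cfg.turn)).length < n / 2) (hk : b = b' ∨ 1 ≤ k) :
    ∃ tr', RunInv n m user C ⟨cfg.turn.other,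
          Function.update
            (Function.update cfg.hist cfg.turn (cfg.hist cfg.turn ++ [.did (.send b)]))
            cfg.turn.other (cfg.hist cfg.turn.other ++ [.channel b']),
          cfg.edits + k⟩ tr' := by
  have herr : ∀ e : Transmission, e.isError = (b != b') →
      ((tr ++ [e]).filter isError).length ≤ cfg.edits + k := by
    intro e he
    have := ih.errors
    rw [List.filter_append, List.length_append]
    rcases hk with rfl | hk
    · simp [he]; omega
    · have : ([e].filter isError).length ≤ 1 := List.length_filter_le _ _
      omega
  rcases cfg with ⟨turn, hist, edits⟩
  cases turn with
  | A =>
    obtain ⟨hA, hB⟩ := ih.turnA rfl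
    have e1 := ih.sentA_eq
    have e2 := ih.sentB_eq
    have e3 := ih.recvA_eq
    have e4 := ih.recvB_eq
    have l2 := ih.limitB
    simp only [Side.other] at *
    refine ⟨tr ++ [.forward b b'], .forward b b' ih.trace, herr _ rfl, ?_, ?_, ?_, ?_, ?_, ?_,
      by simp, fun _ => ⟨?_, hist .A, b, hA, act, by simp [Function.update]⟩⟩
    · simp [sentA, e1, Function.update]
    · simp [sentB, e2, Function.update]
    · simp [recvA, e3, Function.update]
    · simp [recvB, e4, Function.update]
    · simpa [Function.update] using left
    · simpa [Function.update] using l2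
    · rcases hB with hB | ⟨h, b₀, hB, hs, heq⟩
      · simp only [hB, Function.update_self, List.nil_append]
        exact .start b'
      · simp only [heq, Function.update_self]
        simpa using BobHistory.send (b' := b') hB hs
  | B =>
    obtain ⟨hB, h, b₀, hA, hs, heq⟩ := ih.turnB rfl
    have e1 := ih.sentA_eq
    have e2 := ih.sentB_eq
    have e3 := ih.recvA_eq
    have e4 := ih.recvB_eq
    have l2 := ih.limitA
    simp only [Side.other] at *
    refine ⟨tr ++ [.reply b b'], .reply b b' ih.trace, herr _ rfl, ?_, ?_, ?_, ?_, ?_, ?_,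
      fun _ => ⟨?_, Or.inr ⟨hist .B, b, hB, act, by simp [Function.update]⟩⟩, by simp⟩
    · simp [sentA, e1, Function.update]
    · simp [sentB, e2, Function.update]
    · simp [recvA, e3, Function.update]
    · simp [recvB, e4, Function.update]
    · simpa [Function.update] using l2
    · simpa [Function.update] using left
    · simp only [heq, Function.update_self]
      simpa using AliceHistory.send (b' := b') hA hs

/-- The side whose turn it is has a complete local history; that of the other side breaks off after
a send (or is still empty, for Bob) and is completed by the next symbol. A bounce completes the
sender's own history at once, so locally it is the same constructor `send` as a true reply. -/
theorem exists_runInv {n m : ℕ} {user : Side → List Bool → Bool} {C : Side → Strategy}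
    {cfg : Config} (h : Reachable n m user C cfg) : ∃ tr, RunInv n m user C cfg tr := by
  induction h with
  | refl =>
    exact ⟨[], .nil, by simp, rfl, rfl, rfl, rfl, by simp [initial], by simp [initial],
      fun _ => ⟨.start _, Or.inl rfl⟩, by simp [initial]⟩
  | @tail cfg cfg' _ hstep ih =>
    obtain ⟨tr, ih⟩ := ih
    cases hstep with
    | deliver b act left => exact ih.transmit b b 0 act left (Or.inl rfl)
    | substitute b b' act left => exact ih.transmit b b' 1 act left (Or.inr le_rfl)
    | reveal b act =>
      rcases cfg with ⟨turn, hist, edits⟩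
      have e1 := ih.sentA_eq
      have e2 := ih.sentB_eq
      have e3 := ih.recvA_eq
      have e4 := ih.recvB_eq
      have l1 := ih.limitA
      have l2 := ih.limitB
      have ht := ih.trace
      have he := ih.errors
      cases turn with
      | A =>
        obtain ⟨hA, hB⟩ := ih.turnA rfl
        refine ⟨tr, ht, he, ?_, ?_, ?_, ?_, ?_, ?_, fun _ => ⟨?_, ?_⟩, by simp⟩
        all_goals simp only [Function.update_self, ne_eq, reduceCtorEq, not_false_eq_true,
          Function.update_of_ne, sent_append, received_append, sent_response, received_response,
          sent_reveal, received_reveal, sent_nil, received_nil, List.append_nil]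
        all_goals try assumption
        exact hA.reveal act
      | B =>
        obtain ⟨hB, hA⟩ := ih.turnB rfl
        refine ⟨tr, ht, he, ?_, ?_, ?_, ?_, ?_, ?_, by simp, fun _ => ⟨?_, ?_⟩⟩
        all_goals simp only [Function.update_self, ne_eq, reduceCtorEq, not_false_eq_true,
          Function.update_of_ne, sent_append, received_append, sent_response, received_response,
          sent_reveal, received_reveal, sent_nil, received_nil, List.append_nil]
        all_goals try assumption
        exact hB.reveal act
    | bounce b b' act left =>
      rcases cfg with ⟨turn, hist, edits⟩
      have e1 := ih.sentA_eq
      have e2 := ih.sentB_eq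
      have e3 := ih.recvA_eq
      have e4 := ih.recvB_eq
      have l1 := ih.limitA
      have l2 := ih.limitB
      have ht := ih.trace
      have he := ih.errors
      cases turn with
      | A =>
        obtain ⟨hA, hB⟩ := ih.turnA rfl
        refine ⟨tr ++ [.bounceA b b'], ht.bounceA b b', by simpa [isError, List.filter_cons] using he,
          ?_, ?_, ?_, ?_, ?_, ?_, fun _ => ⟨?_, ?_⟩, by simp⟩
        · simp [sentA, e1, Function.update]
        · simp [sentB, e2, Function.update]
        · simp [recvA, e3, Function.update]
        · simp [recvB, e4, Function.update]
        · simpa [Function.update] using left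
        · simpa [Function.update] using l2
        · simpa [Function.update] using hA.send act
        · simpa [Function.update] using hB
      | B =>
        obtain ⟨hB, hA⟩ := ih.turnB rfl
        refine ⟨tr ++ [.bounceB b b'], ht.bounceB b b', by simpa [isError, List.filter_cons] using he,
          ?_, ?_, ?_, ?_, ?_, ?_, by simp, fun _ => ⟨?_, ?_⟩⟩
        · simp [sentA, e1, Function.update]
        · simp [sentB, e2, Function.update]
        · simp [recvA, e3, Function.update]
        · simp [recvB, e4, Function.update]
        · simpa [Function.update] using l1
        · simpa [Function.update] using left
        · simpa [Function.update] using hB.send act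
        · simpa [Function.update] using hA

/-- The two intermediaries as a pair. -/
def strategies (isData header : ℕ → Bool) (target : List Bool → ℕ) (m : ℕ) : Side → Strategy
  | .A => aliceStrategy isData header m
  | .B => bobStrategy target m

/-- How the local histories at the end of a run are determined by its trace. -/
structure Outcome (n m : ℕ) (isData header : ℕ → Bool) (target : List Bool → ℕ) (cfg : Config)
    (tr : List Transmission) : Prop where
  trace : Trace cfg.turn tr
  errors : (tr.filter isError).length ≤ cfg.edits
  revealedA_length : (revealed (cfg.hist .A)).length =
    min m (Nat.count (fun a => isData a) (tr.filterMap recvA).length)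
  revealedB_length : (revealed (cfg.hist .B)).length =
    revealedUpTo target m (tr.filterMap recvB) (tr.filterMap recvB).length
  givenA_length : (given (cfg.hist .A)).length =
    max 1 (min m ((revealed (cfg.hist .A)).length + 1))
  givenB_length : (given (cfg.hist .B)).length = (revealed (cfg.hist .B)).length
  revealedA_eq : ∀ a < (tr.filterMap recvA).length, isData a →
    Nat.count (fun a => isData a) a < m →
    (revealed (cfg.hist .A))[Nat.count (fun a => isData a) a]? = (tr.filterMap recvA)[a]?
  sentA_data : ∀ a < (tr.filterMap sentA).length, isData a →
    Nat.count (fun a => isData a) a < m →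
    (tr.filterMap sentA)[a]? = (given (cfg.hist .A))[Nat.count (fun a => isData a) a]?
  sentA_header : ∀ a < (tr.filterMap sentA).length, isData a = false →
    (tr.filterMap sentA)[a]? = some (header a)
  revealedB_eq : ∀ τ < (tr.filterMap recvB).length, ∀ i < (revealed (cfg.hist .B)).length,
    revealedUpTo target m (tr.filterMap recvB) τ ≤ i →
    i < revealedUpTo target m (tr.filterMap recvB) (τ + 1) →
    (revealed (cfg.hist .B))[i]? = (tr.filterMap recvB)[τ]?
  sentB_eq : ∀ τ < (tr.filterMap sentB).length, ∀ i,
    revealedUpTo target m (tr.filterMap recvB) (τ + 1) = i + 1 →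
    (tr.filterMap sentB)[τ]? = (given (cfg.hist .B))[i]?
  finished : (cfg.turn = .A ∧ (tr.filterMap sentA).length = n / 2) ∨
    (cfg.turn = .B ∧ (tr.filterMap sentB).length = n / 2)
  limit : (tr.filterMap sentA).length ≤ n / 2

theorem revealed_length_le {n m : ℕ} {user : Side → List Bool → Bool} {isData header : ℕ → Bool}
    {target : List Bool → ℕ} {cfg : Config}
    (h : Reachable n m user (strategies isData header target m) cfg) (p : Side) :
    (revealed (cfg.hist p)).length ≤ m := by
  obtain ⟨tr, inv⟩ := exists_runInv h
  have hA : ∀ h, AliceHistory (aliceStrategy isData header m) m user h →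
      (revealed h).length ≤ m := by
    intro h hh
    obtain ⟨P, hP⟩ := aliceInv hh
    rw [hP.revealed_length]
    exact min_le_left _ _
  have hB : ∀ h, BobHistory (bobStrategy target m) m user h → (revealed h).length ≤ m := by
    intro h hh
    exact (bobInv hh).upper.trans (revealedUpTo_le _ _ _ _)
  cases ht : cfg.turn with
  | A =>
    obtain ⟨h1, h2⟩ := inv.turnA ht
    cases p with
    | A => exact hA _ h1
    | B =>
      rcases h2 with h2 | ⟨h, b, h2, -, heq⟩
      · rw [h2]; simp
      · rw [heq]; simpa using hB _ h2
  | B =>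
    obtain ⟨h1, h, b, h2, -, heq⟩ := inv.turnB ht
    cases p with
    | A => rw [heq]; simpa using hA _ h2
    | B => exact hB _ h1

theorem bobStrategy_of_send {target : List Bool → ℕ} {m : ℕ} {h : List Event} {b : Bool}
    (hact : bobStrategy target m h = .send b) :
    min m (target (received h)) ≤ (revealed h).length := by
  unfold bobStrategy at hact
  split_ifs at hact with hc
  exact not_lt.1 hc

theorem BobInv.revealed_length_eq {target : List Bool → ℕ} {m : ℕ} {h : List Event}
    (inv : BobInv target m h) {b : Bool} (hact : bobStrategy target m h = .send b) :
    (revealed h).length = revealedUpTo target m (received h) (received h).length := by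
  refine le_antisymm inv.upper ?_
  rw [← inv.sent_length, revealedUpTo_succ, inv.sent_length, List.take_length]
  exact max_le inv.lower (bobStrategy_of_send hact)

theorem AliceInv.processed_eq {isData header : ℕ → Bool} {m : ℕ} {h : List Event} {P : ℕ}
    (inv : AliceInv isData header m h P) {b : Bool}
    (hact : aliceStrategy isData header m h = .send b) : P = (received h).length := by
  rcases inv.processed with hP | ⟨hP, b₀, hb₀, hd, hr⟩
  · exact hP
  · refine absurd ⟨?_, hr⟩ ((aliceStrategy_of_send hact).2 b₀ hb₀)
    rw [inv.sent_length, ← hP, Nat.add_sub_cancel, hd]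

theorem exists_outcome {n m : ℕ} {user : Side → List Bool → Bool} {isData header : ℕ → Bool}
    {target : List Bool → ℕ} {cfg : Config}
    (h : Reachable n m user (strategies isData header target m) cfg)
    (hh : Halted n m user (strategies isData header target m) cfg) :
    ∃ tr, Outcome n m isData header target cfg tr := by
  obtain ⟨tr, inv⟩ := exists_runInv h
  -- Revealing is never blocked, so when the run has halted an intermediary wants to send and has
  -- used up its n / 2 bits.
  obtain ⟨b, hb, hle⟩ : ∃ b, strategies isData header target m cfg.turn (cfg.hist cfg.turn) =
      .send b ∧ n / 2 ≤ (sent (cfg.hist cfg.turn)).length := by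
    cases hact : strategies isData header target m cfg.turn (cfg.hist cfg.turn) with
    | reveal b => exact absurd (Step.reveal cfg b hact) (hh _)
    | send b =>
      refine ⟨b, rfl, ?_⟩
      by_contra hlt
      exact hh _ (Step.deliver cfg b hact (not_le.1 hlt))
  have e1 := inv.sentA_eq
  have e2 := inv.sentB_eq
  have e3 := inv.recvA_eq
  have e4 := inv.recvB_eq
  have l1 := inv.limitA
  have l2 := inv.limitB
  refine ⟨tr, ?_⟩
  cases ht : cfg.turn with
  | A =>
    rw [ht] at hb hle
    obtain ⟨hA, hB⟩ := inv.turnA ht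
    obtain ⟨P, iA⟩ := aliceInv hA
    have hP := iA.processed_eq hb
    subst hP
    have fin : (tr.filterMap sentA).length = n / 2 := by rw [e1]; omega
    rcases hB with hB | ⟨h, b₀, hB, hs, heq⟩
    · refine ⟨inv.trace, inv.errors, ?_, ?_, iA.given_length, ?_, ?_, ?_, ?_, ?_, ?_, Or.inl ⟨ht, fin⟩, fin.le⟩
      · rw [e3]; exact iA.revealed_length
      · rw [e4, hB]; simp [revealedUpTo]
      · rw [hB]; simp
      · rw [e3]; exact iA.revealed_eq
      · rw [e1]; exact iA.sent_data
      · rw [e1]; exact iA.sent_header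
      · rw [e4, hB]; simp
      · rw [e2, hB]; simp
    · have iB := bobInv hB
      -- Bob's history breaks off after a send. A fictitious reply `false` completes it, so that the
      -- invariant covers the last sent bit, too.
      have iB' := bobInv (hB.send (b' := false) hs)
      have q1 : received (cfg.hist .B) = received h := by rw [heq]; simp
      have q2 : revealed (cfg.hist .B) = revealed h := by rw [heq]; simp
      have q3 : given (cfg.hist .B) = given h := by rw [heq]; simp
      refine ⟨inv.trace, inv.errors, ?_, ?_, iA.given_length, ?_, ?_, ?_, ?_, ?_, ?_, Or.inl ⟨ht, fin⟩, fin.le⟩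
      · rw [e3]; exact iA.revealed_length
      · rw [e4, q1, q2, iB.revealed_length_eq hs]
      · rw [q2, q3, iB.given_length]
      · rw [e3]; exact iA.revealed_eq
      · rw [e1]; exact iA.sent_data
      · rw [e1]; exact iA.sent_header
      · rw [e4, q1, q2]; exact iB.revealed_eq
      · rw [e2, e4, q1, q3]
        have q4 : sent (cfg.hist .B) = sent (h ++ [.did (.send b₀), .channel false]) := by
          rw [heq]; simp
        rw [q4]
        intro τ hτ i hi
        have := iB'.sent_eq τ hτ i
        simp only [received_append, received_send, received_channel, received_nil] at this
        rw [revealedUpTo_append _ _ _ _ (by simp at hτ; have := iB.sent_length; omega)] at this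
        simpa using this hi
  | B =>
    rw [ht] at hb hle
    obtain ⟨hB, h, b₀, hA, hs, heq⟩ := inv.turnB ht
    have iB := bobInv hB
    obtain ⟨P, iA⟩ := aliceInv hA
    obtain ⟨P', iA'⟩ := aliceInv (hA.send (b' := false) hs)
    have hP := iA.processed_eq hs
    subst hP
    have q1 : received (cfg.hist .A) = received h := by rw [heq]; simp
    have q2 : revealed (cfg.hist .A) = revealed h := by rw [heq]; simp
    have q3 : given (cfg.hist .A) = given h := by rw [heq]; simp
    have q4 : sent (cfg.hist .A) = sent (h ++ [.did (.send b₀), .channel false]) := by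
      rw [heq]; simp
    have q5 : given (cfg.hist .A) = given (h ++ [.did (.send b₀), .channel false]) := by
      rw [heq]; simp
    refine ⟨inv.trace, inv.errors, ?_, ?_, ?_, ?_, ?_, ?_, ?_, ?_, ?_, ?_, by rw [e1]; exact l1⟩
    · rw [e3, q1, q2]; exact iA.revealed_length
    · rw [e4, iB.revealed_length_eq hb]
    · rw [q2, q3, iA.given_length]
    · exact iB.given_length
    · rw [e3, q1, q2]; exact iA.revealed_eq
    · rw [e1, q4, q5]; exact iA'.sent_data
    · rw [e1, q4]; exact iA'.sent_header
    · rw [e4]; exact iB.revealed_eq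
    · rw [e2, e4]; exact iB.sent_eq
    · right; rw [e2]; exact ⟨ht, by omega⟩

end InsDel

namespace InsDel

/-! ### Blocks, headers and the receiver -/

/-- Alice's intermediary cuts its communication into blocks of `period` rounds. A block starts with
a header, which consists of a `1`, a word of `len` bits and the pattern `1 0^(s-1)`. -/
structure Scheme where
  s : ℕ
  len : ℕ
  period : ℕ
  word : ℕ → List Bool

namespace Scheme

variable (c : Scheme)

/-- The length of a header. -/
abbrev head : ℕ := c.len + 1 + c.s

/-- The number of data rounds of a block. -/
abbrev data : ℕ := c.period - c.head

structure Valid : Prop where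
  len_lt : c.len + 2 ≤ c.s
  head_lt : c.head < c.period
  word_length : ∀ k, (c.word k).length = c.len

/-- The header of block `k`. -/
def header (k : ℕ) : List Bool := true :: (c.word k ++ true :: List.replicate (c.s - 1) false)

def headerBit (a : ℕ) : Bool := (c.header (a / c.period)).getD (a % c.period) false

def isData (a : ℕ) : Bool := decide (c.head ≤ a % c.period)

/-- The pattern `1 0^(s-1)`, reversed. -/
def pattern : List Bool := List.replicate (c.s - 1) false ++ [true]

end Scheme

/-- The state of the receiver: the received bits (in reversed order), the number of rounds since
the last detected header, and the detected words (in reversed order). -/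
structure Receiver where
  buf : List Bool
  wait : ℕ
  words : List (List Bool)

namespace Receiver

/-- The receiver detects a header. -/
def accepts (c : Scheme) (r : Receiver) (b : Bool) : Bool :=
  decide (c.period ≤ r.wait + 1) && decide ((b :: r.buf).take c.s = c.pattern)

def step (c : Scheme) (r : Receiver) (b : Bool) : Receiver :=
  if r.accepts c b then
    ⟨b :: r.buf, 0, (((b :: r.buf).drop c.s).take c.len).reverse :: r.words⟩
  else ⟨b :: r.buf, r.wait + 1, r.words⟩

/-- `wait` starts at `period`, so that the very first header can be accepted. -/
def init (c : Scheme) : Receiver := ⟨[], c.period, []⟩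

theorem step_of_accepts {c : Scheme} {r : Receiver} {b : Bool} (h : r.accepts c b = true) :
    r.step c b = ⟨b :: r.buf, 0, (((b :: r.buf).drop c.s).take c.len).reverse :: r.words⟩ :=
  if_pos h

theorem step_of_not_accepts {c : Scheme} {r : Receiver} {b : Bool} (h : r.accepts c b = false) :
    r.step c b = ⟨b :: r.buf, r.wait + 1, r.words⟩ :=
  if_neg (by simp [h])

end Receiver

namespace Scheme
variable {c : Scheme}

theorem headerBit_first {a : ℕ} (h : a % c.period = 0) : c.headerBit a = true := by
  simp [headerBit, header, h]

theorem Valid.headerBit_separator (hc : c.Valid) {a : ℕ} (h : a % c.period = c.len + 1) : c.headerBit a = true := by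
  simp [headerBit, header, h, hc.word_length]

theorem Valid.headerBit_tail (hc : c.Valid) {a : ℕ} (h : c.len + 1 < a % c.period) : c.headerBit a = false := by
  have h1 : c.word (a / c.period) ++ true :: List.replicate (c.s - 1) false =
    (c.word (a / c.period) ++ [true]) ++ List.replicate (c.s - 1) false := by simp
  obtain ⟨f, hf⟩ : ∃ f, a % c.period = f + 1 := ⟨a % c.period - 1, by omega⟩
  rw [headerBit, header, hf, List.getD_cons_succ, h1, List.getD_eq_getElem?_getD,
    List.getElem?_append_right (by simp [hc.word_length]; omega), List.getElem?_replicate]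
  split_ifs <;> rfl

theorem Valid.headerBit_word (hc : c.Valid) {a i : ℕ} (h : a % c.period = i + 1)
    (hi : i < c.len) :
    (c.word (a / c.period))[i]? = some (c.headerBit a) := by
  rw [headerBit, header, h, List.getD_cons_succ, List.getD_eq_getElem?_getD,
    List.getElem?_append_left (by rw [hc.word_length]; exact hi),
    List.getElem?_eq_getElem (by rw [hc.word_length]; exact hi)]
  rfl

/-- The stream `x` has the headers of the scheme. -/
def HasHeaders (c : Scheme) (x : ℕ → Bool) : Prop :=
  ∀ a, a % c.period < c.head → x a = c.headerBit a

/-- The pattern `1 0^(s-1)` occurs at position `P` of the stream `x`. -/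
def PatternAt (c : Scheme) (x : ℕ → Bool) (P : ℕ) : Prop :=
  x P = true ∧ ∀ i, 1 ≤ i → i < c.s → x (P + i) = false

/-- The pattern occurs inside the data rounds of block `j`. -/
def PatternIn (c : Scheme) (x : ℕ → Bool) (j : ℕ) : Prop :=
  ∃ P, c.PatternAt x P ∧ c.head ≤ P % c.period ∧ P % c.period + c.s ≤ c.period ∧ P / c.period = j

theorem mod_add_of_lt {a i p : ℕ} (h : a % p + i < p) : (a + i) % p = a % p + i := by
  rw [Nat.add_mod, Nat.mod_eq_of_lt (a := i) (by omega), Nat.mod_eq_of_lt h]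

/-- A pattern that starts before the separator of a header has this 1 among its zeros, because `len
+ 2 ≤ s`. Behind the separator a header has no 1 to start with. A pattern that runs from the data
into the next block meets the leading 1 of its header. -/
theorem Valid.pattern_phase (hc : c.Valid) {x : ℕ → Bool} (hx : c.HasHeaders x) {P : ℕ}
    (hP : c.PatternAt x P) : P % c.period = c.len + 1 ∨ c.PatternIn x (P / c.period) := by
  have h1 := hc.len_lt
  have h2 := hc.head_lt
  have h2' : c.len + 1 + c.s < c.period := h2
  have hlt : P % c.period < c.period := Nat.mod_lt _ (by omega)
  by_contra hcon
  push Not at hcon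
  obtain ⟨hne, hdata⟩ := hcon
  rcases Nat.lt_or_ge (P % c.period) (c.len + 1) with h | h
  · -- the separator of the header is among the zeros
    have e : (P + (c.len + 1 - P % c.period)) % c.period = c.len + 1 := by
      rw [mod_add_of_lt (by omega)]; omega
    have := hP.2 (c.len + 1 - P % c.period) (by omega) (by omega)
    rw [hx _ (by rw [e]; simp only [head]; omega), hc.headerBit_separator e] at this
    simp at this
  · rcases Nat.lt_or_ge (P % c.period) c.head with h' | h'
    · have := hP.1
      rw [hx _ h', hc.headerBit_tail (by omega)] at this
      simp at this
    · rcases Nat.lt_or_ge c.period (P % c.period + c.s) with h'' | h''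
      · have e : (P + (c.period - P % c.period)) % c.period = 0 := by
          rw [Nat.add_mod, Nat.mod_eq_of_lt (a := c.period - P % c.period)
            (by simp only [head] at h'; omega)]
          rw [Nat.add_sub_of_le hlt.le, Nat.mod_self]
        have := hP.2 (c.period - P % c.period) (by omega) (by omega)
        rw [hx _ (by rw [e]; simp only [head]; omega), headerBit_first e] at this
        simp at this
      · exact hdata ⟨P, hP, h', h'', rfl⟩

end Scheme

/-! ### The receiver along a trace -/

open Transmission

/-- The receiver together with data that it does not know: Alice's clock, the number of rounds
since the last error, for each detected word (latest first) Alice's clock and whether it is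
certainly genuine, and the number of errors in each block. -/
structure Ghost where
  clock : ℕ
  clean : ℕ
  rcv : Receiver
  log : List (ℕ × Bool)
  err : ℕ → ℕ

namespace Ghost

def init (c : Scheme) : Ghost := ⟨0, 0, .init c, [], fun _ => 0⟩

/-- The block of Alice's last bit. -/
def block (c : Scheme) (a : ℕ) : ℕ := (a - 1) / c.period

def addError (c : Scheme) (err : ℕ → ℕ) (a : ℕ) : ℕ → ℕ :=
  fun j => err j + if j = block c a then 1 else 0

/-- The effect of a bit that is delivered to Bob. -/
def receive (c : Scheme) (clock clean : ℕ) (rcv : Receiver) (log : List (ℕ × Bool))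
    (err : ℕ → ℕ) (b : Bool) : Ghost :=
  ⟨clock, clean, rcv.step c b,
    if rcv.accepts c b then (clock, decide (c.head ≤ clean ∧ clock % c.period = c.head)) :: log
    else log, err⟩

/-- Every error is charged to the block of the bit that Alice is sending or has sent last. It also
ends the clean stretch, even where Bob's buffer is not affected. -/
def step (c : Scheme) (g : Ghost) : Transmission → Ghost
  | .forward b b' =>
    if b = b' then receive c (g.clock + 1) (g.clean + 1) g.rcv g.log g.err b'
    else receive c (g.clock + 1) 0 g.rcv g.log (addError c g.err (g.clock + 1)) b'
  | .bounceA _ _ => ⟨g.clock + 1, 0, g.rcv, g.log, addError c g.err (g.clock + 1)⟩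
  | .bounceB _ b' => receive c g.clock 0 g.rcv g.log (addError c g.err g.clock) b'
  | .reply b b' => if b = b' then g else ⟨g.clock, 0, g.rcv, g.log, addError c g.err g.clock⟩

/-- The number of detected words in block `j`. -/
def count (c : Scheme) (log : List (ℕ × Bool)) (j : ℕ) : ℕ :=
  log.countP fun e => block c e.1 == j

/-- The errors of block `j`, including occurrences of the pattern in Alice's data. -/
noncomputable def total (c : Scheme) (x : ℕ → Bool) (err : ℕ → ℕ) (j : ℕ) : ℕ :=
  err j + open Classical in if c.PatternIn x j then 1 else 0

/-- Charges Bob's mistakes to blocks with trouble (an error, or a pattern in the data). By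
`last_error` the clean stretch reaches back to the start or to a block with an error. Detections are
at least a period apart on Bob's clock, which gains on Alice's only through errors; hence
`count_le`, with `count_head` as the form that survives the induction. By `spurious` a false
detection has trouble in its block or the one before. A true header may be blocked by a false
detection less than a period earlier, so in `missing` the trouble may lie two blocks back. Truncated
subtraction handles the first blocks. -/
structure Inv (c : Scheme) (x : ℕ → Bool) (g : Ghost) : Prop where
  clean_le : g.clean ≤ g.clock
  clean_le_length : g.clean ≤ g.rcv.buf.length
  clean_eq : ∀ i < g.clean, g.rcv.buf[i]? = some (x (g.clock - 1 - i))
  last_error : (g.clean = g.clock ∧ g.rcv.buf.length = g.clock) ∨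
    0 < g.err (block c (g.clock - g.clean))
  log_length : g.log.length = g.rcv.words.length
  wait_nil : g.log = [] → c.period ≤ g.rcv.wait
  wait_eq : ∀ e ∈ g.log.head?, g.rcv.wait < g.clean → e.1 + g.rcv.wait = g.clock
  log_pos : ∀ e ∈ g.log, 0 < e.1
  log_le : ∀ e ∈ g.log, e.1 ≤ g.clock
  log_sorted : g.log.Pairwise fun new old => old.1 ≤ new.1 ∧ (new.2 = true → old.1 < new.1)
  genuine : ∀ (i : ℕ) (e : ℕ × Bool), g.log[i]? = some e → e.2 = true →
    e.1 % c.period = c.head ∧ g.rcv.words[i]? = some (c.word (e.1 / c.period))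
  count_le : ∀ j, count c g.log j ≤ 1 + g.err j
  count_head : ∀ e ∈ g.log.head?, block c e.1 = block c g.clock →
    count c g.log (block c g.clock) + g.rcv.wait + e.1 ≤ 1 + g.err (block c g.clock) + g.clock
  spurious : ∀ e ∈ g.log, e.2 = false →
    0 < total c x g.err (block c e.1 - 1) + total c x g.err (block c e.1)
  missing : ∀ k, k * c.period + c.head ≤ g.clock → (k * c.period + c.head, true) ∈ g.log ∨
    0 < total c x g.err (k - 2) + total c x g.err (k - 1) + total c x g.err k

theorem inv_init (c : Scheme) (x : ℕ → Bool) : Inv c x (init c) := by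
  refine ⟨le_rfl, le_rfl, by simp [init], Or.inl ⟨rfl, rfl⟩, rfl, fun _ => le_rfl, by simp [init],
    by simp [init], by simp [init], by simp [init], by simp [init], by simp [init, count],
    by simp [init], by simp [init], ?_⟩
  intro k hk
  simp [init] at hk

theorem total_mono {c : Scheme} {x : ℕ → Bool} {err err' : ℕ → ℕ} (h : ∀ j, err j ≤ err' j)
    (j : ℕ) : total c x err j ≤ total c x err' j :=
  Nat.add_le_add_right (h j) _

theorem block_mono (c : Scheme) {a b : ℕ} (h : a ≤ b) : block c a ≤ block c b :=
  Nat.div_le_div_right (by omega)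

theorem le_addError (c : Scheme) (err : ℕ → ℕ) (a j : ℕ) : err j ≤ addError c err a j :=
  Nat.le_add_right _ _

theorem addError_self (c : Scheme) (err : ℕ → ℕ) (a : ℕ) :
    addError c err a (block c a) = err (block c a) + 1 := by
  simp [addError]

/-- A error that does not touch the receiver. -/
theorem Inv.error {c : Scheme} (hc : c.Valid) {x : ℕ → Bool} {g : Ghost} (inv : Inv c x g) {a : ℕ}
    (ha : a = g.clock ∨ a = g.clock + 1) :
    Inv c x ⟨a, 0, g.rcv, g.log, addError c g.err a⟩ := by
  have hmono := le_addError c g.err a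
  have hle : g.clock ≤ a := by omega
  refine ⟨Nat.zero_le _, Nat.zero_le _, by simp, Or.inr ?_, inv.log_length, inv.wait_nil, by simp,
    inv.log_pos, fun e he => (inv.log_le e he).trans hle, inv.log_sorted, inv.genuine, fun j => ?_, ?_, ?_, ?_⟩
  · simp [addError_self]
  · exact (inv.count_le j).trans (Nat.add_le_add_left (hmono j) 1)
  · intro e he hb
    have hem : e ∈ g.log := List.mem_of_mem_head? he
    have h1 := block_mono c (inv.log_le e hem)
    have h2 := block_mono c hle
    simp only at he hb ⊢
    have h3 : block c g.clock = block c a := by omega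
    have h4 := inv.count_head e he (by omega)
    rw [h3] at h4
    have := hmono (block c a)
    omega
  · intro e he hf
    exact (inv.spurious e he hf).trans_le
      (Nat.add_le_add (total_mono hmono _) (total_mono hmono _))
  · intro k hk
    simp only at hk ⊢
    rcases Nat.lt_or_ge g.clock (k * c.period + c.head) with h | h
    · right
      have hka : k * c.period + c.head = a := by omega
      have hb : block c a = k := by
        have := hc.head_lt
        have := hc.len_lt
        rw [block, ← hka]
        apply Nat.div_eq_of_lt_le
        · simp only [Scheme.head] at *; omega
        · simp only [Scheme.head] at *; rw [add_mul]; omega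
      have h1 := addError_self c g.err a
      rw [hb] at h1
      have : 0 < total c x (addError c g.err a) k := by
        unfold total; omega
      omega
    · rcases inv.missing k h with h' | h'
      · exact Or.inl h'
      · right
        have h1 := total_mono (c := c) (x := x) hmono (k - 2)
        have h2 := total_mono (c := c) (x := x) hmono (k - 1)
        have h3 := total_mono (c := c) (x := x) hmono k
        omega


/-- The last received bits agree with Alice's stream. -/
structure Synced (c : Scheme) (x : ℕ → Bool) (a cl : ℕ) (buf : List Bool) (err : ℕ → ℕ) :
    Prop where
  clean_le : cl ≤ a
  clean_le_length : cl ≤ buf.length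
  clean_eq : ∀ i < cl, buf[i]? = some (x (a - 1 - i))
  last_error : (cl = a ∧ buf.length = a) ∨ 0 < err (block c (a - cl))

/-- If there is a last error, it lies at least two blocks back, and so more than a full period has
passed since; otherwise the clean stretch is the whole run. -/
theorem Synced.clean_ge {c : Scheme} (hc : c.Valid) {x : ℕ → Bool} {a cl : ℕ} {buf : List Bool}
    {err : ℕ → ℕ} (h : Synced c x a cl buf err) (h1 : err (block c a - 1) = 0)
    (h2 : err (block c a) = 0) : (cl = a ∧ buf.length = a) ∨ (c.period < cl ∧
      (block c a - 1) * c.period + cl ≥ a ∧ 0 < block c a) := by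
  have hp := hc.head_lt
  rcases h.last_error with h' | h'
  · exact Or.inl h'
  · right
    have hle := block_mono c (Nat.sub_le a cl)
    have hb : block c (a - cl) + 2 ≤ block c a := by
      by_contra hcon
      have : block c (a - cl) = block c a ∨ block c (a - cl) = block c a - 1 := by omega
      rcases this with h | h <;> rw [h] at h' <;> omega
    have e1 : a - cl ≤ (block c (a - cl) + 1) * c.period := by
      have := Nat.lt_mul_div_succ (a - cl - 1) (show 0 < c.period by omega)
      rw [mul_comm] at this
      unfold block
      omega
    have e2 : (block c (a - cl) + 1) * c.period ≤ (block c a - 1) * c.period :=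
      Nat.mul_le_mul_right _ (by omega)
    have e3 : (block c a - 1) * c.period + c.period = block c a * c.period := by
      rw [← Nat.succ_mul]; congr 1; omega
    have e4 : block c a * c.period ≤ a - 1 := Nat.div_mul_le_self _ _
    have : 0 < block c a * c.period := Nat.mul_pos (by omega) (by omega)
    omega

theorem Synced.get {c : Scheme} {x : ℕ → Bool} {a cl : ℕ} {buf : List Bool}
    {err : ℕ → ℕ} (h : Synced c x a cl buf err) {l : List Bool} {n : ℕ} (hl : (buf.take n) = l)
    {i : ℕ} (hi : i < cl) (hn : i < n) : l[i]? = some (x (a - 1 - i)) := by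
  rw [← hl, List.getElem?_take_of_lt hn, h.clean_eq i hi]

/-- A header that is detected in an error-free part is genuine. -/
theorem Synced.genuine {c : Scheme} (hc : c.Valid) {x : ℕ → Bool} (hx : c.HasHeaders x) {a cl : ℕ}
    {buf : List Bool} {err : ℕ → ℕ} (h : Synced c x a cl buf err)
    (h0 : total c x err (block c a - 1) + total c x err (block c a) = 0)
    (hacc : buf.take c.s = c.pattern) : c.head ≤ cl ∧ a % c.period = c.head := by
  have hp := hc.head_lt
  have hs := hc.len_lt
  have hhead : c.head = c.len + 1 + c.s := rfl
  have t1 : err (block c a - 1) = 0 := by unfold total at h0; omega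
  have t2 : err (block c a) = 0 := by unfold total at h0; omega
  have hcl := h.clean_ge hc t1 t2
  have hslen : c.s ≤ buf.length := by
    have := congrArg List.length hacc
    simp [Scheme.pattern] at this
    omega
  have hscl : c.s ≤ cl := by simp only [Scheme.head] at hp; omega
  have hsa := hscl.trans h.clean_le
  have hpat : c.PatternAt x (a - c.s) := by
    constructor
    · have := h.get hacc (i := c.s - 1) (by omega) (by omega)
      rw [Scheme.pattern, List.getElem?_append_right (by simp)] at this
      simp at this
      rw [← this]
      congr 1; omega
    · intro i hi1 hi2
      have := h.get hacc (i := c.s - 1 - i) (by omega) (by omega)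
      rw [Scheme.pattern, List.getElem?_append_left (by simp; omega),
        List.getElem?_replicate_of_lt (by omega)] at this
      injection this with this
      rw [this]
      congr 1; omega
  have hph := hc.pattern_phase hx hpat
  have hph' : (a - c.s) % c.period = c.len + 1 := by
    rcases hph with h' | h'
    · exact h'
    -- The pattern would lie in the data of the current or the previous block, and both are free of
    -- trouble.
    · exfalso
      have hbl : (a - c.s) / c.period = block c a ∨ (a - c.s) / c.period = block c a - 1 := by
        have u1 : (a - c.s) / c.period ≤ block c a := Nat.div_le_div_right (by omega)
        have u2 : block c a ≤ (a - c.s) / c.period + 1 := by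
          rw [← Nat.add_div_right _ (show 0 < c.period by omega)]
          exact Nat.div_le_div_right (by omega)
        generalize (a - c.s) / c.period = y at u1 u2
        omega
      have hpos : 0 < total c x err ((a - c.s) / c.period) := by
        unfold total; rw [if_pos h']; omega
      rcases hbl with h | h <;> rw [h] at hpos <;> omega
  have hmod : a % c.period = c.head := by
    have : a = (a - c.s) + c.s := by omega
    rw [this, Scheme.mod_add_of_lt (by rw [hph']; exact hp), hph']
  refine ⟨?_, hmod⟩
  rcases hcl with h' | h'
  · have := Nat.mod_le a c.period; omega
  · omega

theorem Synced.word {c : Scheme} (hc : c.Valid) {x : ℕ → Bool} (hx : c.HasHeaders x) {a cl : ℕ}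
    {buf : List Bool} {err : ℕ → ℕ} (h : Synced c x a cl buf err) (h1 : c.head ≤ cl)
    (h2 : a % c.period = c.head) : ((buf.drop c.s).take c.len).reverse = c.word (a / c.period) := by
  have hp := hc.head_lt
  have hs := hc.len_lt
  have hhead : c.head = c.len + 1 + c.s := rfl
  have hle := h.clean_le_length
  have hlen : ((buf.drop c.s).take c.len).length = c.len := by simp; omega
  apply List.ext_getElem?
  intro i
  rcases Nat.lt_or_ge i c.len with hi | hi
  · rw [List.getElem?_reverse (by rw [hlen]; exact hi), hlen, List.getElem?_take_of_lt (by omega),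
      List.getElem?_drop, h.clean_eq _ (by omega)]
    have hcla := h.clean_le
    set P := a - 1 - (c.s + (c.len - 1 - i)) with hP
    have hPa : a = P + (c.head - (i + 1)) := by omega
    have hdm := Nat.div_add_mod a c.period
    have hPm : P = c.period * (a / c.period) + (i + 1) := by omega
    have e1 : P % c.period = i + 1 := by
      rw [hPm, Nat.mul_add_mod, Nat.mod_eq_of_lt (by omega)]
    have e2 : P / c.period = a / c.period := by
      rw [hPm, Nat.mul_add_div (by omega), Nat.div_eq_of_lt (show i + 1 < c.period by omega),
        Nat.add_zero]
    rw [← e2, hc.headerBit_word e1 hi, hx P (by omega)]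
  · rw [List.getElem?_eq_none (by simp; omega), List.getElem?_eq_none (by rw [hc.word_length]; exact hi)]

theorem Synced.take_eq_pattern {c : Scheme} (hc : c.Valid) {x : ℕ → Bool} (hx : c.HasHeaders x)
    {a cl : ℕ} {buf : List Bool} {err : ℕ → ℕ} (h : Synced c x a cl buf err) (h1 : c.s ≤ cl)
    (h2 : a % c.period = c.head) : buf.take c.s = c.pattern := by
  have hp := hc.head_lt
  have hs := hc.len_lt
  have hhead : c.head = c.len + 1 + c.s := rfl
  have hle := h.clean_le_length
  have hcla := h.clean_le
  have hlen : c.pattern.length = c.s := by simp [Scheme.pattern]; omega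
  have hma := Nat.mod_le a c.period
  apply List.ext_getElem?
  intro i
  rcases Nat.lt_or_ge i c.s with hi | hi
  · rw [List.getElem?_take_of_lt hi, h.clean_eq i (by omega)]
    set P := a - 1 - i with hP
    have hdm := Nat.div_add_mod a c.period
    have hPm : P = c.period * (a / c.period) + (c.head - 1 - i) := by omega
    have e1 : P % c.period = c.head - 1 - i := by
      rw [hPm, Nat.mul_add_mod, Nat.mod_eq_of_lt (by omega)]
    rw [hx P (by omega), Scheme.pattern]
    rcases Nat.lt_or_ge i (c.s - 1) with hi' | hi'
    · rw [hc.headerBit_tail (by omega), List.getElem?_append_left (by simpa using hi'),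
        List.getElem?_replicate_of_lt hi']
    · rw [hc.headerBit_separator (by omega), List.getElem?_append_right (by simpa using hi')]
      have : i - (c.s - 1) = 0 := by omega
      simp [this]
  · rw [List.getElem?_eq_none (by simp; omega), List.getElem?_eq_none (by omega)]

/-- The three ways in which Bob can receive a bit. -/
def Reception (c : Scheme) (x : ℕ → Bool) (g : Ghost) (a cl : ℕ) (err : ℕ → ℕ) (b : Bool) : Prop :=
  (a = g.clock + 1 ∧ cl = g.clean + 1 ∧ err = g.err ∧ b = x g.clock) ∨
  ((a = g.clock ∨ a = g.clock + 1) ∧ 0 < a ∧ cl = 0 ∧ err = addError c g.err a)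

theorem Inv.synced {c : Scheme} {x : ℕ → Bool} {g : Ghost} (inv : Inv c x g) {a cl : ℕ}
    {err : ℕ → ℕ} {b : Bool} (h : Reception c x g a cl err b) :
    Synced c x a cl (b :: g.rcv.buf) err := by
  rcases h with ⟨rfl, rfl, rfl, rfl⟩ | ⟨h, -, rfl, rfl⟩
  · refine ⟨Nat.succ_le_succ inv.clean_le, Nat.succ_le_succ inv.clean_le_length, ?_, ?_⟩
    · intro i hi
      rcases i with _ | i
      · simp
      · rw [List.getElem?_cons_succ, inv.clean_eq i (by omega)]
        congr 2
        omega
    · rcases inv.last_error with h | h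
      · left; simp [h]
      · right; rwa [Nat.add_sub_add_right]
  · refine ⟨Nat.zero_le _, Nat.zero_le _, by simp, Or.inr ?_⟩
    simp [addError_self]

theorem Inv.missing_of_lt {c : Scheme} {x : ℕ → Bool} {g : Ghost} (inv : Inv c x g)
    {err : ℕ → ℕ} (hmono : ∀ j, g.err j ≤ err j) {k : ℕ} (h : k * c.period + c.head ≤ g.clock) :
    (k * c.period + c.head, true) ∈ g.log ∨
    0 < total c x err (k - 2) + total c x err (k - 1) + total c x err k := by
  rcases inv.missing k h with h' | h'
  · exact Or.inl h'
  · right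
    have h1 := total_mono (c := c) (x := x) hmono (k - 2)
    have h2 := total_mono (c := c) (x := x) hmono (k - 1)
    have h3 := total_mono (c := c) (x := x) hmono k
    omega

theorem Reception.mono {c : Scheme} {x : ℕ → Bool} {g : Ghost} {a cl : ℕ} {err : ℕ → ℕ}
    {b : Bool} (h : Reception c x g a cl err b) : ∀ j, g.err j ≤ err j := by
  rcases h with ⟨rfl, rfl, rfl, rfl⟩ | ⟨h, -, rfl, rfl⟩
  · exact fun _ => le_rfl
  · exact le_addError c g.err a

theorem block_eq_of_header {c : Scheme} (hc : c.Valid) (k : ℕ) :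
    block c (k * c.period + c.head) = k := by
  have := hc.head_lt
  rw [block]
  apply Nat.div_eq_of_lt_le
  · simp only [Scheme.head] at *; omega
  · simp only [Scheme.head] at *; rw [add_mul]; omega

/-- In an error-free part a header is detected. -/
theorem Inv.accepts_of_total_eq_zero {c : Scheme} (hc : c.Valid) {x : ℕ → Bool}
    (hx : c.HasHeaders x) {g : Ghost} (inv : Inv c x g) {a cl : ℕ}
    {err : ℕ → ℕ} {b : Bool} (h : Reception c x g a cl err b) {k : ℕ}
    (hk : k * c.period + c.head = a)
    (h0 : total c x err (k - 2) + total c x err (k - 1) + total c x err k = 0) :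
    g.rcv.accepts c b = true := by
  have hp := hc.head_lt
  have hs := hc.len_lt
  have hhead : c.head = c.len + 1 + c.s := rfl
  have hsync := inv.synced h
  have hb : block c a = k := by rw [← hk]; exact block_eq_of_header hc k
  have ha : a % c.period = c.head := by
    rw [← hk, mul_comm, Nat.mul_add_mod, Nat.mod_eq_of_lt hp]
  have hek : err k = 0 := by unfold total at h0; omega
  have hek1 : err (k - 1) = 0 := by unfold total at h0; omega
  have hcl := hsync.clean_ge hc (by rwa [hb]) (by rwa [hb])
  rw [hb] at hcl
  have hscl : c.s ≤ cl := by omega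
  have htake := hsync.take_eq_pattern hc hx hscl ha
  rcases h with ⟨h1, h2, h3, h4⟩ | ⟨h1, -, h2, h3⟩
  swap
  · rw [h3, ← hb, addError_self] at hek
    omega
  rw [Receiver.accepts, htake]
  simp only [decide_true, Bool.and_true, decide_eq_true_eq]
  -- Otherwise the previous detection e is less than a period old, so it lies in block k or k - 1,
  -- and it is genuine, since a false one would show trouble in the blocks k - 2 to k. Then e sits
  -- at the end of a header, yet its clock is before the first header end or strictly between two
  -- consecutive ones.
  by_contra hwait
  rcases hlog : g.log with _ | ⟨e, l⟩
  · have := inv.wait_nil hlog; omega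
  have hem : e ∈ g.log := by rw [hlog]; simp
  have hea := inv.log_le e hem
  have hgen : (block c e.1 = k ∨ block c e.1 = k - 1) → e.1 % c.period = c.head := by
    intro hbl
    cases he2 : e.2 with
    | true => exact (inv.genuine 0 e (by rw [hlog]; rfl) he2).1
    | false =>
      have := inv.spurious e hem he2
      rw [← h3] at this
      rcases hbl with hbl | hbl <;> rw [hbl] at this
      · omega
      · rw [show k - 1 - 1 = k - 2 by omega] at this; omega
  rcases Nat.eq_zero_or_pos k with rfl | hkpos
  · have hbl : block c e.1 = 0 := by
      have := block_mono c (hea.trans (show g.clock ≤ a by omega))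
      omega
    have := hgen (Or.inl hbl)
    have := Nat.mod_le e.1 c.period
    omega
  · have hclean : c.period ≤ g.clean + 1 := by
      rcases hcl with h | h
      · have : c.period ≤ k * c.period := Nat.le_mul_of_pos_left _ hkpos
        omega
      · omega
    have hw := inv.wait_eq e (by rw [hlog]; simp) (by omega)
    have hkk : (k - 1) * c.period + c.period = k * c.period := by
      rw [← Nat.succ_mul]; congr 1; omega
    have hbl : block c e.1 = k ∨ block c e.1 = k - 1 := by
      have u1 : block c e.1 ≤ k := by
        rw [← hb]; exact block_mono c (by omega)
      have u2 : k - 1 ≤ block c e.1 := by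
        rw [block, Nat.le_div_iff_mul_le (by omega)]
        omega
      omega
    have hmod := hgen hbl
    obtain ⟨f, hf1, hf2⟩ : ∃ f, e.1 = (k - 1) * c.period + c.head + f ∧ 0 < f ∧ f < c.period :=
      ⟨e.1 - ((k - 1) * c.period + c.head), by omega, by omega⟩
    rw [hf1, add_assoc, mul_comm, Nat.mul_add_mod] at hmod
    rcases Nat.lt_or_ge (c.head + f) c.period with hlt | hge
    · rw [Nat.mod_eq_of_lt hlt] at hmod; omega
    · rw [Nat.mod_eq_sub_mod hge, Nat.mod_eq_of_lt (by omega)] at hmod; omega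

theorem count_cons (c : Scheme) (e : ℕ × Bool) (l : List (ℕ × Bool)) (j : ℕ) :
    count c (e :: l) j = count c l j + if block c e.1 = j then 1 else 0 := by
  unfold count
  rw [List.countP_cons]
  simp

theorem Inv.receive {c : Scheme} (hc : c.Valid) {x : ℕ → Bool}
    (hx : c.HasHeaders x) {g : Ghost} (inv : Inv c x g) {a cl : ℕ}
    {err : ℕ → ℕ} {b : Bool} (h : Reception c x g a cl err b) :
    Inv c x (Ghost.receive c a cl g.rcv g.log err b) := by
  have hp := hc.head_lt
  have hs := hc.len_lt
  have hhead : c.head = c.len + 1 + c.s := rfl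
  have hsync := inv.synced h
  have hmono := h.mono
  have hle : g.clock ≤ a := by rcases h with h | h <;> omega
  have hle' : a ≤ g.clock + 1 := by rcases h with h | h <;> omega
  -- an error is recorded if the clocks of the two ends do not advance together
  have hadv : a = g.clock → err (block c a) = g.err (block c a) + 1 := by
    intro ha
    rcases h with h | ⟨-, -, -, rfl⟩
    · omega
    · exact addError_self c g.err a
  have hspur : ∀ e ∈ g.log, e.2 = false →
      0 < total c x err (block c e.1 - 1) + total c x err (block c e.1) := fun e he hf =>
    (inv.spurious e he hf).trans_le (Nat.add_le_add (total_mono hmono _) (total_mono hmono _))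
  -- the number of words in the current block
  have hcount : ∀ e ∈ g.log.head?, block c e.1 = block c a →
      count c g.log (block c a) + (g.rcv.wait + 1) + e.1 ≤ 1 + err (block c a) + a := by
    intro e he hb
    have h1 := block_mono c (inv.log_le e (List.mem_of_mem_head? he))
    have h2 := block_mono c hle
    have h3 : block c g.clock = block c a := by omega
    have h4 := inv.count_head e he (by omega)
    rw [h3] at h4
    have := hmono (block c a)
    rcases Nat.eq_or_lt_of_le hle with ha | ha
    · have := hadv ha.symm; omega
    · omega
  cases hacc : g.rcv.accepts c b with
  | false =>
    rw [Ghost.receive, Receiver.step_of_not_accepts hacc, hacc]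
    refine ⟨hsync.clean_le, hsync.clean_le_length, hsync.clean_eq, hsync.last_error,
      inv.log_length, ?_, ?_, inv.log_pos,
      fun e he => (inv.log_le e he).trans hle, inv.log_sorted, inv.genuine, fun j => (inv.count_le j).trans (Nat.add_le_add_left (hmono j) 1), ?_, hspur, ?_⟩
    · intro h; exact (inv.wait_nil h).trans (Nat.le_succ _)
    · intro e he hlt
      simp only at hlt he ⊢
      rcases h with ⟨h1, h2, -⟩ | ⟨-, -, h2, -⟩
      · have := inv.wait_eq e he (by omega); omega
      · omega
    · exact hcount
    · intro k hk
      simp only at hk ⊢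
      rcases Nat.lt_or_ge g.clock (k * c.period + c.head) with h' | h'
      · right
        by_contra h0
        have := inv.accepts_of_total_eq_zero hc hx h (k := k) (by omega) (by omega)
        rw [hacc] at this
        cases this
      · exact inv.missing_of_lt hmono h'
  | true =>
    rw [Ghost.receive, Receiver.step_of_accepts hacc, hacc]
    have hacc' := hacc
    rw [Receiver.accepts, Bool.and_eq_true, decide_eq_true_iff, decide_eq_true_iff] at hacc'
    -- Bob accepts only a period after the previous detection, whereas two bits of one block are
    -- less than a period apart on Alice's clock. The difference was paid by errors, which leaves
    -- room for one more detection.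
    have hcnt : count c g.log (block c a) ≤ err (block c a) := by
      rcases hlog : g.log with _ | ⟨e, l⟩
      · simp [count]
      · rw [← hlog]
        have hem : e ∈ g.log := by rw [hlog]; simp
        have hea := (inv.log_le e hem).trans hle
        have hpos := inv.log_pos e hem
        by_cases hb : block c e.1 = block c a
        · have h1 := hcount e (by rw [hlog]; simp) hb
          have h2 : a < e.1 + c.period := by
            have e1 : block c e.1 * c.period ≤ e.1 - 1 := Nat.div_mul_le_self _ _
            have e2 := Nat.lt_mul_div_succ (a - 1) (show 0 < c.period by omega)
            rw [block] at hb e1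
            rw [mul_comm, add_mul] at e2
            rw [show (a - 1) / c.period = (e.1 - 1) / c.period from hb.symm] at e2
            omega
          omega
        · have : count c g.log (block c a) = 0 := by
            rw [count, List.countP_eq_zero]
            intro e' he' hbe
            rw [beq_iff_eq] at hbe
            have h1 : e'.1 ≤ e.1 := by
              rw [hlog] at he'
              rcases List.mem_cons.1 he' with rfl | he'
              · exact le_rfl
              · have := inv.log_sorted
                rw [hlog] at this
                exact ((List.pairwise_cons.1 this).1 e' he').1
            have h2 := block_mono c h1
            have h3 := block_mono c hea
            omega
          omega
    refine ⟨hsync.clean_le, hsync.clean_le_length, hsync.clean_eq, hsync.last_error, ?_, ?_, ?_,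
      ?_, ?_, ?_, ?_, ?_, ?_, ?_, ?_⟩
    · simp [inv.log_length]
    · simp
    · intro e he _
      simp at he
      simp [← he]
    · intro e he
      rcases List.mem_cons.1 he with rfl | he
      · simp only; rcases h with h | h <;> omega
      · exact inv.log_pos e he
    · intro e he
      rcases List.mem_cons.1 he with rfl | he
      · exact le_rfl
      · exact (inv.log_le e he).trans hle
    · simp only [if_true]
      refine List.pairwise_cons.2 ⟨fun e he => ⟨(inv.log_le e he).trans hle, fun hg => ?_⟩,
        inv.log_sorted⟩
      rw [decide_eq_true_iff] at hg
      have := inv.log_le e he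
      simp only
      rcases h with h | h <;> omega
    · intro i e he hg
      rcases i with _ | i
      · simp only [if_true, List.getElem?_cons_zero, Option.some.injEq] at he
        subst he
        simp only [decide_eq_true_eq] at hg
        refine ⟨hg.2, ?_⟩
        simp [hsync.word hc hx hg.1 hg.2]
      · simp only [if_true, List.getElem?_cons_succ] at he ⊢
        exact inv.genuine i e he hg
    · intro j
      simp only [if_true]
      rw [count_cons]
      have := inv.count_le j
      have := hmono j
      split_ifs with hb
      · simp only at hb
        subst hb
        omega
      · omega
    · intro e he hb
      simp only [if_true, List.head?_cons, Option.mem_def, Option.some.injEq] at he ⊢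
      subst he
      rw [count_cons]
      simp only [if_true]
      omega
    · intro e he hf
      rcases List.mem_cons.1 he with rfl | he
      · by_contra h0
        have := hsync.genuine hc hx (by simp only at h0; omega) hacc'.2
        simp only [decide_eq_false_iff_not] at hf
        exact hf this
      · exact hspur e he hf
    · intro k hk
      simp only [if_true] at hk ⊢
      rcases Nat.lt_or_ge g.clock (k * c.period + c.head) with h' | h'
      · have hka : k * c.period + c.head = a := by omega
        by_contra hcon
        push Not at hcon
        have hb : block c a = k := by rw [← hka]; exact block_eq_of_header hc k
        have := hsync.genuine hc hx (by rw [hb]; omega) hacc'.2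
        apply hcon.1
        rw [hka]
        simp [this]
      · rcases inv.missing_of_lt hmono h' with h | h
        · exact Or.inl (List.mem_cons_of_mem _ h)
        · exact Or.inr h

theorem Inv.step {c : Scheme} (hc : c.Valid) {x : ℕ → Bool}
    (hx : c.HasHeaders x) {g : Ghost} (inv : Inv c x g) {e : Transmission}
    (he : ∀ b, e.sentA = some b → b = x g.clock)
    (hclock : ∀ b b', e = .bounceB b b' → 0 < g.clock) : Inv c x (g.step c e) := by
  cases e with
  | forward b b' =>
    rw [Ghost.step]
    have hb : b = x g.clock := he b rfl
    split_ifs with h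
    · exact inv.receive hc hx (Or.inl ⟨rfl, rfl, rfl, by rw [← h, hb]⟩)
    · exact inv.receive hc hx (Or.inr ⟨Or.inr rfl, Nat.succ_pos _, rfl, rfl⟩)
  | reply b b' =>
    rw [Ghost.step]
    split_ifs with h
    · exact inv
    · exact inv.error hc (Or.inl rfl)
  | bounceA b b' => exact inv.error hc (Or.inr rfl)
  | bounceB b b' => exact inv.receive hc hx (Or.inr ⟨Or.inl rfl, hclock _ _ rfl, rfl, rfl⟩)

end Ghost
end InsDel

namespace InsDel
open Transmission

/-! ### Decoding Alice's clock -/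

theorem card_filter_getElem? {α : Type*} (l : List α) (p : α → Bool) :
    ((Finset.range l.length).filter fun i => (l[i]?).any p = true).card = l.countP p := by
  induction l using List.reverseRecOn with
  | nil => simp
  | append_singleton l a ih =>
    rw [List.countP_append, ← ih, List.length_append, List.length_singleton,
      Finset.range_add_one, Finset.filter_insert]
    have h1 : ((Finset.range l.length).filter fun i => ((l ++ [a])[i]?).any p = true) =
        (Finset.range l.length).filter fun i => (l[i]?).any p = true := by
      apply Finset.filter_congr
      intro i hi
      rw [List.getElem?_append_left (by simpa using hi)]
    rw [h1]
    by_cases h : p a = true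
    · rw [if_pos (by simp [h]), Finset.card_insert_of_notMem (by simp)]
      simp [h]
    · rw [if_neg (by simp [h])]
      simp [h]

/-- With truncated subtraction both 0 and 1 have predecessor 0, so each value is used at most twice.
-/
theorem sum_pred_le (f : ℕ → ℕ) (l B : ℕ) :
    ∑ j ∈ Finset.Icc l B, f (j - 1) ≤ 2 * ∑ j ∈ Finset.Icc (l - 1) B, f j := by
  rw [← Finset.sum_filter_add_sum_filter_not _ (fun j => j = 0), two_mul]
  refine Nat.add_le_add ?_ ?_
  · rcases Nat.eq_zero_or_pos l with rfl | hl
    · have : (Finset.Icc 0 B).filter (fun j => j = 0) = {0} := by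
        ext j; simp; omega
      rw [this, Finset.sum_singleton]
      exact Finset.single_le_sum (f := f) (fun _ _ => Nat.zero_le _) (by simp)
    · have : (Finset.Icc l B).filter (fun j => j = 0) = ∅ := by
        ext j; simp; omega
      rw [this]; simp
  · rw [← Finset.sum_image (f := f) (g := fun j => j - 1)]
    · apply Finset.sum_le_sum_of_subset
      intro j hj
      simp only [Finset.mem_image, Finset.mem_filter, Finset.mem_Icc] at hj ⊢
      omega
    · intro i hi j hj h
      simp at hi hj h
      omega

theorem count_isData {c : Scheme} (hc : c.Valid) (k f : ℕ) (hf : f ≤ c.period) :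
    Nat.count (fun a => c.isData a) (k * c.period + f) = k * c.data + (f - c.head) := by
  have hp := hc.head_lt
  have step : ∀ k, Nat.count (fun a => c.isData a) (k * c.period) = k * c.data →
      ∀ f ≤ c.period, Nat.count (fun a => c.isData a) (k * c.period + f) =
        k * c.data + (f - c.head) := by
    intro k hk f
    induction f with
    | zero => intro _; simp [hk]
    | succ f ih =>
      intro hf
      rw [← add_assoc, Nat.count_succ, ih (by omega)]
      have : (k * c.period + f) % c.period = f := by
        rw [mul_comm, Nat.mul_add_mod, Nat.mod_eq_of_lt (by omega)]
      rw [Scheme.isData, this]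
      by_cases h : c.head ≤ f
      · simp [h]; omega
      · simp [h]; omega
  have base : ∀ k, Nat.count (fun a => c.isData a) (k * c.period) = k * c.data := by
    intro k
    induction k with
    | zero => simp
    | succ k ih =>
      rw [Nat.succ_mul, step k ih _ le_rfl, Nat.succ_mul]
  exact step k (base k) f hf

/-- A position in `0, …, N` that maximizes the score. -/
def best {β : Type*} [DecidableEq β] (W : ℕ → β) (N : ℕ) (ys : List β) : ℕ :=
  (List.range (N + 1)).foldl (fun b q =>
    if 2 * lcs W ys b + q < 2 * lcs W ys q + b then q else b) 0

theorem best_spec {β : Type*} [DecidableEq β] (W : ℕ → β) (N : ℕ) (ys : List β) :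
    best W N ys ≤ N ∧
      ∀ K ≤ N, 2 * lcs W ys K + best W N ys ≤ 2 * lcs W ys (best W N ys) + K := by
  have key : ∀ n, let b := (List.range (n + 1)).foldl (fun b q =>
      if 2 * lcs W ys b + q < 2 * lcs W ys q + b then q else b) 0
      b ≤ n ∧ ∀ K ≤ n, 2 * lcs W ys K + b ≤ 2 * lcs W ys b + K := by
    intro n
    induction n with
    | zero => simp
    | succ n ih =>
      simp only at ih ⊢
      rw [List.range_succ, List.foldl_append, List.foldl_cons, List.foldl_nil]
      set b := (List.range (n + 1)).foldl (fun b q =>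
        if 2 * lcs W ys b + q < 2 * lcs W ys q + b then q else b) 0
      split_ifs with h
      · refine ⟨le_rfl, fun K hK => ?_⟩
        rcases Nat.le_succ_iff.1 hK with h' | h'
        · have := ih.2 K h'; omega
        · rw [h']
      · refine ⟨by omega, fun K hK => ?_⟩
        rcases Nat.le_succ_iff.1 hK with h' | h'
        · exact ih.2 K h'
        · rw [Nat.succ_eq_add_one] at h'; subst h'; omega
  exact key N

/-- The number of Alice's bits that, as far as Bob's intermediary knows, have arrived. -/
def decode (c : Scheme) (N : ℕ) (r : Receiver) : ℕ :=
  let q := best c.word N r.words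
  if q = 0 then 0 else (q - 1) * c.data + min r.wait c.data

namespace Ghost

variable {c : Scheme} {x : ℕ → Bool} {g : Ghost}

/-- The block of the `p`-th detected word (earliest first), if it is certainly genuine. -/
def gen (c : Scheme) (g : Ghost) (p : ℕ) : Option ℕ :=
  match g.log.reverse[p]? with
  | some (a, true) => some (a / c.period)
  | _ => none

theorem gen_eq_some {p k : ℕ} : g.gen c p = some k ↔
    ∃ a, g.log.reverse[p]? = some (a, true) ∧ a / c.period = k := by
  unfold gen
  split
  · rename_i a h
    rw [h]; simp
  · rename_i h
    simp only [reduceCtorEq, false_iff, not_exists, not_and]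
    intro a ha
    exact absurd ha (h a)

theorem gen_eq_none {p : ℕ} {e : ℕ × Bool} (he : g.log.reverse[p]? = some e)
    (h : g.gen c p = none) : e.2 = false := by
  rcases e with ⟨a, b⟩
  cases b with
  | false => rfl
  | true =>
    have := (gen_eq_some (c := c) (k := a / c.period)).2 ⟨a, he, rfl⟩
    rw [h] at this
    cases this

theorem Inv.genuine_reverse (inv : Inv c x g) {p a : ℕ}
    (h : g.log.reverse[p]? = some (a, true)) :
    a % c.period = c.head ∧ g.rcv.words.reverse[p]? = some (c.word (a / c.period)) := by
  have hlt := (List.getElem?_eq_some_iff.1 h).1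
  rw [List.length_reverse] at hlt
  rw [List.getElem?_reverse hlt] at h
  rw [List.getElem?_reverse (by rw [← inv.log_length]; exact hlt), ← inv.log_length]
  exact inv.genuine _ _ h rfl

theorem Inv.sorted_reverse (inv : Inv c x g) {p p' : ℕ} {e e' : ℕ × Bool} (hp : p < p')
    (h : g.log.reverse[p]? = some e) (h' : g.log.reverse[p']? = some e') :
    e.1 ≤ e'.1 ∧ (e'.2 = true → e.1 < e'.1) := by
  have := List.pairwise_reverse.2 inv.log_sorted
  obtain ⟨h1, h2⟩ := List.getElem?_eq_some_iff.1 h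
  obtain ⟨h3, h4⟩ := List.getElem?_eq_some_iff.1 h'
  have := List.pairwise_iff_getElem.1 this p p' h1 h3 hp
  rwa [h2, h4] at this

theorem div_lt_div_of_mod_eq {a b p : ℕ} (h : a < b) (hm : a % p = b % p) : a / p < b / p := by
  have h1 := Nat.div_add_mod a p
  have h2 := Nat.div_add_mod b p
  have h3 : p * (a / p) < p * (b / p) := by omega
  exact Nat.lt_of_mul_lt_mul_left h3

/-- The number of headers that Alice's intermediary has completed at clock `a`. -/
def headers (c : Scheme) (a : ℕ) : ℕ := (a + c.period - c.head) / c.period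

theorem lt_headers (hc : c.Valid) {a k : ℕ} : k < headers c a ↔ k * c.period + c.head ≤ a := by
  have := hc.head_lt
  rw [headers, ← Nat.succ_le_iff, Nat.le_div_iff_mul_le (by omega), Nat.succ_mul]
  omega

/-- The false and missing words of `decoding_error` are converted into trouble f with sum S. A block
with a false detection has at most f(j-1) + 2f(j) detections, 4S in total. A missing header has
f(k-2) + f(k-1) + f(k) ≥ 1, and these sums amount to at most 7S, as `sum_pred_le` doubles with each
shift. Hence 22 = 2·(4 + 7). The window starts at u - 2 because trouble may precede its effect by
two blocks. -/
theorem Inv.exists_decoding_error (hc : c.Valid) (inv : Inv c x g) {ε : ℝ} {N : ℕ}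
    (hW : ∀ (u K q : ℕ) (Q : List (ℕ × ℕ)), K ≤ N → q ≤ N → u ≤ K → u ≤ q → Increasing Q →
      (∀ p ∈ Q, u ≤ p.1 ∧ p.1 < K ∧ u ≤ p.2 ∧ p.2 < q ∧ p.1 ≠ p.2 ∧ c.word p.1 = c.word p.2) →
      2 * (Q.length : ℝ) ≤ ε * (((K : ℝ) - u) + ((q : ℝ) - u)))
    (hN : headers c g.clock ≤ N) :
    ∃ u, u ≤ headers c g.clock ∧ u ≤ best c.word N g.rcv.words ∧
      (1 - ε) * (((headers c g.clock : ℝ) - u) + ((best c.word N g.rcv.words : ℝ) - u)) ≤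
        22 * (∑ j ∈ Finset.Icc (u - 2) (block c g.clock), total c x g.err j : ℕ) := by
  have hp := hc.head_lt
  have hbest := best_spec c.word N g.rcv.words
  have hlen := inv.log_length
  obtain ⟨p, u, hpu, huK, huq, hle⟩ := decoding_error hW (gen := g.gen c) hN hbest.1
    (by
      intro p k _ hk
      obtain ⟨a, ha, rfl⟩ := gen_eq_some.1 hk
      have h1 := inv.genuine_reverse ha
      refine ⟨h1.2, (lt_headers hc).2 ?_⟩
      have h2 := inv.log_le (a, true) (List.mem_reverse.1 (List.mem_of_getElem? ha))
      have h3 := Nat.div_add_mod' a c.period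
      simp only at h2
      omega)
    (by
      intro p p' k k' hpp _ hk hk'
      obtain ⟨a, ha, rfl⟩ := gen_eq_some.1 hk
      obtain ⟨a', ha', rfl⟩ := gen_eq_some.1 hk'
      have h1 := inv.sorted_reverse hpp ha ha'
      exact div_lt_div_of_mod_eq (h1.2 rfl)
        ((inv.genuine_reverse ha).1.trans (inv.genuine_reverse ha').1.symm))
    (hbest.2 _ hN)
  refine ⟨u, huK, huq, hle.trans ?_⟩
  set B := block c g.clock with hB
  set f := total c x g.err with hf
  set S := ∑ j ∈ Finset.Icc (u - 2) B, f j with hS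
  -- spurious words
  have hng : ((Finset.Ico p g.rcv.words.length).filter fun i => g.gen c i = none).card ≤ 4 * S := by
    have hent : ∀ i ∈ (Finset.Ico p g.rcv.words.length).filter fun i => g.gen c i = none,
        ∃ e, g.log.reverse[i]? = some e ∧ e ∈ g.log ∧ e.2 = false ∧ u - 1 ≤ block c e.1 ∧
          block c e.1 ≤ B := by
      intro i hi
      simp only [Finset.mem_filter, Finset.mem_Ico] at hi
      obtain ⟨e, he⟩ : ∃ e, g.log.reverse[i]? = some e :=
        ⟨_, List.getElem?_eq_getElem (by rw [List.length_reverse, hlen]; exact hi.1.2)⟩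
      have hem := List.mem_reverse.1 (List.mem_of_getElem? he)
      refine ⟨e, he, hem, gen_eq_none he hi.2, ?_, block_mono c (inv.log_le e hem)⟩
      rcases hpu with h | h
      · omega
      · obtain ⟨a, ha, hau⟩ := gen_eq_some.1 h.2.2.2
        have h1 := inv.sorted_reverse (show p - 1 < i by omega) ha he
        have h2 := (inv.genuine_reverse ha).1
        have h3 := Nat.div_add_mod' a c.period
        rw [h2, hau] at h3
        have h4 := block_mono c h1.1
        rw [← h3, block_eq_of_header hc] at h4
        exact h4
    have hfib := Finset.card_eq_sum_card_fiberwise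
      (f := fun i => block c ((g.log.reverse[i]?).getD (0, false)).1)
      (s := (Finset.Ico p g.rcv.words.length).filter fun i => g.gen c i = none)
      (t := Finset.Icc (u - 1) B) (by
        intro i hi
        obtain ⟨e, he, -, -, h1, h2⟩ := hent i hi
        simp only [he, Option.getD_some, Finset.coe_Icc, Set.mem_Icc]
        exact ⟨h1, h2⟩)
    rw [hfib]
    have hone : ∀ j ∈ Finset.Icc (u - 1) B, (((Finset.Ico p g.rcv.words.length).filter
        fun i => g.gen c i = none).filter fun i =>
          block c ((g.log.reverse[i]?).getD (0, false)).1 = j).card ≤ f (j - 1) + 2 * f j := by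
      intro j _
      rcases Finset.eq_empty_or_nonempty (((Finset.Ico p g.rcv.words.length).filter
        fun i => g.gen c i = none).filter fun i =>
          block c ((g.log.reverse[i]?).getD (0, false)).1 = j) with h | ⟨i, hi⟩
      · rw [h]; simp
      · rw [Finset.mem_filter] at hi
        obtain ⟨e, he, hem, he2, -, -⟩ := hent i hi.1
        have hej : block c e.1 = j := by simpa [he] using hi.2
        have h1 := inv.spurious e hem he2
        rw [hej] at h1
        change 0 < f (j - 1) + f j at h1
        have h2 := inv.count_le j
        have h3 : (((Finset.Ico p g.rcv.words.length).filter
            fun i => g.gen c i = none).filter fun i =>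
              block c ((g.log.reverse[i]?).getD (0, false)).1 = j).card ≤ count c g.log j := by
          rw [count, ← List.countP_reverse, ← card_filter_getElem?]
          apply Finset.card_le_card
          intro i hi
          rw [Finset.mem_filter] at hi
          obtain ⟨e, he, hem, he2, -, -⟩ := hent i hi.1
          have hej : block c e.1 = j := by simpa [he] using hi.2
          rw [Finset.mem_filter, Finset.mem_range]
          exact ⟨(List.getElem?_eq_some_iff.1 he).1, by simp [he, hej]⟩
        have h4 : g.err j ≤ f j := Nat.le_add_right _ _
        omega
    refine (Finset.sum_le_sum hone).trans ?_
    rw [Finset.sum_add_distrib, ← Finset.mul_sum]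
    have h1 := sum_pred_le f (u - 1) B
    have h2 : ∑ j ∈ Finset.Icc (u - 1) B, f j ≤ S :=
      Finset.sum_le_sum_of_subset (Finset.Icc_subset_Icc (by omega) le_rfl)
    rw [show u - 1 - 1 = u - 2 by omega] at h1
    omega
  -- missing headers
  have hmiss : ((Finset.Ico u (headers c g.clock)).filter fun k =>
      ∀ i < g.rcv.words.length, g.gen c i ≠ some k).card ≤ 7 * S := by
    have hpos : ∀ k ∈ (Finset.Ico u (headers c g.clock)).filter fun k =>
        ∀ i < g.rcv.words.length, g.gen c i ≠ some k, 1 ≤ f (k - 2) + f (k - 1) + f k := by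
      intro k hk
      rw [Finset.mem_filter, Finset.mem_Ico, lt_headers hc] at hk
      rcases inv.missing k hk.1.2 with h | h
      · exfalso
        obtain ⟨i, hi⟩ := List.getElem?_of_mem (List.mem_reverse.2 h)
        have hil := (List.getElem?_eq_some_iff.1 hi).1
        rw [List.length_reverse, hlen] at hil
        refine hk.2 i hil (gen_eq_some.2 ⟨_, hi, ?_⟩)
        rw [mul_comm, Nat.mul_add_div (by omega), Nat.div_eq_of_lt hp, Nat.add_zero]
      · exact h
    have hsub : ((Finset.Ico u (headers c g.clock)).filter fun k =>
        ∀ i < g.rcv.words.length, g.gen c i ≠ some k) ⊆ Finset.Icc u B := by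
      intro k hk
      rw [Finset.mem_filter, Finset.mem_Ico, lt_headers hc] at hk
      rw [Finset.mem_Icc]
      refine ⟨hk.1.1, ?_⟩
      have := block_mono c hk.1.2
      rwa [block_eq_of_header hc] at this
    have h1 : ((Finset.Ico u (headers c g.clock)).filter fun k =>
        ∀ i < g.rcv.words.length, g.gen c i ≠ some k).card ≤
        ∑ k ∈ Finset.Icc u B, (f (k - 2) + f (k - 1) + f k) := by
      rw [Finset.card_eq_sum_ones]
      exact (Finset.sum_le_sum hpos).trans (Finset.sum_le_sum_of_subset hsub)
    rw [Finset.sum_add_distrib, Finset.sum_add_distrib] at h1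
    have h2 := sum_pred_le (fun j => f (j - 1)) u B
    have h3 := sum_pred_le f (u - 1) B
    have h4 := sum_pred_le f u B
    have hk2 : ∀ k, k - 1 - 1 = k - 2 := by omega
    simp only [hk2] at h2 h3
    have h5 : ∑ j ∈ Finset.Icc (u - 1) B, f j ≤ S :=
      Finset.sum_le_sum_of_subset (Finset.Icc_subset_Icc (by omega) le_rfl)
    have h6 : ∑ j ∈ Finset.Icc u B, f j ≤ S :=
      Finset.sum_le_sum_of_subset (Finset.Icc_subset_Icc (by omega) le_rfl)
    omega
  have h : ((((Finset.Ico p g.rcv.words.length).filter fun i => g.gen c i = none).card : ℕ) : ℝ) +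
      (((Finset.Ico u (headers c g.clock)).filter fun k =>
      ∀ i < g.rcv.words.length, g.gen c i ≠ some k).card : ℕ) ≤ 11 * (S : ℕ) := by
    exact_mod_cast (Nat.add_le_add hng hmiss).trans (by omega : 4 * S + 7 * S ≤ 11 * S)
  linarith

/-- All windows that end with block `k` have few errors. -/
def Good (C : ℕ) (f : ℕ → ℕ) (k : ℕ) : Prop := ∀ y ≤ k, C * ∑ j ∈ Finset.Icc y k, f j ≤ k - y

theorem Good.mono {C : ℕ} {f f' : ℕ → ℕ} {k : ℕ} (h : Good C f' k) (hf : ∀ j, f j ≤ f' j) :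
    Good C f k := fun y hy =>
  (Nat.mul_le_mul_left _ (Finset.sum_le_sum fun j _ => hf j)).trans (h y hy)

/-- A single unit of trouble in the last three blocks costs C ≥ 3, while such a window allows at
most 2. -/
theorem Good.eq_zero {C : ℕ} (hC : 3 ≤ C) {f : ℕ → ℕ} {k j : ℕ} (h : Good C f k) (hj : j ≤ k)
    (hj' : k ≤ j + 2) : f j = 0 := by
  have h1 := h j hj
  have h2 : f j ≤ ∑ i ∈ Finset.Icc j k, f i :=
    Finset.single_le_sum (f := f) (fun _ _ => Nat.zero_le _) (by simp [hj])
  by_contra h0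
  have h3 : 3 * 1 ≤ C * ∑ i ∈ Finset.Icc j k, f i := Nat.mul_le_mul hC (by omega)
  omega

/-- As 88 = 4·22, goodness turns the decoding error into 4((K - u) + (q - u)) ≤ k + 2 - u, where K
is the true and q the estimated number of headers. For K = k + 1 integrality forces u = k + 1 = q;
for K ≤ k it keeps q from exceeding k. -/
theorem Inv.best_of_good (hc : c.Valid) (inv : Inv c x g) {ε : ℝ} {N C k : ℕ}
    (hC : 88 ≤ C * (1 - ε))
    (hW : ∀ (u K q : ℕ) (Q : List (ℕ × ℕ)), K ≤ N → q ≤ N → u ≤ K → u ≤ q → Increasing Q →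
      (∀ p ∈ Q, u ≤ p.1 ∧ p.1 < K ∧ u ≤ p.2 ∧ p.2 < q ∧ p.1 ≠ p.2 ∧ c.word p.1 = c.word p.2) →
      2 * (Q.length : ℝ) ≤ ε * (((K : ℝ) - u) + ((q : ℝ) - u)))
    (hN : headers c g.clock ≤ N) (hgood : Good C (total c x g.err) k)
    (hk : block c g.clock ≤ k) :
    (headers c g.clock ≤ k → best c.word N g.rcv.words ≤ k) ∧
    (headers c g.clock = k + 1 → best c.word N g.rcv.words = k + 1) := by
  obtain ⟨u, huK, huq, hle⟩ := inv.exists_decoding_error hc hW hN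
  set K := headers c g.clock
  set q := best c.word N g.rcv.words
  set S := ∑ j ∈ Finset.Icc (u - 2) (block c g.clock), total c x g.err j with hS
  have hmain : u ≤ k + 1 → 4 * ((K - u) + (q - u)) ≤ k + 2 - u := by
    intro hu
    have h1 : C * S ≤ k + 2 - u := by
      rcases Nat.lt_or_ge k (u - 2) with h | h
      · omega
      · have h2 := hgood (u - 2) h
        have h3 : S ≤ ∑ j ∈ Finset.Icc (u - 2) k, total c x g.err j :=
          Finset.sum_le_sum_of_subset (Finset.Icc_subset_Icc le_rfl hk)
        have := Nat.mul_le_mul_left C h3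
        omega
    have h2 : (C : ℝ) * S ≤ ((k + 2 - u : ℕ) : ℝ) := by exact_mod_cast h1
    have h3 : ((K : ℝ) - u) + ((q : ℝ) - u) = (((K - u) + (q - u) : ℕ) : ℝ) := by
      rw [Nat.cast_add, Nat.cast_sub huK, Nat.cast_sub huq]
    rw [h3] at hle
    set X := (K - u) + (q - u)
    have h4 : (88 : ℝ) * X ≤ 22 * ((k + 2 - u : ℕ) : ℝ) := by
      have hX : (0 : ℝ) ≤ X := Nat.cast_nonneg _
      have hC0 : (0 : ℝ) ≤ C := Nat.cast_nonneg _
      calc (88 : ℝ) * X ≤ C * (1 - ε) * X := mul_le_mul_of_nonneg_right hC hX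
        _ = C * ((1 - ε) * X) := by ring
        _ ≤ C * (22 * S) := mul_le_mul_of_nonneg_left hle hC0
        _ = 22 * (C * S) := by ring
        _ ≤ _ := by linarith
    have h5 : 88 * X ≤ 22 * (k + 2 - u) := by exact_mod_cast h4
    omega
  constructor
  · intro hK
    have := hmain (by omega)
    omega
  · intro hK
    have := hmain (by omega)
    omega

/-- Up to the header of a good block `k` Bob's estimate does not exceed the start of the block. -/
theorem Inv.decode_le (hc : c.Valid) (inv : Inv c x g) {ε : ℝ} {N C k : ℕ}
    (hC : 88 ≤ C * (1 - ε))
    (hW : ∀ (u K q : ℕ) (Q : List (ℕ × ℕ)), K ≤ N → q ≤ N → u ≤ K → u ≤ q → Increasing Q →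
      (∀ p ∈ Q, u ≤ p.1 ∧ p.1 < K ∧ u ≤ p.2 ∧ p.2 < q ∧ p.1 ≠ p.2 ∧ c.word p.1 = c.word p.2) →
      2 * (Q.length : ℝ) ≤ ε * (((K : ℝ) - u) + ((q : ℝ) - u)))
    (hN : headers c g.clock ≤ N) (hgood : Good C (total c x g.err) k)
    (hk : g.clock < k * c.period + c.head) : decode c N g.rcv ≤ k * c.data := by
  have h1 : headers c g.clock ≤ k := by
    rw [← not_lt, lt_headers hc]; omega
  have h2 : block c g.clock ≤ k := by
    have := block_mono c hk.le
    rwa [block_eq_of_header hc] at this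
  have h3 := (inv.best_of_good hc hC hW hN hgood h2).1 h1
  simp only [decode]
  split_ifs with h0
  · exact Nat.zero_le _
  · calc (best c.word N g.rcv.words - 1) * c.data + min g.rcv.wait c.data ≤
        (best c.word N g.rcv.words - 1) * c.data + c.data := by
          have := min_le_right g.rcv.wait c.data; omega
      _ = best c.word N g.rcv.words * c.data := by
          rw [← Nat.succ_mul]; congr 1; omega
      _ ≤ k * c.data := Nat.mul_le_mul_right _ h3

/-- After the header of a good block Bob's estimate is correct. -/
theorem Inv.decode_eq (hc : c.Valid) (inv : Inv c x g) {ε : ℝ} {N C k : ℕ}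
    (hC : 88 ≤ C * (1 - ε)) (hC3 : 3 ≤ C)
    (hW : ∀ (u K q : ℕ) (Q : List (ℕ × ℕ)), K ≤ N → q ≤ N → u ≤ K → u ≤ q → Increasing Q →
      (∀ p ∈ Q, u ≤ p.1 ∧ p.1 < K ∧ u ≤ p.2 ∧ p.2 < q ∧ p.1 ≠ p.2 ∧ c.word p.1 = c.word p.2) →
      2 * (Q.length : ℝ) ≤ ε * (((K : ℝ) - u) + ((q : ℝ) - u)))
    (hN : headers c g.clock ≤ N) (hgood : Good C (total c x g.err) k)
    (hk : k * c.period + c.head ≤ g.clock) (hk' : g.clock ≤ (k + 1) * c.period) :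
    decode c N g.rcv = k * c.data + (g.clock - k * c.period - c.head) := by
  have hp := hc.head_lt
  have hhead : c.head = c.len + 1 + c.s := rfl
  rw [Nat.succ_mul] at hk'
  have hblock : block c g.clock = k := by
    refine le_antisymm ?_ ?_
    · rw [block, ← Nat.lt_succ_iff, Nat.div_lt_iff_lt_mul (by omega), Nat.succ_mul]
      omega
    · have := block_mono c hk
      rwa [block_eq_of_header hc] at this
  have hK : headers c g.clock = k + 1 := by
    refine le_antisymm ?_ ?_
    · rw [← not_lt, lt_headers hc, Nat.succ_mul]; omega
    · exact (lt_headers hc).2 hk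
  have hq := (inv.best_of_good hc hC hW hN hgood hblock.le).2 hK
  have z0 := hgood.eq_zero hC3 le_rfl (by omega)
  have z1 := hgood.eq_zero hC3 (show k - 1 ≤ k by omega) (by omega)
  have z2 := hgood.eq_zero hC3 (show k - 2 ≤ k by omega) (by omega)
  -- A good block and the two blocks before it have no trouble, so its header was detected. For the
  -- same reason no other detection follows it in this block, and the latest log entry e is this
  -- header.
  have hmem : (k * c.period + c.head, true) ∈ g.log := by
    rcases inv.missing k hk with h | h
    · exact h
    · omega
  obtain ⟨e, l, hlog⟩ := List.exists_cons_of_ne_nil (List.ne_nil_of_mem hmem)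
  have hem : e ∈ g.log := by rw [hlog]; simp
  have hge : k * c.period + c.head ≤ e.1 := by
    rw [hlog] at hmem
    rcases List.mem_cons.1 hmem with h | h
    · rw [← h]
    · have := inv.log_sorted
      rw [hlog] at this
      exact ((List.pairwise_cons.1 this).1 _ h).1
  have hea := inv.log_le e hem
  have heb : block c e.1 = k := by
    have h1 := block_mono c hge
    have h2 := block_mono c hea
    rw [block_eq_of_header hc] at h1
    omega
  have he1 : e.1 = k * c.period + c.head := by
    cases he2 : e.2 with
    | false =>
      have := inv.spurious e hem he2
      rw [heb] at this
      omega
    | true =>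
      have h1 := (inv.genuine 0 e (by rw [hlog]; rfl) he2).1
      obtain ⟨f, hf⟩ := Nat.exists_eq_add_of_le hge
      rw [hf, add_assoc, mul_comm, Nat.mul_add_mod] at h1
      rcases Nat.lt_or_ge (c.head + f) c.period with h | h
      · rw [Nat.mod_eq_of_lt h] at h1; omega
      · rw [Nat.mod_eq_sub_mod h, Nat.mod_eq_of_lt (by omega)] at h1; omega
  have herr : g.err k = 0 := by unfold total at z0; omega
  have hwait : g.rcv.wait + e.1 ≤ g.clock := by
    have h1 := inv.count_head e (by rw [hlog]; rfl) (by omega)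
    rw [hblock] at h1
    have h2 : 1 ≤ count c g.log k := by
      rw [hlog, count_cons, if_pos heb]; omega
    omega
  have hsync : Synced c x g.clock g.clean g.rcv.buf g.err :=
    ⟨inv.clean_le, inv.clean_le_length, inv.clean_eq, inv.last_error⟩
  have hcl := hsync.clean_ge hc
    (by rw [hblock]; unfold total at z1; omega) (by rw [hblock]; exact herr)
  have hepos := inv.log_pos e hem
  have hw := inv.wait_eq e (by rw [hlog]; rfl) (by omega)
  have hdata : c.data = c.period - c.head := rfl
  simp only [decode]
  rw [hq, if_neg (by omega), Nat.add_sub_cancel, min_eq_left (by omega)]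
  omega

end Ghost
end InsDel

namespace InsDel
open Transmission

/-! ### Runs of the simulation -/

namespace Ghost

def run (c : Scheme) (tr : List Transmission) : Ghost := tr.foldl (Ghost.step c) (init c)

theorem run_append_singleton (c : Scheme) (tr : List Transmission) (e : Transmission) :
    run c (tr ++ [e]) = (run c tr).step c e := by
  simp [run]

theorem run_clock (c : Scheme) (tr : List Transmission) :
    (run c tr).clock = (tr.filterMap sentA).length := by
  induction tr using List.reverseRecOn with
  | nil => rfl
  | append_singleton tr e ih =>
    rw [run_append_singleton]
    cases e <;> simp only [step] <;> (try split_ifs) <;> simp [receive, ih, sentA, List.filterMap_cons]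

theorem run_rcv (c : Scheme) (tr : List Transmission) :
    (run c tr).rcv = (tr.filterMap recvB).foldl (Receiver.step c) (.init c) := by
  induction tr using List.reverseRecOn with
  | nil => rfl
  | append_singleton tr e ih =>
    rw [run_append_singleton]
    cases e <;> simp only [step] <;> (try split_ifs) <;> simp [receive, ih, recvB, List.filterMap_cons]

theorem le_step_err (c : Scheme) (g : Ghost) (e : Transmission) (j : ℕ) :
    g.err j ≤ (g.step c e).err j := by
  cases e <;> simp only [step] <;> (try split_ifs) <;>
    simp only [receive, le_refl, le_addError]

theorem run_err_le (c : Scheme) (tr tr' : List Transmission) (j : ℕ) :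
    (run c tr).err j ≤ (run c (tr ++ tr')).err j := by
  induction tr' using List.reverseRecOn with
  | nil => simp
  | append_singleton tr' e ih =>
    rw [← List.append_assoc, run_append_singleton]
    exact ih.trans (le_step_err c _ e j)

theorem sum_addError_le (c : Scheme) (err : ℕ → ℕ) (a M : ℕ) :
    ∑ j ∈ Finset.range M, addError c err a j ≤ ∑ j ∈ Finset.range M, err j + 1 := by
  simp only [addError, Finset.sum_add_distrib, Finset.sum_ite_eq']
  split_ifs <;> omega

theorem sum_run_err_le (c : Scheme) (tr : List Transmission) (M : ℕ) :
    ∑ j ∈ Finset.range M, (run c tr).err j ≤ (tr.filter isError).length := by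
  induction tr using List.reverseRecOn with
  | nil => simp [run, init]
  | append_singleton tr e ih =>
    rw [run_append_singleton, List.filter_append, List.length_append]
    have key : ∀ a, ∑ j ∈ Finset.range M, addError c (run c tr).err a j ≤
        (tr.filter isError).length + 1 := fun a =>
      (sum_addError_le c _ a M).trans (Nat.add_le_add_right ih 1)
    cases e with
    | forward b b' =>
      by_cases h : b = b'
      · simpa [step, receive, h, isError, List.filter_cons] using ih
      · simpa [step, receive, h, isError, List.filter_cons] using key _
    | reply b b' =>
      by_cases h : b = b'
      · simpa [step, receive, h, isError, List.filter_cons] using ih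
      · simpa [step, receive, h, isError, List.filter_cons] using key _
    | bounceA b b' => simpa [step, receive, isError, List.filter_cons] using key _
    | bounceB b b' => simpa [step, receive, isError, List.filter_cons] using key _

/-- Alice's stream of transmitted bits, continued by headers. -/
def stream (c : Scheme) (tr : List Transmission) (a : ℕ) : Bool :=
  ((tr.filterMap sentA)[a]?).getD (c.headerBit a)

theorem run_inv {c : Scheme} (hc : c.Valid) {tr : List Transmission} {s : Side}
    (htr : Trace s tr) {x : ℕ → Bool} (hx : c.HasHeaders x)
    (hsent : ∀ a b, (tr.filterMap sentA)[a]? = some b → b = x a) :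
    ∀ tr₁ tr₂, tr = tr₁ ++ tr₂ → Inv c x (run c tr₁) := by
  intro tr₁
  induction tr₁ using List.reverseRecOn with
  | nil => exact fun _ _ => inv_init c x
  | append_singleton tr₁ e ih =>
    intro tr₂ h
    rw [List.append_assoc, List.singleton_append] at h
    rw [run_append_singleton]
    refine (ih _ h).step hc hx (fun b hb => ?_) (fun b b' he => ?_)
    · rw [run_clock]
      apply hsent
      rw [h, List.filterMap_append, List.filterMap_cons_some hb,
        List.getElem?_append_right le_rfl, Nat.sub_self, List.getElem?_cons_zero]
    · obtain ⟨s', h1, -, h3⟩ := htr.append _ _ _ h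
      rw [he] at h3
      have hs' : s' = .B := by
        cases s' with
        | A => simp [sentA] at h3
        | B => rfl
      have := (h1.lengths.2 hs').1
      rw [run_clock]
      omega

theorem exists_split_sentA (tr : List Transmission) {a : ℕ}
    (ha : a < (tr.filterMap sentA).length) :
    ∃ tr₁ e tr₂, tr = tr₁ ++ e :: tr₂ ∧ (tr₁.filterMap sentA).length = a ∧ (sentA e).isSome := by
  induction tr using List.reverseRecOn with
  | nil => simp at ha
  | append_singleton tr e ih =>
    by_cases h : a < (tr.filterMap sentA).length
    · obtain ⟨tr₁, e', tr₂, h1, h2, h3⟩ := ih h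
      exact ⟨tr₁, e', tr₂ ++ [e], by simp [h1], h2, h3⟩
    · refine ⟨tr, e, [], rfl, ?_, ?_⟩
      · cases e <;> simp [sentA, List.filterMap_cons] at ha <;> omega
      · cases e <;> simp [sentA, List.filterMap_cons] at ha ⊢ <;> omega

/-- A data round without an error is an undisturbed exchange. -/
theorem exists_exchange {c : Scheme} {tr : List Transmission} {s : Side} (htr : Trace s tr)
    {a : ℕ} (ha : a + 1 < (tr.filterMap sentA).length)
    (herr : (run c tr).err (block c (a + 1)) = 0) :
    ∃ tr₁ b y tr₂, tr = tr₁ ++ .forward b b :: .reply y y :: tr₂ ∧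
      (tr₁.filterMap sentA).length = a := by
  obtain ⟨tr₁, e, tr₂, h1, h2, h3⟩ := exists_split_sentA tr (Nat.lt_of_succ_lt ha)
  have herr1 : ((run c tr₁).step c e).err (block c (a + 1)) = 0 := by
    have := run_err_le c (tr₁ ++ [e]) tr₂ (block c (a + 1))
    rw [List.append_assoc, List.singleton_append, ← h1, herr] at this
    rw [← run_append_singleton]
    omega
  have hclock : (run c tr₁).clock = a := by rw [run_clock, h2]
  obtain ⟨b, rfl⟩ : ∃ b, e = .forward b b := by
    cases e with
    | forward b b' =>
      by_cases h : b = b'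
      · exact ⟨b, by rw [h]⟩
      · simp [step, h, receive, hclock, addError_self] at herr1
    | bounceA b b' => simp [step, hclock, addError_self] at herr1
    | reply b b' => simp [sentA] at h3
    | bounceB b b' => simp [sentA] at h3
  rcases tr₂ with _ | ⟨e₂, tr₂⟩
  · rw [h1] at ha
    simp [sentA, h2] at ha
  have h1' : tr = (tr₁ ++ [.forward b b]) ++ e₂ :: tr₂ := by simp [h1]
  -- Once Alice's bit has been forwarded it is Bob's turn, so the next transmission cannot be hers.
  have hB : (sentA e₂).isSome = false := by
    obtain ⟨s', hs1, hs2, hs3⟩ := htr.append _ _ _ h1'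
    obtain ⟨-, -, hs2', -⟩ := htr.append _ _ _ h1
    have l1 := hs2'.lengths.2 rfl
    by_contra hcon
    have : s' = .A := hs3.2 (by simpa only [Bool.not_eq_false] using hcon)
    have := hs1.lengths.1 this
    omega
  have herr2 : ((run c (tr₁ ++ [.forward b b])).step c e₂).err (block c (a + 1)) = 0 := by
    have := run_err_le c (tr₁ ++ [.forward b b] ++ [e₂]) tr₂ (block c (a + 1))
    rw [List.append_assoc _ [e₂], List.singleton_append, ← h1', herr] at this
    rw [← run_append_singleton]
    omega
  have hclock2 : (run c (tr₁ ++ [.forward b b])).clock = a + 1 := by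
    rw [run_clock]; simp [sentA, h2]
  obtain ⟨y, rfl⟩ : ∃ y, e₂ = .reply y y := by
    cases e₂ with
    | reply y y' =>
      by_cases h : y = y'
      · exact ⟨y, by rw [h]⟩
      · simp [step, h, hclock2, addError_self] at herr2
    | bounceB b b' => simp [step, receive, hclock2, addError_self] at herr2
    | forward b b' => simp [sentA] at hB
    | bounceA b b' => simp [sentA] at hB
  exact ⟨tr₁, b, y, tr₂, h1, h2⟩

theorem exists_prefix_recvB (tr : List Transmission) {t : ℕ}
    (ht : t ≤ (tr.filterMap recvB).length) :
    ∃ tr₁ tr₂, tr = tr₁ ++ tr₂ ∧ tr₁.filterMap recvB = (tr.filterMap recvB).take t := by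
  induction tr using List.reverseRecOn with
  | nil => exact ⟨[], [], rfl, by simp⟩
  | append_singleton tr e ih =>
    by_cases h : t ≤ (tr.filterMap recvB).length
    · obtain ⟨tr₁, tr₂, h1, h2⟩ := ih h
      refine ⟨tr₁, tr₂ ++ [e], by simp [h1], ?_⟩
      rw [h2, List.filterMap_append, List.take_append_of_le_length h]
    · refine ⟨tr ++ [e], [], by simp, ?_⟩
      rw [List.take_of_length_le]
      cases e <;> simp [recvB, List.filterMap_cons] at ht ⊢ <;> omega

end Ghost

/-- The number of bits that Bob's intermediary has to reveal when it has received `bits`; at the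
end it reveals everything that is left. -/
def target (c : Scheme) (N m F : ℕ) (bits : List Bool) : ℕ :=
  if F ≤ bits.length then m else decode c N (bits.foldl (Receiver.step c) (.init c))

/-- The words can be told apart although some of them get lost or are replaced. -/
def Separated (c : Scheme) (N : ℕ) (ε : ℝ) : Prop :=
  ∀ (u K q : ℕ) (Q : List (ℕ × ℕ)), K ≤ N → q ≤ N → u ≤ K → u ≤ q → Increasing Q →
      (∀ p ∈ Q, u ≤ p.1 ∧ p.1 < K ∧ u ≤ p.2 ∧ p.2 < q ∧ p.1 ≠ p.2 ∧ c.word p.1 = c.word p.2) →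
      2 * (Q.length : ℝ) ≤ ε * (((K : ℝ) - u) + ((q : ℝ) - u))

theorem headers_le {c : Scheme} (hc : c.Valid) (a : ℕ) : Ghost.headers c a ≤ a := by
  have := hc.head_lt
  have h1 : c.head = c.len + 1 + c.s := rfl
  rw [← not_lt, Ghost.lt_headers hc]
  have : a * 1 ≤ a * c.period := Nat.mul_le_mul_left _ (by omega)
  omega

variable {c : Scheme} {n m N F C : ℕ} {ε : ℝ} {cfg : Config} {tr : List Transmission}

theorem Outcome.hasHeaders
    (o : Outcome n m (fun a => c.isData a) c.headerBit (target c N m F) cfg tr) :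
    c.HasHeaders (Ghost.stream c tr) := by
  intro a ha
  unfold Ghost.stream
  by_cases h : a < (tr.filterMap sentA).length
  · rw [o.sentA_header a h (by simpa [Scheme.isData] using ha)]; rfl
  · rw [List.getElem?_eq_none (not_lt.1 h)]; rfl

/-- One side has used up its n / 2 bits, and each error lets the counts at the two ends drift apart
by at most one. -/
theorem Outcome.sentA_length
    (o : Outcome n m (fun a => c.isData a) c.headerBit (target c N m F) cfg tr) :
    n / 2 ≤ (tr.filterMap sentA).length + cfg.edits ∧
    n / 2 ≤ (tr.filterMap recvB).length + cfg.edits ∧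
    n / 2 ≤ (tr.filterMap recvA).length + 1 + cfg.edits := by
  have h1 := length_recvB_le tr
  have h2 := o.errors
  have h3 := o.trace.lengths
  rcases o.finished with ⟨hs, h⟩ | ⟨hs, h⟩ <;> simp [hs] at h3 <;> omega

theorem Outcome.stream_eq {isData header : ℕ → Bool} {tg : List Bool → ℕ}
    (_ : Outcome n m isData header tg cfg tr) (a : ℕ) (b : Bool)
    (h : (tr.filterMap sentA)[a]? = some b) : b = Ghost.stream c tr a := by
  rw [Ghost.stream, h]; rfl

/-- The estimate in a good block. -/
theorem Outcome.decode_eq (hc : c.Valid) (hC : 88 ≤ C * (1 - ε)) (hC3 : 3 ≤ C)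
    (hW : Separated c N ε) (hn : n / 2 ≤ N)
    (o : Outcome n m (fun a => c.isData a) c.headerBit (target c N m F) cfg tr)
    {k : ℕ} (hgood : Ghost.Good C (Ghost.total c (Ghost.stream c tr) (Ghost.run c tr).err) k)
    {tr₁ tr₂ : List Transmission} (h : tr = tr₁ ++ tr₂) :
    ((tr₁.filterMap sentA).length < k * c.period + c.head →
      decode c N ((tr₁.filterMap recvB).foldl (Receiver.step c) (.init c)) ≤ k * c.data) ∧
    (k * c.period + c.head ≤ (tr₁.filterMap sentA).length →
      (tr₁.filterMap sentA).length ≤ (k + 1) * c.period →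
      decode c N ((tr₁.filterMap recvB).foldl (Receiver.step c) (.init c)) =
        k * c.data + ((tr₁.filterMap sentA).length - k * c.period - c.head)) := by
  have inv := Ghost.run_inv hc o.trace o.hasHeaders (fun a b => o.stream_eq a b) tr₁ tr₂ h
  -- Errors only accumulate, so a block that is good at the end of the run was good at all earlier
  -- times.
  have hgood' : Ghost.Good C (Ghost.total c (Ghost.stream c tr) (Ghost.run c tr₁).err) k := by
    refine hgood.mono (Ghost.total_mono fun j => ?_)
    conv_rhs => rw [h]
    exact Ghost.run_err_le c tr₁ tr₂ j
  have hN : Ghost.headers c (Ghost.run c tr₁).clock ≤ N := by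
    refine (headers_le hc _).trans ?_
    rw [Ghost.run_clock]
    have : (tr₁.filterMap sentA).length ≤ (tr.filterMap sentA).length := by
      rw [h, List.filterMap_append, List.length_append]; omega
    have := o.limit
    omega
  rw [← Ghost.run_rcv, ← Ghost.run_clock c]
  exact ⟨fun h => inv.decode_le hc hC hW hN hgood' h,
    fun h h' => inv.decode_eq hc hC hC3 hW hN hgood' h h'⟩

end InsDel

namespace InsDel
open Transmission

/-! ### Corrupted rounds -/

open Classical in
/-- There are few bad blocks. -/
theorem Ghost.card_not_good_le (C : ℕ) (f : ℕ → ℕ) (M : ℕ) :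
    ((Finset.range M).filter fun k => ¬ Ghost.Good C f k).card ≤ C * ∑ j ∈ Finset.range M, f j := by
  -- The blocks are scanned with a debt d that bounds the excess of every window ending here over
  -- its length. A block raises d by C times its trouble and then lowers it by 1. If there is
  -- nothing to lower, the block is good; so each bad block pays one unit.
  suffices h : ∃ d, ((Finset.range M).filter fun k => ¬ Ghost.Good C f k).card + d ≤
      C * ∑ j ∈ Finset.range M, f j ∧ ∀ y ≤ M, C * ∑ j ∈ Finset.Ico y M, f j ≤ d + (M - y) by
    obtain ⟨d, h, -⟩ := h
    omega
  induction M with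
  | zero => exact ⟨0, by simp, by simp⟩
  | succ M ih =>
    obtain ⟨d, h1, h2⟩ := ih
    have h3 : ∀ y ≤ M, C * ∑ j ∈ Finset.Icc y M, f j ≤ d + (M - y) + C * f M := by
      intro y hy
      have h4 := h2 y hy
      rw [← Finset.Ico_add_one_right_eq_Icc, Finset.sum_Ico_succ_top hy, Nat.mul_add]
      omega
    refine ⟨d + C * f M - 1, ?_, ?_⟩
    · rw [Finset.range_add_one, Finset.filter_insert, Finset.sum_insert (by simp), Nat.mul_add]
      split_ifs with hg
      · omega
      · rw [Finset.card_insert_of_notMem (by simp)]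
        have : 0 < d + C * f M := by
          by_contra h0
          apply hg
          intro y hy
          have := h3 y hy
          omega
        omega
    · intro y hy
      rcases Nat.lt_or_ge M y with h | h
      · rw [Finset.Ico_eq_empty (by omega)]; simp
      · have := h3 y h
        rw [← Finset.Ico_add_one_right_eq_Icc] at this
        omega

variable {c : Scheme} {n m N F C : ℕ} {ε : ℝ} {cfg : Config} {tr : List Transmission}

/-- The exchange is undisturbed, and with i = k·data + f Bob's estimates are at most i before it and
exactly i + 1 upon Alice's bit. So he reveals precisely bit i now, and his user's answer goes back
in the same exchange, which is Alice's data round i. The bound `hlast` keeps this before the time F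
at which he reveals all that is left. -/
theorem Outcome.round_eq (hc : c.Valid) (hC : 88 ≤ C * (1 - ε)) (hC3 : 3 ≤ C)
    (hW : Separated c N ε) (hn : n / 2 ≤ N) (hF : F ≤ n / 2)
    (o : Outcome n m (fun a => c.isData a) c.headerBit (target c N m F) cfg tr)
    (hlen : (revealed (cfg.hist .B)).length = m)
    {k f : ℕ} (hgood : Ghost.Good C (Ghost.total c (Ghost.stream c tr) (Ghost.run c tr).err) k)
    (hf : f < c.data) (hi : k * c.data + f < m)
    (hlast : k * c.period + c.head + f + 1 + cfg.edits < F) :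
    (revealed (cfg.hist .B))[k * c.data + f]? = (given (cfg.hist .A))[k * c.data + f]? ∧
    (revealed (cfg.hist .A))[k * c.data + f]? = (given (cfg.hist .B))[k * c.data + f]? := by
  have hp := hc.head_lt
  set a := k * c.period + c.head + f with ha
  have hdata : c.data = c.period - c.head := rfl
  have hblock : Ghost.block c (a + 1) = k := by
    rw [Ghost.block, Nat.add_sub_cancel, ha, add_assoc, mul_comm, Nat.mul_add_div (by omega),
      Nat.div_eq_of_lt (by omega), Nat.add_zero]
  have hcount : Nat.count (fun a => c.isData a) a = k * c.data + f := by
    rw [ha, add_assoc, count_isData hc k _ (by omega), Nat.add_sub_cancel_left]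
  have hisData : c.isData a := by
    rw [Scheme.isData, ha, add_assoc, mul_comm, Nat.mul_add_mod, Nat.mod_eq_of_lt (by omega)]
    simp
  have hlens := o.sentA_length
  have ha1 : a + 1 < (tr.filterMap sentA).length := by omega
  obtain ⟨tr₁, b, y, tr₂, htr, htr₁⟩ := Ghost.exists_exchange (c := c) o.trace ha1 (by
    rw [hblock]
    have h1 := hgood.eq_zero hC3 le_rfl (by omega)
    unfold Ghost.total at h1
    omega)
  have htr' : tr = (tr₁ ++ [.forward b b]) ++ .reply y y :: tr₂ := by simp [htr]
  have hT1 : Trace .A tr₁ := by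
    obtain ⟨s', h1, -, h3⟩ := o.trace.append _ _ _ htr
    rwa [h3.2 rfl] at h1
  have l1 := hT1.lengths.1 rfl
  have lB := length_recvB_le tr₁
  have lE : (tr₁.filter isError).length ≤ cfg.edits := by
    refine le_trans ?_ o.errors
    rw [htr, List.filter_append, List.length_append]
    omega
  -- the bits of this exchange
  have eA : (tr.filterMap sentA)[a]? = some b := by
    rw [htr, List.filterMap_append, ← htr₁, List.getElem?_append_right le_rfl]
    simp [sentA]
  have eA' : (tr.filterMap recvA)[a]? = some y := by
    rw [htr, List.filterMap_append, ← htr₁, l1.1, List.getElem?_append_right le_rfl]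
    simp [recvA, List.filterMap_cons]
  set τ := (tr₁.filterMap recvB).length with hτ
  have eB : (tr.filterMap recvB)[τ]? = some b := by
    rw [htr, List.filterMap_append, List.getElem?_append_right le_rfl]
    simp [recvB]
  have eB' : (tr.filterMap sentB)[τ]? = some y := by
    rw [htr, List.filterMap_append, ← l1.2, List.getElem?_append_right le_rfl]
    simp [sentB, List.filterMap_cons]
  have hτlt : τ < (tr.filterMap recvB).length := (List.getElem?_eq_some_iff.1 eB).1
  -- Bob's estimates
  have hbefore : revealedUpTo (target c N m F) m (tr.filterMap recvB) τ ≤ k * c.data + f := by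
    refine Finset.sup_le fun t ht => (min_le_right _ _).trans ?_
    rw [Finset.mem_Icc] at ht
    have htake : (tr.filterMap recvB).take t = (tr₁.filterMap recvB).take t := by
      rw [htr, List.filterMap_append, List.take_append_of_le_length ht.2]
    obtain ⟨tr₀, tr₀', h0, h0'⟩ := Ghost.exists_prefix_recvB tr₁ ht.2
    rw [htake, target, if_neg (by rw [List.length_take]; omega), ← h0']
    have hle : (tr₀.filterMap sentA).length ≤ a := by
      rw [← htr₁, h0, List.filterMap_append, List.length_append]; omega
    obtain ⟨h1, h2⟩ := o.decode_eq hc hC hC3 hW hn hgood (tr₁ := tr₀)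
      (tr₂ := tr₀' ++ Transmission.forward b b :: .reply y y :: tr₂) (by rw [htr, h0]; simp)
    rcases Nat.lt_or_ge (tr₀.filterMap sentA).length (k * c.period + c.head) with h | h
    · have := h1 h; omega
    · rw [h2 h (by rw [Nat.succ_mul]; omega)]
      omega
  have hat : target c N m F ((tr.filterMap recvB).take (τ + 1)) = k * c.data + f + 1 := by
    have htake : (tr.filterMap recvB).take (τ + 1) = (tr₁ ++ [Transmission.forward b b]).filterMap recvB := by
      rw [htr', List.filterMap_append, List.take_append_of_le_length (by simp [recvB, ← hτ]),
        List.take_of_length_le (by simp [recvB, ← hτ])]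
    have hl : ((tr₁ ++ [Transmission.forward b b]).filterMap recvB).length = τ + 1 := by simp [recvB, ← hτ]
    have hs : ((tr₁ ++ [Transmission.forward b b]).filterMap sentA).length = a + 1 := by
      simp [sentA, htr₁]
    obtain ⟨-, h2⟩ := o.decode_eq hc hC hC3 hW hn hgood htr'
    rw [htake, target, hl, if_neg (by omega), h2 (by omega) (by rw [Nat.succ_mul]; omega), hs]
    omega
  have hafter : revealedUpTo (target c N m F) m (tr.filterMap recvB) (τ + 1) =
      k * c.data + f + 1 := by
    rw [revealedUpTo_succ, hat]
    omega
  constructor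
  · rw [o.revealedB_eq τ hτlt _ (by omega) hbefore (by omega), eB, ← eA,
      o.sentA_data a (by omega) hisData (by omega), hcount]
  · rw [← o.sentB_eq τ (List.getElem?_eq_some_iff.1 eB').1 _ hafter, eB', ← hcount,
      o.revealedA_eq a (List.getElem?_eq_some_iff.1 eA').1 hisData (by omega), eA']

/-- Bob receives at least F bits, whereupon he reveals everything missing; Alice's clock gets past
her first m data rounds, whose end is computed in `h1`. -/
theorem Outcome.lengths (hc : c.Valid)
    (o : Outcome n m (fun a => c.isData a) c.headerBit (target c N m F) cfg tr)
    (hE : F + cfg.edits ≤ n / 2) (hm : m + (m / c.data + 1) * c.head < F) :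
    ∀ p, (revealed (cfg.hist p)).length = m := by
  have hp := hc.head_lt
  have hdata : c.data = c.period - c.head := rfl
  have hl := o.sentA_length
  intro p
  cases p with
  | A =>
    rw [o.revealedA_length, min_eq_left]
    have h1 : Nat.count (fun a => c.isData a) (m / c.data * c.period + (c.head + m % c.data)) =
        m := by
      have := Nat.mod_lt m (show 0 < c.data by omega)
      rw [count_isData hc _ _ (by omega), Nat.add_sub_cancel_left, Nat.div_add_mod']
    conv_lhs => rw [← h1]
    apply Nat.count_monotone
    have h2 := Nat.div_add_mod' m c.data
    have h3 : m / c.data * c.period = m / c.data * c.data + m / c.data * c.head := by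
      rw [← Nat.mul_add]; congr 1; omega
    rw [Nat.succ_mul] at hm
    omega
  | B =>
    rw [o.revealedB_length]
    refine le_antisymm (revealedUpTo_le _ _ _ _) ?_
    have h1 := Finset.le_sup (f := fun t => min m (target c N m F ((tr.filterMap recvB).take t)))
      (show (tr.filterMap recvB).length ∈ Finset.Icc 1 (tr.filterMap recvB).length by
        rw [Finset.mem_Icc]; omega)
    simp only [List.take_length] at h1
    rw [target, if_pos (by omega), min_self] at h1
    exact h1

/-- A pattern in Alice's data shows up in the rounds of the simulated channel. -/
theorem Outcome.pattern (hc : c.Valid)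
    (o : Outcome n m (fun a => c.isData a) c.headerBit (target c N m F) cfg tr)
    (hm : m + (m / c.data + 1) * c.head < (tr.filterMap sentA).length)
    {j : ℕ} (hj : j < m / c.data) (hpat : c.PatternIn (Ghost.stream c tr) j) :
    ∃ i, 2 * i ∈ patternRounds c.s (given (cfg.hist .A)) ∧ i / c.data = j := by
  have hp := hc.head_lt
  have hs := hc.len_lt
  have hdata : c.data = c.period - c.head := rfl
  obtain ⟨P, ⟨hP1, hP2⟩, h1, h2, h3⟩ := hpat
  have hPd := Nat.div_add_mod' P c.period
  rw [h3] at hPd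
  obtain ⟨f, hf⟩ := Nat.exists_eq_add_of_le h1
  have hle : (j + 1) * c.data ≤ m := (Nat.mul_le_mul_right _ hj).trans (Nat.div_mul_le_self _ _)
  rw [Nat.succ_mul] at hle
  have hbits : ∀ t < c.s, (given (cfg.hist .A))[j * c.data + f + t]? =
      some (Ghost.stream c tr (P + t)) := by
    intro t ht
    have e1 : (P + t) % c.period = c.head + f + t := by
      rw [Scheme.mod_add_of_lt (by omega), hf]
    have e2 : Nat.count (fun a => c.isData a) (P + t) = j * c.data + f + t := by
      rw [show P + t = j * c.period + (c.head + f + t) by omega,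
        count_isData hc _ _ (by omega)]
      omega
    have e3 : P + t < (tr.filterMap sentA).length := by
      have h4 : j * c.period = j * c.data + j * c.head := by
        rw [← Nat.mul_add]; congr 1; omega
      have h5 : (j + 1) * c.head ≤ (m / c.data + 1) * c.head :=
        Nat.mul_le_mul_right _ (by omega)
      rw [Nat.succ_mul] at h5
      omega
    rw [← e2, ← o.sentA_data _ e3 (by rw [Scheme.isData, e1]; simp; omega) (by omega),
      Ghost.stream, List.getElem?_eq_getElem e3]
    rfl
  refine ⟨j * c.data + f, ⟨j * c.data + f, 0, ?_, by omega, rfl⟩, ?_⟩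
  · rw [List.prefix_iff_eq_take]
    apply List.ext_getElem?
    intro t
    have hl : (true :: List.replicate (c.s - 1) false).length = c.s := by simp; omega
    rcases Nat.lt_or_ge t c.s with ht | ht
    · rw [hl, List.getElem?_take_of_lt ht, List.getElem?_drop, hbits t ht]
      rcases t with _ | t
      · simpa using hP1.symm
      · rw [List.getElem?_cons_succ, List.getElem?_replicate, if_pos (by omega),
          hP2 _ (by omega) ht]
    · rw [List.getElem?_eq_none (by omega), List.getElem?_eq_none (by simp; omega)]
  · rw [mul_comm, Nat.mul_add_div (by omega), Nat.div_eq_of_lt (by omega), Nat.add_zero]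

open Classical in
-- Each edit contributes at most one. An interval of `period` rounds holds about `period / 2 ≤ data`
-- bits of Alice's stream, so it meets at most two blocks of data; hence the factor 2.
theorem Outcome.sum_total_le (hc : c.Valid)
    (o : Outcome n m (fun a => c.isData a) c.headerBit (target c N m F) cfg tr)
    (hm : m + (m / c.data + 1) * c.head < (tr.filterMap sentA).length)
    (hd : c.period / 2 ≤ c.data) (starts : Finset ℕ)
    (hcover : ∀ x ∈ patternRounds c.s (given (cfg.hist .A)),
      ∃ a ∈ starts, a ≤ x ∧ x < a + c.period) :
    ∑ j ∈ Finset.range (m / c.data), Ghost.total c (Ghost.stream c tr) (Ghost.run c tr).err j ≤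
      cfg.edits + 2 * starts.card := by
  have hp := hc.head_lt
  have hdata : c.data = c.period - c.head := rfl
  simp only [Ghost.total]
  rw [Finset.sum_add_distrib, ← Finset.card_filter]
  refine Nat.add_le_add ((Ghost.sum_run_err_le c tr _).trans o.errors) ?_
  have hsub : (Finset.range (m / c.data)).filter (fun j => c.PatternIn (Ghost.stream c tr) j) ⊆
      starts.biUnion fun a => {a / 2 / c.data, a / 2 / c.data + 1} := by
    intro j hj
    rw [Finset.mem_filter, Finset.mem_range] at hj
    obtain ⟨i, hi, rfl⟩ := o.pattern hc hm hj.1 hj.2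
    obtain ⟨a, ha, h1, h2⟩ := hcover _ hi
    rw [Finset.mem_biUnion]
    refine ⟨a, ha, ?_⟩
    rw [Finset.mem_insert, Finset.mem_singleton]
    have h3 : a / 2 / c.data ≤ i / c.data := Nat.div_le_div_right (by omega)
    have h4 : i / c.data ≤ (a / 2 + c.data) / c.data := Nat.div_le_div_right (by omega)
    rw [Nat.add_div_right _ (by omega)] at h4
    omega
  refine (Finset.card_le_card hsub).trans ?_
  refine Finset.card_biUnion_le.trans ?_
  rw [mul_comm, ← smul_eq_mul, ← Finset.sum_const]
  exact Finset.sum_le_sum fun a _ => Finset.card_le_two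

end InsDel

/-! ### Correctness of the simulation: the general scheme and the error-free case. -/

namespace InsDel
open Transmission

variable {c : Scheme} {n m N F C : ℕ} {ε : ℝ} {cfg : Config} {tr : List Transmission}

open Classical in
/-- The blocks of data that may get corrupted: the bad ones and the last, incomplete one. -/
theorem Outcome.exists_blocks (hc : c.Valid) (hC : 88 ≤ C * (1 - ε)) (hC3 : 3 ≤ C)
    (hW : Separated c N ε) (hn : n / 2 ≤ N)
    (o : Outcome n m (fun a => c.isData a) c.headerBit (target c N m F) cfg tr)
    (hE : F + cfg.edits ≤ n / 2)
    (hm : m + (m / c.data + 1) * c.head + cfg.edits < F)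
    (hd : c.period / 2 ≤ c.data) (starts : Finset ℕ)
    (hcover : ∀ x ∈ patternRounds c.s (given (cfg.hist .A)),
      ∃ a ∈ starts, a ≤ x ∧ x < a + c.period) :
    ∃ B : Finset ℕ, B.card ≤ C * (cfg.edits + 2 * starts.card) + 1 ∧
      ∀ x ∈ corrupted m cfg, x / 2 / c.data ∈ B := by
  have hp := hc.head_lt
  have hdata : c.data = c.period - c.head := rfl
  have hlen := o.lengths hc hE (by omega)
  have hl := o.sentA_length
  set f := Ghost.total c (Ghost.stream c tr) (Ghost.run c tr).err
  refine ⟨insert (m / c.data) ((Finset.range (m / c.data)).filter fun k => ¬ Ghost.Good C f k),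
    ?_, ?_⟩
  · refine (Finset.card_insert_le _ _).trans (Nat.add_le_add_right ?_ 1)
    refine (Ghost.card_not_good_le C f _).trans (Nat.mul_le_mul_left _ ?_)
    exact o.sum_total_le hc (by omega) hd starts hcover
  · intro x hx
    rw [corrupted, Finset.mem_filter, Finset.mem_range] at hx
    obtain ⟨hx, hne⟩ := hx
    have hi : x / 2 < m := by omega
    have h1 : x / 2 / c.data ≤ m / c.data := Nat.div_le_div_right hi.le
    rw [Finset.mem_insert, Finset.mem_filter, Finset.mem_range]
    rcases h1.eq_or_lt with h | h
    · exact Or.inl h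
    · refine Or.inr ⟨h, fun hgood => hne ?_⟩
      have h2 := Nat.div_add_mod' (x / 2) c.data
      have h3 := Nat.mod_lt (x / 2) (show 0 < c.data by omega)
      have h4 : x / 2 / c.data * c.period =
          x / 2 / c.data * c.data + x / 2 / c.data * c.head := by
        rw [← Nat.mul_add]; congr 1; omega
      have h5 : (x / 2 / c.data + 1) * c.head ≤ (m / c.data + 1) * c.head :=
        Nat.mul_le_mul_right _ (by omega)
      rw [Nat.succ_mul] at h5
      have h6 := o.round_eq hc hC hC3 hW hn (by omega) (hlen .B) hgood h3 (by omega) (by omega)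
      rw [h2] at h6
      unfold roundOut roundIn
      split_ifs
      · exact h6.1
      · exact h6.2

/-- The simulation works if the parameters fit. -/
theorem simulates_of_scheme (hc : c.Valid) (hC : 88 ≤ C * (1 - ε)) (hC3 : 3 ≤ C)
    (hW : Separated c N ε) (hn : n / 2 ≤ N) {δ θ r : ℝ} {e : ℕ}
    (he : n * δ ≤ e) (hF : F + e ≤ n / 2)
    (hm : m + (m / c.data + 1) * c.head + e < F)
    (hd : c.period / 2 ≤ c.data) (hr : c.period = ⌈r⌉₊) (hr0 : 0 < r) (hdr : (c.data : ℝ) ≤ r)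
    (hθ : 2 * (C * (3 * (n * δ)) + 1) ≤ ((2 * m : ℕ) : ℝ) * θ / r) :
    Simulates n m δ (strategies (fun a => c.isData a) c.headerBit (target c N m F) m)
      (fun X => CoveredBy (patternRounds c.s X) (n * δ) ⌈r⌉₊)
      (BlockCorruption (2 * m) θ r) := by
  classical
  intro user cfg hreach hedits
  refine ⟨revealed_length_le hreach, fun hhalt => ?_⟩
  obtain ⟨tr, o⟩ := exists_outcome hreach hhalt
  have hle : cfg.edits ≤ e := by exact_mod_cast hedits.trans he
  refine ⟨o.lengths hc (by omega) (by omega), ?_⟩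
  rintro ⟨starts, hcard, hcover⟩
  obtain ⟨B, hB, hmem⟩ := o.exists_blocks hc hC hC3 hW hn (by omega) (by omega) hd starts
    (by rw [hr]; exact hcover)
  have hB' : (B.card : ℝ) ≤ C * (3 * (n * δ)) + 1 := by
    have h1 : (B.card : ℝ) ≤ C * (cfg.edits + 2 * starts.card) + 1 := by exact_mod_cast hB
    have h2 : (cfg.edits : ℝ) + 2 * starts.card ≤ 3 * (n * δ) := by linarith
    have h3 : (C : ℝ) * (cfg.edits + 2 * starts.card) ≤ C * (3 * (n * δ)) :=
      mul_le_mul_of_nonneg_left h2 (Nat.cast_nonneg _)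
    linarith
  have hp := hc.head_lt
  have hdata : c.data = c.period - c.head := rfl
  have hpos : 0 < c.data := by omega
  have hmain : 2 * (B.card : ℝ) ≤ ((2 * m : ℕ) : ℝ) * θ / r := by linarith
  have hdm : ∀ x, x / 2 / c.data * c.data ≤ x / 2 ∧
      x / 2 < x / 2 / c.data * c.data + c.data := by
    intro x
    have h2 := Nat.div_add_mod' (x / 2) c.data
    have h3 := Nat.mod_lt (x / 2) hpos
    omega
  -- The data of one block fill 2·data ≤ 2r consecutive rounds, for which two intervals of length
  -- ⌈r⌉ suffice.
  refine ⟨?_, (B.biUnion fun k => {2 * (k * c.data), 2 * (k * c.data) + ⌈r⌉₊}), ?_, ?_⟩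
  · have hsub : corrupted m cfg ⊆ B.biUnion fun k =>
        Finset.Ico (2 * (k * c.data)) (2 * (k * c.data) + 2 * c.data) := by
      intro x hx
      rw [Finset.mem_biUnion]
      refine ⟨_, hmem x hx, ?_⟩
      rw [Finset.mem_Ico]
      have := hdm x
      omega
    have h1 : (corrupted m cfg).card ≤ B.card * (2 * c.data) := by
      refine (Finset.card_le_card hsub).trans (Finset.card_biUnion_le_card_mul _ _ _ ?_)
      intro k _
      rw [Nat.card_Ico]; omega
    have h2 : ((corrupted m cfg).card : ℝ) ≤ B.card * (2 * c.data) := by exact_mod_cast h1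
    rw [le_div_iff₀ hr0] at hmain
    have h3 : (B.card : ℝ) * (2 * c.data) ≤ 2 * B.card * r := by
      have := mul_le_mul_of_nonneg_left hdr (show (0 : ℝ) ≤ 2 * B.card by positivity)
      linarith
    calc ((corrupted m cfg).card : ℝ) ≤ 2 * B.card * r := h2.trans h3
      _ ≤ ((2 * m : ℕ) : ℝ) * θ := hmain
      _ = _ := by push_cast; ring
  · refine le_trans ?_ (hmain.trans_eq (by push_cast; ring))
    have h1 : (B.biUnion fun k => ({2 * (k * c.data), 2 * (k * c.data) + ⌈r⌉₊} : Finset ℕ)).card ≤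
        B.card * 2 := Finset.card_biUnion_le_card_mul _ _ _ fun _ _ => Finset.card_le_two
    rw [mul_comm]
    exact_mod_cast h1
  · intro x hx
    have := hdm x
    have hk := hmem x hx
    by_cases h : x < 2 * (x / 2 / c.data * c.data) + ⌈r⌉₊
    · refine ⟨2 * (x / 2 / c.data * c.data), ?_, by omega, h⟩
      rw [Finset.mem_biUnion]
      exact ⟨_, hk, by simp⟩
    · refine ⟨2 * (x / 2 / c.data * c.data) + ⌈r⌉₊, ?_, by omega, by omega⟩
      rw [Finset.mem_biUnion]
      exact ⟨_, hk, by simp⟩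

theorem filterMap_eq_of_no_error {tr : List Transmission} (h : (tr.filter isError).length = 0) :
    tr.filterMap recvB = tr.filterMap sentA ∧ tr.filterMap recvA = tr.filterMap sentB := by
  rw [List.length_eq_zero_iff, List.filter_eq_nil_iff] at h
  constructor <;> refine List.filterMap_congr fun e he => ?_ <;> have := h e he <;>
    cases e <;> simp_all [isError, sentA, sentB, recvA, recvB]

theorem revealedUpTo_length (m : ℕ) (bits : List Bool) {τ : ℕ} (h : τ ≤ bits.length) :
    revealedUpTo List.length m bits τ = min m τ := by
  induction τ with
  | zero => simp [revealedUpTo]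
  | succ τ ih => rw [revealedUpTo_succ, ih (by omega), List.length_take]; omega

/-- Without errors it suffices to forward the bits. -/
theorem simulates_of_no_edits {n m : ℕ} {δ : ℝ} (hδ : n * δ < 1) (hm : m ≤ n / 2)
    {admissible : List Bool → Prop} {allowed : Finset ℕ → Prop} (hallowed : allowed ∅) :
    Simulates n m δ (strategies (fun _ => true) (fun _ => false) List.length m)
      admissible allowed := by
  intro user cfg hreach hedits
  refine ⟨revealed_length_le hreach, fun hhalt => ?_⟩
  obtain ⟨tr, o⟩ := exists_outcome hreach hhalt
  have h0 : cfg.edits = 0 := by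
    have : (cfg.edits : ℝ) < 1 := hedits.trans_lt hδ
    exact_mod_cast Nat.lt_one_iff.1 (by exact_mod_cast this)
  have hE : (tr.filter isError).length = 0 := by
    have := o.errors
    omega
  obtain ⟨hB, hA⟩ := filterMap_eq_of_no_error hE
  have hlens := o.trace.lengths
  have hsent : (tr.filterMap sentA).length = n / 2 ∧ (tr.filterMap sentB).length = n / 2 := by
    have h1 := o.limit
    rw [hA, hB] at hlens
    rcases o.finished with ⟨hs, h⟩ | ⟨hs, h⟩ <;> simp [hs] at hlens <;> omega
  have hcount : ∀ a, Nat.count (fun _ => (true : Bool) = true) a = a := fun a => by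
    simp [Nat.count_eq_card_filter_range]
  have hrev : ∀ p, (revealed (cfg.hist p)).length = m := by
    intro p
    cases p with
    | A => rw [o.revealedA_length, hcount, hA]; omega
    | B => rw [o.revealedB_length, revealedUpTo_length _ _ le_rfl, hB]; omega
  refine ⟨hrev, fun _ => ?_⟩
  convert hallowed
  rw [corrupted, Finset.filter_eq_empty_iff]
  intro k hk
  rw [Finset.mem_range] at hk
  rw [not_not, roundOut, roundIn]
  have hi : k / 2 < m := by omega
  have hup : revealedUpTo List.length m (tr.filterMap recvB) (k / 2 + 1) = k / 2 + 1 := by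
    rw [revealedUpTo_length _ _ (by rw [hB]; omega)]; omega
  split_ifs
  · rw [o.revealedB_eq (k / 2) (by rw [hB]; omega) _ (by rw [hrev]; exact hi)
      (by rw [revealedUpTo_length _ _ (by rw [hB]; omega)]; omega) (by omega), hB,
      o.sentA_data (k / 2) (by omega) rfl (by rw [hcount]; exact hi), hcount]
  · have h1 := o.revealedA_eq (k / 2) (by rw [hA]; omega) rfl (by rw [hcount]; exact hi)
    rw [hcount] at h1
    rw [h1, hA, o.sentB_eq (k / 2) (by omega) _ hup]

end InsDel

namespace InsDel

/-! ### Functions computable in polynomial time -/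

def Data.size : Data → ℕ
  | .nil => 0
  | .cons a b => a.size + b.size + 1

theorem eval_mono (T : Polynomial ℕ) : Monotone fun x => T.eval x := by
  intro x y h
  simp only [Polynomial.eval_eq_sum]
  exact Finset.sum_le_sum fun i _ => Nat.mul_le_mul_left _ (Nat.pow_le_pow_left h i)

/-- Representation by binary trees. -/
class Code (α : Type) where
  code : α → Data

open Code (code)

instance : Code ℕ := ⟨encodeNat⟩
instance : Code Bool := ⟨encodeBool⟩
instance : Code Action := ⟨encodeAction⟩
instance : Code Event := ⟨encodeEvent⟩
instance {α β : Type} [Code α] [Code β] : Code (α × β) := ⟨fun p => .cons (code p.1) (code p.2)⟩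
instance {α : Type} [Code α] : Code (List α) := ⟨fun l => encodeList (l.map code)⟩

/-- The size of the representation. -/
def codeSize {α : Type} [Code α] (a : α) : ℕ := (code a).size

section
variable {α β γ σ : Type} [Code α] [Code β] [Code γ] [Code σ]

@[simp] theorem codeSize_pair (a : α) (b : β) : codeSize (a, b) = codeSize a + codeSize b + 1 := rfl
@[simp] theorem codeSize_nil : codeSize ([] : List α) = 0 := rfl
@[simp] theorem codeSize_cons (a : α) (l : List α) :
    codeSize (a :: l) = codeSize a + codeSize l + 1 := rfl
@[simp] theorem codeSize_nat (n : ℕ) : codeSize n = n := by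
  induction n with
  | zero => rfl
  | succ n ih =>
    change Data.size Data.nil + codeSize n + 1 = n + 1
    rw [ih]; simp [Data.size]

theorem codeSize_bool (b : Bool) : codeSize b ≤ 1 := by cases b <;> decide

theorem codeSize_event (e : Event) : codeSize e ≤ 6 := by
  rcases e with b | b | (b | b) <;> cases b <;> decide

@[simp] theorem codeSize_append (l l' : List α) : codeSize (l ++ l') = codeSize l + codeSize l' := by
  induction l with
  | nil => simp
  | cons a l ih => simp [ih]; omega

@[simp] theorem codeSize_reverse (l : List α) : codeSize l.reverse = codeSize l := by
  induction l with
  | nil => rfl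
  | cons a l ih => simp [ih]; omega

theorem length_le_codeSize (l : List α) : l.length ≤ codeSize l := by
  induction l with
  | nil => simp
  | cons a l ih => simp; omega

theorem codeSize_le_of_mem {l : List α} {a : α} (h : a ∈ l) : codeSize a + 1 ≤ codeSize l := by
  induction l with
  | nil => simp at h
  | cons b l ih =>
    rcases List.mem_cons.1 h with rfl | h
    · simp
    · have := ih h; simp; omega

theorem codeSize_le_of_forall {l : List α} {B : ℕ} (h : ∀ a ∈ l, codeSize a ≤ B) :
    codeSize l ≤ l.length * (B + 1) := by
  induction l with
  | nil => simp
  | cons a l ih =>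
    have h1 := h a (by simp)
    have h2 := ih fun x hx => h x (by simp [hx])
    rw [codeSize_cons, List.length_cons, Nat.succ_mul]
    omega

/-- `f` is computable in polynomial time, and its values have polynomial size. -/
def PolyTime (f : α → β) : Prop :=
  ∃ (P : Prog) (T : Polynomial ℕ), ∀ a, codeSize (f a) ≤ T.eval (codeSize a) ∧
    ∃ t ≤ T.eval (codeSize a), Eval P (code a) (code (f a)) t

namespace PolyTime

theorem of_eq {f g : α → β} (hf : PolyTime f) (h : ∀ a, f a = g a) : PolyTime g := by
  rwa [← funext h]

theorem id : PolyTime (fun a : α => a) :=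
  ⟨.id, Polynomial.X + 1, fun a => ⟨by simp, 1, by simp, .id _⟩⟩

theorem const (b : β) : PolyTime (fun _ : α => b) :=
  ⟨.const (code b), Polynomial.C (codeSize b + 1), fun a => ⟨by simp, 1, by simp, .const _ _⟩⟩

theorem fst : PolyTime (fun p : α × β => p.1) :=
  ⟨.hd, Polynomial.X + 1, fun p => ⟨by rcases p with ⟨a, b⟩; simp; omega, 1, by simp, .hd _⟩⟩

theorem snd : PolyTime (fun p : α × β => p.2) :=
  ⟨.tl, Polynomial.X + 1, fun p => ⟨by rcases p with ⟨a, b⟩; simp; omega, 1, by simp, .tl _⟩⟩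

theorem comp {g : β → γ} {f : α → β} (hg : PolyTime g) (hf : PolyTime f) :
    PolyTime (fun a => g (f a)) := by
  obtain ⟨P, T, h⟩ := hg
  obtain ⟨P', T', h'⟩ := hf
  refine ⟨.comp P P', T.comp T' + T' + 1, fun a => ?_⟩
  obtain ⟨h1, t', ht', h2⟩ := h' a
  obtain ⟨h3, t, ht, h4⟩ := h (f a)
  have := eval_mono T h1
  simp only [Polynomial.eval_add, Polynomial.eval_comp, Polynomial.eval_one] at this ⊢
  exact ⟨by omega, _, by omega, .comp h2 h4⟩

theorem pair {f : α → β} {g : α → γ} (hf : PolyTime f) (hg : PolyTime g) :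
    PolyTime (fun a => (f a, g a)) := by
  obtain ⟨P, T, h⟩ := hf
  obtain ⟨P', T', h'⟩ := hg
  refine ⟨.cons P P', T + T' + 1, fun a => ?_⟩
  obtain ⟨h1, t, ht, h2⟩ := h a
  obtain ⟨h3, t', ht', h4⟩ := h' a
  simp only [Polynomial.eval_add, Polynomial.eval_one, codeSize_pair]
  exact ⟨by omega, _, by omega, .cons h2 h4⟩

theorem fst' {f : α → β × γ} (hf : PolyTime f) : PolyTime (fun a => (f a).1) := fst.comp hf
theorem snd' {f : α → β × γ} (hf : PolyTime f) : PolyTime (fun a => (f a).2) := snd.comp hf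

theorem cons {f : α → β} {g : α → List β} (hf : PolyTime f) (hg : PolyTime g) :
    PolyTime (fun a => f a :: g a) := by
  obtain ⟨P, T, h⟩ := hf.pair hg
  exact ⟨P, T, h⟩

theorem code_true_ne : code true ≠ Data.nil := by
  intro h; cases h

/-- Case distinction, where `f` and `g` need to be computable only in their own case. -/
theorem ite_of {b : α → Bool} {f : α → β} (hb : PolyTime b)
    (hf : ∃ (P : Prog) (T : Polynomial ℕ), ∀ a, b a = true → codeSize (f a) ≤ T.eval (codeSize a) ∧
      ∃ t ≤ T.eval (codeSize a), Eval P (code a) (code (f a)) t)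
    (hg : ∃ (P : Prog) (T : Polynomial ℕ), ∀ a, b a = false → codeSize (f a) ≤ T.eval (codeSize a) ∧
      ∃ t ≤ T.eval (codeSize a), Eval P (code a) (code (f a)) t) :
    PolyTime f := by
  obtain ⟨P₀, T₀, h₀⟩ := hb
  obtain ⟨P, T, h⟩ := hf
  obtain ⟨P', T', h'⟩ := hg
  refine ⟨.ite P₀ P P', T₀ + T + T' + 1, fun a => ?_⟩
  obtain ⟨-, t₀, ht₀, h₀⟩ := h₀ a
  simp only [Polynomial.eval_add, Polynomial.eval_one]
  cases hba : b a with
  | true =>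
    obtain ⟨h1, t, ht, h2⟩ := h a hba
    rw [hba] at h₀
    exact ⟨by omega, _, by omega, .iteTrue h₀ code_true_ne h2⟩
  | false =>
    obtain ⟨h1, t, ht, h2⟩ := h' a hba
    rw [hba] at h₀
    exact ⟨by omega, _, by omega, .iteFalse h₀ h2⟩

theorem cond {b : α → Bool} {f g : α → β} (hb : PolyTime b) (hf : PolyTime f) (hg : PolyTime g) :
    PolyTime (fun a => if b a then f a else g a) := by
  obtain ⟨P, T, h⟩ := hf
  obtain ⟨P', T', h'⟩ := hg
  refine ite_of hb ⟨P, T, fun a ha => ?_⟩ ⟨P', T', fun a ha => ?_⟩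
  · simpa [ha] using h a
  · simpa [ha] using h' a

theorem ite {p : α → Prop} [DecidablePred p] {f g : α → β} (hb : PolyTime fun a => decide (p a))
    (hf : PolyTime f) (hg : PolyTime g) : PolyTime (fun a => if p a then f a else g a) :=
  (cond hb hf hg).of_eq fun a => by simp

theorem not {b : α → Bool} (hb : PolyTime b) : PolyTime (fun a => !b a) :=
  (cond hb (const false) (const true)).of_eq fun a => by cases b a <;> rfl

theorem and {b b' : α → Bool} (hb : PolyTime b) (hb' : PolyTime b') :
    PolyTime (fun a => b a && b' a) :=
  (cond hb hb' (const false)).of_eq fun a => by cases b a <;> rfl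

theorem isEmpty {l : α → List β} (hl : PolyTime l) : PolyTime (fun a => (l a).isEmpty) := by
  refine PolyTime.comp (g := fun l : List β => l.isEmpty) ?_ hl
  refine ⟨.ite .id (.const (code false)) (.const (code true)), 3, fun l => ?_⟩
  rcases l with _ | ⟨a, l⟩
  · exact ⟨by simp; decide, 3, by simp, .iteFalse (.id _) (.const _ _)⟩
  · exact ⟨by simp; decide, 3, by simp, .iteTrue (.id _) (by intro h; cases h) (.const _ _)⟩

theorem tail {l : α → List β} (hl : PolyTime l) : PolyTime (fun a => (l a).tail) := by
  refine PolyTime.comp (g := fun l : List β => l.tail) ?_ hl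
  refine ⟨.tl, Polynomial.X + 1, fun l => ⟨?_, 1, by simp, ?_⟩⟩
  · cases l <;> simp; omega
  · rcases l with _ | ⟨a, l⟩
    · exact .tl _
    · exact .tl _

theorem headD {l : α → List β} {d : β} (hl : PolyTime l) : PolyTime (fun a => (l a).headD d) := by
  refine PolyTime.comp (g := fun l : List β => l.headD d) ?_ hl
  refine ite_of (b := fun l : List β => !l.isEmpty) (isEmpty id).not
    ⟨.hd, Polynomial.X + 1, fun l hl => ⟨?_, 1, by simp, ?_⟩⟩
    ⟨.const (code d), Polynomial.C (codeSize d + 1), fun l hl => ⟨?_, 1, by simp, ?_⟩⟩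
  · rcases l with _ | ⟨a, l⟩
    · simp at hl
    · simp; omega
  · rcases l with _ | ⟨a, l⟩
    · simp at hl
    · exact .hd _
  · rcases l with _ | ⟨a, l⟩
    · simp
    · simp at hl
  · rcases l with _ | ⟨a, l⟩
    · exact .const _ _
    · simp at hl

/-! #### Loops -/

/-- Programs for the loop that computes `List.foldl`. -/
def foldLoop (P : Prog) : Prog :=
  .loop (.comp .hd .tl) (.cons .hd (.cons (.comp .tl (.comp .hd .tl))
    (.comp P (.cons .hd (.cons (.comp .tl .tl) (.comp .hd (.comp .hd .tl)))))))

/-- The loop works on the triple of parameter, remaining list and state. K bounds the time of a step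
on the states that actually occur, and 30 the bookkeeping of an iteration. -/
theorem foldLoop_eval {st : α → σ → β → σ} {P : Prog} {K : ℕ} (a : α) (l : List β) :
    ∀ s : σ, (∀ l₁ b l₂, l = l₁ ++ b :: l₂ → ∃ t ≤ K,
      Eval P (code (a, l₁.foldl (st a) s, b)) (code (st a (l₁.foldl (st a) s) b)) t) →
    ∃ t ≤ l.length * (K + 30) + 30,
      Eval (foldLoop P) (code (a, l, s)) (code (a, ([] : List β), l.foldl (st a) s)) t := by
  induction l with
  | nil =>
    intro s _
    exact ⟨_, by omega, .loopDone (.comp (.tl _) (.hd _))⟩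
  | cons b l ih =>
    intro s h
    obtain ⟨t, ht, he⟩ := h [] b l rfl
    obtain ⟨t', ht', he'⟩ := ih (st a s b) fun l₁ b' l₂ hl => by
      simpa using h (b :: l₁) b' l₂ (by simp [hl])
    refine ⟨_, ?_, .loopNext (.comp (.tl _) (.hd _)) (by intro h; cases h)
      (.cons (.hd _) (.cons (.comp (.comp (.tl _) (.hd _)) (.tl _))
        (.comp (.cons (.hd _) (.cons (.comp (.tl _) (.tl _))
          (.comp (.comp (.tl _) (.hd _)) (.hd _)))) he))) he'⟩
    rw [List.length_cons, Nat.succ_mul]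
    omega

theorem exists_size_le {f : α → β} (hf : PolyTime f) :
    ∃ T : Polynomial ℕ, ∀ a, codeSize (f a) ≤ T.eval (codeSize a) := by
  obtain ⟨_, T, h⟩ := hf
  exact ⟨T, fun a => (h a).1⟩

/-- Iterating a polynomial-time step may blow up the state. A polynomial bound `B` on all
intermediate states excludes this and bounds the time of every step. -/
theorem foldl_of_prefix {l : α → List β} {i : α → σ} {st : α → σ → β → σ} (hl : PolyTime l)
    (hi : PolyTime i) (hst : PolyTime fun p : α × σ × β => st p.1 p.2.1 p.2.2)
    (B : Polynomial ℕ)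
    (hB : ∀ a l', l' <+: l a → codeSize (l'.foldl (st a) (i a)) ≤ B.eval (codeSize a)) :
    PolyTime fun a => (l a).foldl (st a) (i a) := by
  obtain ⟨P, T, h⟩ := hst
  obtain ⟨Tl, hTl⟩ := hl.exists_size_le
  obtain ⟨P', T', h'⟩ := id.pair (hl.pair hi)
  refine ⟨.comp (.comp .tl .tl) (.comp (foldLoop P) P'),
    B + T' + (Tl * (T.comp (Polynomial.X + B + Tl + 2) + 30) + 30) + 10, fun a => ?_⟩
  obtain ⟨-, t', ht', h'⟩ := h' a
  obtain ⟨t, ht, he⟩ := foldLoop_eval (st := st) (P := P)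
    (K := T.eval (codeSize a + B.eval (codeSize a) + Tl.eval (codeSize a) + 2)) a (l a) (i a)
    (by
      intro l₁ b l₂ hl₁
      obtain ⟨-, t, ht, he⟩ := h (a, l₁.foldl (st a) (i a), b)
      refine ⟨t, ht.trans (eval_mono T ?_), he⟩
      have h1 := hB a l₁ (by rw [hl₁]; exact List.prefix_append _ _)
      have h2 := codeSize_le_of_mem (show b ∈ l a by rw [hl₁]; simp)
      have h3 := hTl a
      simp only [codeSize_pair]
      omega)
  have h1 := hB a _ (List.prefix_refl _)
  have h2 : (l a).length * (T.eval (codeSize a + B.eval (codeSize a) + Tl.eval (codeSize a) + 2) + 30) ≤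
      Tl.eval (codeSize a) *
        (T.eval (codeSize a + B.eval (codeSize a) + Tl.eval (codeSize a) + 2) + 30) :=
    Nat.mul_le_mul_right _ ((length_le_codeSize _).trans (hTl a))
  simp only [Polynomial.eval_add, Polynomial.eval_mul, Polynomial.eval_comp, Polynomial.eval_X,
    Polynomial.eval_ofNat]
  exact ⟨by omega, _, by omega, .comp (.comp h' he) (.comp (.tl _) (.tl _))⟩

/-- A fold is computable in polynomial time if every step increases the size of the state by an
amount that does not depend on the state. -/
theorem foldl {l : α → List β} {i : α → σ} {st : α → σ → β → σ} (hl : PolyTime l)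
    (hi : PolyTime i) (hst : PolyTime fun p : α × σ × β => st p.1 p.2.1 p.2.2)
    (G : Polynomial ℕ)
    (hG : ∀ a s b, codeSize (st a s b) ≤ codeSize s + G.eval (codeSize a + codeSize b)) :
    PolyTime fun a => (l a).foldl (st a) (i a) := by
  obtain ⟨Tl, hTl⟩ := hl.exists_size_le
  obtain ⟨Ti, hTi⟩ := hi.exists_size_le
  refine foldl_of_prefix hl hi hst (Ti + Tl * G.comp (Polynomial.X + Tl)) fun a l' hl' => ?_
  simp only [Polynomial.eval_add, Polynomial.eval_mul, Polynomial.eval_comp, Polynomial.eval_X]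
  have hbound : ∀ l' : List β, (∀ b ∈ l', b ∈ l a) → codeSize (l'.foldl (st a) (i a)) ≤
      Ti.eval (codeSize a) + l'.length * G.eval (codeSize a + Tl.eval (codeSize a)) := by
    intro l'
    induction l' using List.reverseRecOn with
    | nil => simpa using hTi a
    | append_singleton l' b ih =>
      intro hmem
      have h1 := ih fun x hx => hmem x (by simp [hx])
      have h2 := hG a (l'.foldl (st a) (i a)) b
      have h3 := codeSize_le_of_mem (hmem b (by simp))
      have h4 := hTl a
      have h5 := eval_mono G (show codeSize a + codeSize b ≤
        codeSize a + Tl.eval (codeSize a) by omega)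
      simp only at h5
      rw [List.foldl_append, List.foldl_cons, List.foldl_nil, List.length_append,
        List.length_singleton, Nat.succ_mul]
      omega
  refine (hbound l' fun _ h => hl'.subset h).trans (Nat.add_le_add_left ?_ _)
  exact Nat.mul_le_mul_right _ (hl'.length_le.trans ((length_le_codeSize _).trans (hTl a)))

end PolyTime
end
end InsDel

namespace InsDel
open Code (code)

variable {α β γ σ : Type} [Code α] [Code β] [Code γ] [Code σ]

namespace PolyTime

/-- The result may be read as an element of another type with the same representation. -/
theorem of_code {f : α → β} {g : α → γ} (hf : PolyTime f) (h : ∀ a, code (f a) = code (g a)) :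
    PolyTime g := by
  obtain ⟨P, T, hP⟩ := hf
  refine ⟨P, T, fun a => ?_⟩
  rw [codeSize, ← h]
  exact hP a

/-! #### Natural numbers -/

/-- `false` is coded by `nil`, so a unary number is at the same time a list of copies of `false`;
this reduces arithmetic to list operations. -/
theorem code_replicate (n : ℕ) : code (List.replicate n false) = code n := by
  change encodeList ((List.replicate n false).map code) = encodeNat n
  rw [List.map_replicate]
  rfl

theorem ones {f : α → ℕ} (hf : PolyTime f) : PolyTime (fun a => List.replicate (f a) false) :=
  hf.of_code fun _ => (code_replicate _).symm

theorem succ {f : α → ℕ} (hf : PolyTime f) : PolyTime (fun a => f a + 1) :=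
  (cons (const false) hf.ones).of_code fun _ => by
    rw [← code_replicate, List.replicate_succ]

theorem pred {f : α → ℕ} (hf : PolyTime f) : PolyTime (fun a => f a - 1) :=
  hf.ones.tail.of_code fun _ => by rw [List.tail_replicate, code_replicate]

theorem isZero {f : α → ℕ} (hf : PolyTime f) : PolyTime (fun a => decide (f a = 0)) :=
  hf.ones.isEmpty.of_eq fun a => by cases f a <;> rfl

theorem iterate {f : α → ℕ} {i : α → σ} {st : α → σ → σ} (hf : PolyTime f)
    (hi : PolyTime i) (hst : PolyTime fun p : α × σ => st p.1 p.2)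
    (G : Polynomial ℕ) (hG : ∀ a s, codeSize (st a s) ≤ codeSize s + G.eval (codeSize a)) :
    PolyTime fun a => (st a)^[f a] (i a) := by
  refine (foldl (l := fun a => List.replicate (f a) false) (st := fun a s _ => st a s)
    hf.ones hi (hst.comp (fst.pair snd.fst')) G
    fun a s b => (hG a s).trans (Nat.add_le_add_left (eval_mono G (by omega)) _)).of_eq fun a => ?_
  generalize i a = s
  induction f a generalizing s with
  | zero => rfl
  | succ n ih => rw [List.replicate_succ, List.foldl_cons, ih, Function.iterate_succ_apply]

theorem length {l : α → List β} (hl : PolyTime l) : PolyTime (fun a => (l a).length) := by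
  refine (foldl (st := fun _ (n : ℕ) _ => n + 1) hl (const 0) snd.fst'.succ 1
    fun a s b => by simp).of_eq fun a => ?_
  simp

theorem add {f g : α → ℕ} (hf : PolyTime f) (hg : PolyTime g) : PolyTime (fun a => f a + g a) := by
  refine (iterate (st := fun _ n => n + 1) hg hf snd.succ 1 fun a s => by simp).of_eq fun a => ?_
  simp

theorem sub {f g : α → ℕ} (hf : PolyTime f) (hg : PolyTime g) : PolyTime (fun a => f a - g a) := by
  refine (iterate (st := fun _ n => n - 1) hg hf snd.pred 1 fun a s => by simp; omega).of_eq
    fun a => ?_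
  exact Nat.pred_iterate _ _

theorem mul {f g : α → ℕ} (hf : PolyTime f) (hg : PolyTime g) : PolyTime (fun a => f a * g a) := by
  obtain ⟨T, hT⟩ := hf.exists_size_le
  refine (iterate (st := fun a n => f a + n) hg (const 0) ((hf.comp fst).add snd) T
    fun a s => by have := hT a; simp at this ⊢; omega).of_eq fun a => ?_
  simp [mul_comm]

theorem le {f g : α → ℕ} (hf : PolyTime f) (hg : PolyTime g) :
    PolyTime (fun a => decide (f a ≤ g a)) :=
  (hf.sub hg).isZero.of_eq fun a => by simp [Nat.sub_eq_zero_iff_le]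

theorem lt {f g : α → ℕ} (hf : PolyTime f) (hg : PolyTime g) :
    PolyTime (fun a => decide (f a < g a)) :=
  hf.succ.le hg

theorem eq {f g : α → ℕ} (hf : PolyTime f) (hg : PolyTime g) :
    PolyTime (fun a => decide (f a = g a)) :=
  ((hf.le hg).and (hg.le hf)).of_eq fun a => by
    rw [← Bool.decide_and]; exact decide_eq_decide.2 ⟨fun h => le_antisymm h.1 h.2, fun h => by omega⟩

theorem min {f g : α → ℕ} (hf : PolyTime f) (hg : PolyTime g) :
    PolyTime (fun a => min (f a) (g a)) :=
  (ite (hf.le hg) hf hg).of_eq fun a => by simp only [min_def]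

theorem max {f g : α → ℕ} (hf : PolyTime f) (hg : PolyTime g) :
    PolyTime (fun a => max (f a) (g a)) :=
  (ite (hf.le hg) hg hf).of_eq fun a => by simp only [max_def]

/-- An odometer: the remainder counts up and carries at d. For d = 0 it never carries, in accordance
with n / 0 = 0 and n % 0 = n. -/
theorem divMod_iterate (d n : ℕ) :
    (fun p : ℕ × ℕ => if p.2 + 1 = d then (p.1 + 1, 0) else (p.1, p.2 + 1))^[n] (0, 0) =
      (n / d, n % d) := by
  induction n with
  | zero => simp
  | succ n ih =>
    rw [Function.iterate_succ_apply', ih]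
    simp only
    rcases Nat.eq_zero_or_pos d with rfl | hd
    · simp
    have h1 := Nat.div_add_mod n d
    have h2 := Nat.mod_lt n hd
    split_ifs with h
    · have h3 : n + 1 = d * (n / d + 1) := by rw [Nat.mul_succ]; omega
      rw [h3, Nat.mul_div_cancel_left _ hd, Nat.mul_mod_right]
    · have h3 : n + 1 = d * (n / d) + (n % d + 1) := by omega
      rw [h3, Nat.mul_add_div hd, Nat.mul_add_mod, Nat.mod_eq_of_lt (a := n % d + 1) (by omega),
        Nat.div_eq_of_lt (a := n % d + 1) (by omega)]
      rfl

theorem divMod {f g : α → ℕ} (hf : PolyTime f) (hg : PolyTime g) :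
    PolyTime (fun a => (f a / g a, f a % g a)) := by
  refine (iterate (st := fun a p => if p.2 + 1 = g a then (p.1 + 1, 0) else (p.1, p.2 + 1)) hf
    (const (0, 0)) ?_ 2 fun a s => ?_).of_eq fun a => divMod_iterate _ _
  · exact ite (snd.snd'.succ.eq (hg.comp fst)) (snd.fst'.succ.pair (const 0))
      (snd.fst'.pair snd.snd'.succ)
  · rcases s with ⟨x, y⟩
    simp only
    split_ifs <;> simp <;> omega

theorem div {f g : α → ℕ} (hf : PolyTime f) (hg : PolyTime g) : PolyTime (fun a => f a / g a) :=
  (hf.divMod hg).fst'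

theorem mod {f g : α → ℕ} (hf : PolyTime f) (hg : PolyTime g) : PolyTime (fun a => f a % g a) :=
  (hf.divMod hg).snd'

/-! #### Lists -/

theorem reverse {l : α → List β} (hl : PolyTime l) : PolyTime (fun a => (l a).reverse) := by
  refine (foldl (st := fun _ (s : List β) b => b :: s) hl (const []) (cons snd.snd' snd.fst')
    (Polynomial.X + 1) fun a s b => by simp; omega).of_eq fun a => ?_
  simp

theorem append {l l' : α → List β} (hl : PolyTime l) (hl' : PolyTime l') :
    PolyTime (fun a => l a ++ l' a) := by
  refine (foldl (st := fun _ (s : List β) b => b :: s) hl.reverse hl' (cons snd.snd' snd.fst')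
    (Polynomial.X + 1) fun a s b => by simp; omega).of_eq fun a => ?_
  simp

theorem replicate {f : α → ℕ} {g : α → β} (hf : PolyTime f) (hg : PolyTime g) :
    PolyTime (fun a => List.replicate (f a) (g a)) := by
  obtain ⟨T, hT⟩ := hg.exists_size_le
  refine (iterate (st := fun a (s : List β) => g a :: s) hf (const []) (cons (hg.comp fst) snd)
    (T + 1) fun a s => by have := hT a; simp; omega).of_eq fun a => ?_
  induction f a with
  | zero => rfl
  | succ n ih => rw [Function.iterate_succ_apply', ih, List.replicate_succ]

theorem drop {f : α → ℕ} {l : α → List β} (hf : PolyTime f) (hl : PolyTime l) :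
    PolyTime (fun a => (l a).drop (f a)) := by
  refine (iterate (st := fun _ (s : List β) => s.tail) hf hl snd.tail 1
    fun a s => ?_).of_eq fun a => ?_
  · cases s <;> simp; omega
  · generalize l a = s
    induction f a generalizing s with
    | zero => rfl
    | succ n ih => rw [Function.iterate_succ_apply, ih, List.drop_tail]

theorem take {f : α → ℕ} {l : α → List β} (hf : PolyTime f) (hl : PolyTime l) :
    PolyTime (fun a => (l a).take (f a)) :=
  ((hl.length.sub hf).drop hl.reverse).reverse.of_eq fun a => by
    rw [List.drop_reverse, List.reverse_reverse]
    rcases Nat.le_total (l a).length (f a) with h | h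
    · rw [List.take_of_length_le (by omega), List.take_of_length_le h]
    · congr 1; omega

theorem getD {f : α → ℕ} {l : α → List β} {d : β} (hf : PolyTime f) (hl : PolyTime l) :
    PolyTime (fun a => (l a).getD (f a) d) :=
  (hf.drop hl).headD.of_eq fun a => by
    rw [List.headD_eq_head?_getD, List.head?_drop, List.getD_eq_getElem?_getD]

theorem getLastD {l : α → List β} {d : β} (hl : PolyTime l) :
    PolyTime (fun a => (l a).getLastD d) :=
  hl.reverse.headD.of_eq fun a => by
    rw [List.headD_eq_head?_getD, List.head?_reverse, List.getLastD_eq_getLast?]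

theorem range {f : α → ℕ} (hf : PolyTime f) : PolyTime (fun a => List.range (f a)) := by
  have key : ∀ l : List Bool, l.foldl (fun (s : ℕ × List ℕ) _ => (s.1 + 1, s.1 :: s.2)) (0, []) =
      (l.length, (List.range l.length).reverse) := by
    intro l
    induction l using List.reverseRecOn with
    | nil => rfl
    | append_singleton l b ih => simp [ih, List.range_succ]
  obtain ⟨T, hT⟩ := hf.exists_size_le
  -- The number pushed in a step grows with the state, so the uniform growth bound of `foldl` is not
  -- available; the closed form `key` bounds the states instead.
  refine (foldl_of_prefix (st := fun _ (s : ℕ × List ℕ) _ => (s.1 + 1, s.1 :: s.2)) hf.ones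
    (const (0, [])) (snd.fst'.fst'.succ.pair (cons snd.fst'.fst' snd.fst'.snd'))
    (T + T * (T + 1) + 1) fun a l' hl' => ?_).snd'.reverse.of_eq fun a => ?_
  · have h1 := hl'.length_le
    have h2 := hT a
    rw [List.length_replicate] at h1
    rw [codeSize_nat] at h2
    rw [key, codeSize_pair, codeSize_nat, codeSize_reverse]
    have h3 : codeSize (List.range l'.length) ≤ l'.length * (l'.length + 1) := by
      refine (codeSize_le_of_forall (B := l'.length) fun k hk => ?_).trans_eq
        (by rw [List.length_range])
      rw [codeSize_nat]
      exact (List.mem_range.1 hk).le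
    have h4 : l'.length * (l'.length + 1) ≤
        T.eval (codeSize a) * (T.eval (codeSize a) + 1) := Nat.mul_le_mul (by omega) (by omega)
    simp only [Polynomial.eval_add, Polynomial.eval_mul, Polynomial.eval_one]
    omega
  · rw [key, List.length_replicate, List.reverse_reverse]

theorem boolEq {f g : α → Bool} (hf : PolyTime f) (hg : PolyTime g) :
    PolyTime (fun a => f a == g a) :=
  (cond hf hg hg.not).of_eq fun a => by cases f a <;> cases g a <;> rfl

/-- The fold over one list pops the other one along and records whether all heads agreed; the lists
are equal if, moreover, nothing is left. -/
theorem listEq {l l' : α → List Bool} (hl : PolyTime l) (hl' : PolyTime l') :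
    PolyTime (fun a => decide (l a = l' a)) := by
  have h := foldl (l := l) (i := fun a => (l' a, true))
    (st := fun _ (s : List Bool × Bool) b => (s.1.tail, s.2 && !s.1.isEmpty && s.1.headD false == b))
    hl (hl'.pair (const true))
    (snd.fst'.fst'.tail.pair ((snd.fst'.snd'.and snd.fst'.fst'.isEmpty.not).and
      (snd.fst'.fst'.headD.boolEq snd.snd'))) 1 fun a s b => by
        rcases s with ⟨s, v⟩
        have := codeSize_bool (v && !s.isEmpty && s.headD false == b)
        cases s <;> simp <;> simp at this <;> omega
  refine (h.snd'.and h.fst'.isEmpty).of_eq fun a => ?_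
  have key : ∀ (l l' : List Bool) (v : Bool),
      let s := l.foldl (fun (s : List Bool × Bool) b =>
        (s.1.tail, s.2 && !s.1.isEmpty && s.1.headD false == b)) (l', v)
      (s.2 && s.1.isEmpty) = (v && decide (l = l')) := by
    intro l
    induction l with
    | nil => intro l' v; cases l' <;> simp
    | cons b l ih =>
      intro l' v
      simp only [List.foldl_cons]
      rw [ih]
      cases l' with
      | nil => simp
      | cons b' l' => cases b <;> cases b' <;> cases v <;> simp <;> congr
  rw [key, Bool.true_and]

/-! #### Events -/

def _root_.InsDel.Event.bit : Event → Bool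
  | .user b => b
  | .channel b => b
  | .did (.reveal b) => b
  | .did (.send b) => b

/-- Which of the four kinds of events it is. -/
def _root_.InsDel.Event.kind : Event → ℕ
  | .user _ => 0
  | .channel _ => 1
  | .did (.reveal _) => 2
  | .did (.send _) => 3

theorem bit : PolyTime Event.bit := by
  refine ⟨.ite (.comp .tl .hd) (.comp .tl .tl) .tl, 40,
    fun e => ⟨(codeSize_bool _).trans (by simp), ?_⟩⟩
  simp only [Polynomial.eval_ofNat]
  rcases e with b | b | b | b
  · exact ⟨_, by omega, .iteFalse (.comp (.hd _) (.tl _)) (.tl _)⟩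
  · exact ⟨_, by omega, .iteFalse (.comp (.hd _) (.tl _)) (.tl _)⟩
  · exact ⟨_, by omega, .iteTrue (.comp (.hd _) (.tl _)) (by intro h; cases h)
      (.comp (.tl _) (.tl _))⟩
  · exact ⟨_, by omega, .iteTrue (.comp (.hd _) (.tl _)) (by intro h; cases h)
      (.comp (.tl _) (.tl _))⟩

theorem kind : PolyTime Event.kind := by
  refine ⟨.ite (.comp .tl .hd) (.cons (.const .nil) (.cons (.const .nil) (.comp .hd .tl))) .hd, 40,
    fun e => ⟨?_, ?_⟩⟩
  · rcases e with b | b | b | b <;> simp [Event.kind]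
  simp only [Polynomial.eval_ofNat]
  rcases e with b | b | b | b
  · exact ⟨_, by omega, .iteFalse (.comp (.hd _) (.tl _)) (.hd _)⟩
  · exact ⟨_, by omega, .iteFalse (.comp (.hd _) (.tl _)) (.hd _)⟩
  · exact ⟨_, by omega, .iteTrue (.comp (.hd _) (.tl _)) (by intro h; cases h)
      (.cons (.const _ _) (.cons (.const _ _) (.comp (.tl _) (.hd _))))⟩
  · exact ⟨_, by omega, .iteTrue (.comp (.hd _) (.tl _)) (by intro h; cases h)
      (.cons (.const _ _) (.cons (.const _ _) (.comp (.tl _) (.hd _))))⟩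

theorem reveal {f : α → Bool} (hf : PolyTime f) : PolyTime (fun a => Action.reveal (f a)) :=
  ((const 0).pair hf).of_code fun _ => rfl

theorem send {f : α → Bool} (hf : PolyTime f) : PolyTime (fun a => Action.send (f a)) :=
  ((const 1).pair hf).of_code fun _ => rfl

/-- The bits of the events of the given kind. -/
theorem bitsOfKind {h : α → List Event} (hh : PolyTime h) (k : ℕ) :
    PolyTime (fun a => (h a).filterMap fun e => if e.kind = k then some e.bit else none) := by
  refine (foldl (st := fun _ (s : List Bool) (e : Event) => if e.kind = k then e.bit :: s else s) hh
    (const []) (ite ((kind.comp snd.snd').eq (const k)) (cons (bit.comp snd.snd') snd.fst') snd.fst')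
    2 fun a s e => ?_).reverse.of_eq fun a => ?_
  · have := codeSize_bool e.bit
    split_ifs
    · simp; omega
    · simp
  · generalize h a = l
    induction l using List.reverseRecOn with
    | nil => rfl
    | append_singleton l e ih =>
      rw [List.foldl_append, List.foldl_cons, List.foldl_nil, List.filterMap_append, ← ih]
      by_cases h : e.kind = k <;> simp [h]

theorem given {h : α → List Event} (hh : PolyTime h) : PolyTime (fun a => given (h a)) :=
  (hh.bitsOfKind 0).of_eq fun a => by
    refine List.filterMap_congr fun e _ => ?_
    rcases e with b | b | b | b <;> rfl

theorem received {h : α → List Event} (hh : PolyTime h) : PolyTime (fun a => received (h a)) :=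
  (hh.bitsOfKind 1).of_eq fun a => by
    refine List.filterMap_congr fun e _ => ?_
    rcases e with b | b | b | b <;> rfl

theorem revealed {h : α → List Event} (hh : PolyTime h) : PolyTime (fun a => revealed (h a)) :=
  (hh.bitsOfKind 2).of_eq fun a => by
    refine List.filterMap_congr fun e _ => ?_
    rcases e with b | b | b | b <;> rfl

theorem sent {h : α → List Event} (hh : PolyTime h) : PolyTime (fun a => sent (h a)) :=
  (hh.bitsOfKind 3).of_eq fun a => by
    refine List.filterMap_congr fun e _ => ?_
    rcases e with b | b | b | b <;> rfl

/-! #### The strategies -/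

theorem aliceStrategy {isData header : α → ℕ → Bool} {m : α → ℕ} {h : α → List Event}
    (hd : PolyTime fun p : α × ℕ => isData p.1 p.2) (hh : PolyTime fun p : α × ℕ => header p.1 p.2)
    (hm : PolyTime m) (hh' : PolyTime h) :
    PolyTime (fun a => aliceStrategy (isData a) (header a) (m a) (h a)) := by
  have hs := hh'.sent.length
  have hbit : PolyTime fun a => aliceBit (isData a) (header a) (h a) :=
    cond (hd.comp (id.pair hs)) hh'.given.getLastD (hh.comp (id.pair hs))
  have hlast := hh'.getLastD (d := Event.user false)
  refine (cond (((kind.comp hlast).eq (const 1)).and ((hd.comp (id.pair hs.pred)).and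
    (hh'.revealed.length.lt hm))) (bit.comp hlast).reveal hbit.send).of_eq fun a => ?_
  unfold InsDel.aliceStrategy
  rw [List.getLastD_eq_getLast?]
  rcases (h a).getLast? with _ | (b | b | (b | b)) <;> simp [Event.kind, Event.bit]

theorem bobStrategy {target : α → List Bool → ℕ} {m : α → ℕ} {h : α → List Event}
    (ht : PolyTime fun p : α × List Bool => target p.1 p.2) (hm : PolyTime m) (hh : PolyTime h) :
    PolyTime (fun a => bobStrategy (target a) (m a) (h a)) :=
  ite (hh.revealed.length.lt (hm.min (ht.comp (id.pair hh.received))))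
    hh.received.getLastD.reveal hh.given.getLastD.send

end PolyTime
end InsDel

namespace InsDel
open Code (code)

/-! ### The running time of the decoder -/

/-- A row of the table for longest common subsequences, as a list. -/
def rowStep {β : Type*} [DecidableEq β] (W : ℕ → β) (N : ℕ) (y : β) (row : List ℕ) : List ℕ :=
  ((List.range N).foldl (fun acc q => max (acc.headD 0)
    (max (row.getD (q + 1) 0) (row.getD q 0 + if W q = y then 1 else 0)) :: acc) [0]).reverse

theorem getD_map_range {f : ℕ → ℕ} {n i : ℕ} (h : i < n) :
    ((List.range n).map f).getD i 0 = f i := by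
  simp [List.getD_eq_getElem?_getD, h]

theorem rowStep_eq {β : Type*} [DecidableEq β] (W : ℕ → β) (N : ℕ) (y : β) (f : ℕ → ℕ) :
    rowStep W N y ((List.range (N + 1)).map f) = (List.range (N + 1)).map (nextRow W y f) := by
  have key : ∀ k ≤ N, (List.range k).foldl (fun acc q => max (acc.headD 0)
      (max (((List.range (N + 1)).map f).getD (q + 1) 0) (((List.range (N + 1)).map f).getD q 0 +
        if W q = y then 1 else 0)) :: acc) [0] = ((List.range (k + 1)).map (nextRow W y f)).reverse := by
    intro k
    induction k with
    | zero => intro _; rfl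
    | succ k ih =>
      intro hk
      rw [List.range_succ (n := k), List.foldl_append, ih (by omega), List.foldl_cons, List.foldl_nil,
        getD_map_range (by omega), getD_map_range (by omega), List.range_succ (n := k + 1),
        List.map_append, List.reverse_append, List.map_singleton, List.reverse_singleton,
        List.singleton_append, nextRow]
      congr 2
      rw [List.range_succ]
      simp
  rw [rowStep, key N le_rfl, List.reverse_reverse]

theorem lcs_le {β : Type*} [DecidableEq β] (W : ℕ → β) (ys : List β) (q : ℕ) :
    lcs W ys q ≤ q := by
  induction ys generalizing q with
  | nil => simp [lcs]
  | cons y ys ih =>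
    rw [lcs_cons]
    induction q with
    | zero => simp [nextRow]
    | succ q ihq =>
      rw [nextRow]
      have h1 := ih q
      have h2 := ih (q + 1)
      split_ifs <;> omega

theorem lcs_rows {β : Type*} [DecidableEq β] (W : ℕ → β) (N : ℕ) (ys : List β) :
    ys.foldl (fun row y => rowStep W N y row) (List.replicate (N + 1) 0) =
      (List.range (N + 1)).map (lcs W ys.reverse) := by
  induction ys using List.reverseRecOn with
  | nil => simp [lcs]
  | append_singleton ys y ih =>
    rw [List.foldl_append, ih, List.foldl_cons, List.foldl_nil, rowStep_eq, List.reverse_append,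
      List.reverse_singleton, List.singleton_append, lcs_cons]

instance : Code Receiver := ⟨fun r => code (r.buf, r.wait, r.words)⟩

theorem codeSize_receiver (r : Receiver) :
    codeSize r = codeSize r.buf + (r.wait + codeSize r.words + 1) + 1 := by
  have : codeSize r = codeSize (r.buf, r.wait, r.words) := rfl
  rw [this, codeSize_pair, codeSize_pair, codeSize_nat]

/-- A symbol as a word of `q` bits. -/
def codeword (q σ : ℕ) : List Bool := List.replicate σ true ++ List.replicate (q - σ) false

/-- The symbol with number `i` of the `N`-th string. -/
def symbol {q : ℕ} (S : ℕ → List (Fin q)) (N i : ℕ) : ℕ := ((S N)[i]?).elim 0 Fin.val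

/-- The scheme with the words given by the `n`-th string. -/
def scheme {q : ℕ} (S : ℕ → List (Fin q)) (s ρ n : ℕ) : Scheme :=
  ⟨s, q, ρ, fun k => codeword q (symbol S n k)⟩

theorem symbol_le {q : ℕ} (S : ℕ → List (Fin q)) (N i : ℕ) : symbol S N i ≤ q := by
  unfold symbol
  cases (S N)[i]? with
  | none => simp
  | some a => exact a.2.le

namespace PolyTime

variable {α β γ σ : Type} [Code α] [Code β] [Code γ] [Code σ]

theorem rowStep {W : α → ℕ → List Bool} {N : α → ℕ} {y : α → List Bool} {row : α → List ℕ}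
    (hW : PolyTime fun p : α × ℕ => W p.1 p.2) (hN : PolyTime N) (hy : PolyTime y)
    (hrow : PolyTime row) : PolyTime (fun a => rowStep (W a) (N a) (y a) (row a)) := by
  obtain ⟨TN, hTN⟩ := hN.exists_size_le
  obtain ⟨T, hT⟩ := hrow.exists_size_le
  refine (foldl_of_prefix (l := fun a => List.range (N a)) (i := fun _ => [0])
    (st := fun a acc q => Max.max (acc.headD 0) (Max.max ((row a).getD (q + 1) 0)
      ((row a).getD q 0 + if W a q = y a then 1 else 0)) :: acc) hN.range (const [0]) ?_
    ((TN + 1) * (T + 2)) fun a l' hl' => ?_).reverse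
  · refine cons ((headD snd.fst').max (((getD snd.snd'.succ (hrow.comp fst))).max
      ((getD snd.snd' (hrow.comp fst)).add (ite ?_ (const 1) (const 0))))) snd.fst'
    exact (hW.comp (fst.pair snd.snd')).listEq (hy.comp fst)
  · have hget : ∀ i, (row a).getD i 0 ≤ codeSize (row a) := by
      intro i
      rw [List.getD_eq_getElem?_getD]
      cases h : (row a)[i]? with
      | none => simp
      | some x =>
        have := codeSize_le_of_mem (List.mem_of_getElem? h)
        simp at this ⊢; omega
    have hl := hl'.length_le
    have h1 := hTN a
    have h2 := hT a
    rw [List.length_range] at hl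
    rw [codeSize_nat] at h1
    clear hl'
    -- No entry exceeds the size of the previous row by more than one, so the partial rows stay of
    -- polynomial size.
    have key : ∀ l' acc : List ℕ, acc = l'.foldl (fun acc q => Max.max (acc.headD 0)
        (Max.max ((row a).getD (q + 1) 0) ((row a).getD q 0 + if W a q = y a then 1 else 0)) ::
          acc) [0] → acc.length = l'.length + 1 ∧ ∀ x ∈ acc, x ≤ codeSize (row a) + 1 := by
      intro l'
      induction l' using List.reverseRecOn with
      | nil => rintro acc rfl; simp
      | append_singleton l' q ih =>
        rintro acc rfl
        have ih := ih _ rfl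
        rw [List.foldl_append, List.foldl_cons, List.foldl_nil]
        refine ⟨by rw [List.length_cons, ih.1, List.length_append, List.length_singleton], ?_⟩
        intro x hx
        rcases List.mem_cons.1 hx with rfl | hx
        · have h3 := hget q
          have h4 := hget (q + 1)
          refine max_le ?_ (max_le (by omega) (by split_ifs <;> omega))
          generalize l'.foldl _ _ = acc at ih
          rcases acc with _ | ⟨x, acc⟩
          · simp
          · exact ih.2 x (by simp)
        · exact ih.2 x hx
    obtain ⟨h3, h4⟩ := key l' _ rfl
    refine (codeSize_le_of_forall (B := codeSize (row a) + 1) fun x hx => ?_).trans ?_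
    · rw [codeSize_nat]; exact h4 x hx
    · rw [h3]
      simp only [Polynomial.eval_add, Polynomial.eval_mul, Polynomial.eval_one,
        Polynomial.eval_ofNat]
      exact Nat.mul_le_mul (by omega) (by omega)

/-- A growth bound for single rows would have to be iterated. Instead, every intermediate row is
itself a table of values of `lcs`, and these are at most N by `lcs_le`. -/
theorem lcsRows {W : α → ℕ → List Bool} {N : α → ℕ} {ys : α → List (List Bool)}
    (hW : PolyTime fun p : α × ℕ => W p.1 p.2) (hN : PolyTime N) (hys : PolyTime ys) :
    PolyTime (fun a => (List.range (N a + 1)).map (lcs (W a) (ys a))) := by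
  obtain ⟨T, hT⟩ := hN.exists_size_le
  refine (foldl_of_prefix (l := fun a => (ys a).reverse) (i := fun a => List.replicate (N a + 1) 0)
    (st := fun a row y => InsDel.rowStep (W a) (N a) y row) hys.reverse (hN.succ.replicate (const 0))
    (rowStep (hW.comp (fst.fst'.pair snd)) (hN.comp fst) snd.snd' snd.fst')
    ((T + 1) * (T + 1)) fun a l' _ => ?_).of_eq fun a => ?_
  · have h1 := hT a
    rw [codeSize_nat] at h1
    rw [lcs_rows]
    refine (codeSize_le_of_forall (B := N a) fun x hx => ?_).trans ?_
    · obtain ⟨k, hk, rfl⟩ := List.mem_map.1 hx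
      rw [codeSize_nat]
      have := lcs_le (W a) l'.reverse k
      have := List.mem_range.1 hk
      omega
    · rw [List.length_map, List.length_range]
      simp only [Polynomial.eval_add, Polynomial.eval_mul, Polynomial.eval_one]
      exact Nat.mul_le_mul (by omega) (by omega)
  · rw [lcs_rows, List.reverse_reverse]

theorem best {W : α → ℕ → List Bool} {N : α → ℕ} {ys : α → List (List Bool)}
    (hW : PolyTime fun p : α × ℕ => W p.1 p.2) (hN : PolyTime N) (hys : PolyTime ys) :
    PolyTime (fun a => best (W a) (N a) (ys a)) := by
  have hrow := lcsRows hW hN hys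
  refine (foldl (l := fun a => List.range (N a + 1)) (i := fun _ => 0)
    (st := fun a b q =>
      if 2 * ((List.range (N a + 1)).map (lcs (W a) (ys a))).getD b 0 + q <
        2 * ((List.range (N a + 1)).map (lcs (W a) (ys a))).getD q 0 + b then q else b)
    hN.succ.range (const 0) ?_ Polynomial.X fun a b q => ?_).of_eq fun a => ?_
  · exact ite ((((const 2).mul (getD snd.fst' (hrow.comp fst))).add snd.snd').lt
      (((const 2).mul (getD snd.snd' (hrow.comp fst))).add snd.fst')) snd.snd' snd.fst'
  · split_ifs <;> simp; omega
  · unfold InsDel.best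
    have key : ∀ l : List ℕ, (∀ q ∈ l, q < N a + 1) → ∀ b < N a + 1,
        l.foldl (fun b q =>
          if 2 * ((List.range (N a + 1)).map (lcs (W a) (ys a))).getD b 0 + q <
            2 * ((List.range (N a + 1)).map (lcs (W a) (ys a))).getD q 0 + b then q else b) b =
        l.foldl (fun b q => if 2 * lcs (W a) (ys a) b + q < 2 * lcs (W a) (ys a) q + b
          then q else b) b := by
      intro l
      induction l with
      | nil => intros; rfl
      | cons q l ih =>
        intro hl b hb
        have hq := hl q (by simp)
        simp only [List.foldl_cons]
        rw [getD_map_range hb, getD_map_range hq]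
        exact ih (fun x hx => hl x (by simp [hx])) _ (by split_ifs <;> assumption)
    exact key _ (fun q hq => List.mem_range.1 hq) 0 (Nat.succ_pos _)

section
variable {q : ℕ} {S : ℕ → List (Fin q)}

/-- The given program is reliable only on positions inside the string, so it is run only there;
elsewhere the default 0 is returned. -/
theorem symbol (hS : IsEfficientFamily S) (hlen : ∀ N, (S N).length = N) {f g : α → ℕ}
    (hf : PolyTime f) (hg : PolyTime g) : PolyTime (fun a => symbol S (f a) (g a)) := by
  refine PolyTime.comp (g := fun p : ℕ × ℕ => InsDel.symbol S p.1 p.2) ?_ (hf.pair hg)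
  obtain ⟨P, T, hP⟩ := hS
  refine ite_of (b := fun p : ℕ × ℕ => decide (p.2 < p.1)) (snd.lt fst)
    ⟨P, T + (q : Polynomial ℕ), fun p hp => ?_⟩ ⟨.const (code 0), 1, fun p hp => ?_⟩
  · rw [decide_eq_true_iff] at hp
    have hi : p.2 < (S p.1).length := by rw [hlen]; exact hp
    obtain ⟨t, ht, he⟩ := hP p.1 p.2 _ (List.getElem?_eq_getElem hi)
    have h1 := symbol_le S p.1 p.2
    have h2 := eval_mono T (show p.1 ≤ codeSize p by
      rcases p with ⟨x, y⟩; simp; omega)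
    simp only at h2
    rw [codeSize_nat]
    simp only [Polynomial.eval_add, Polynomial.eval_natCast, Nat.cast_id]
    refine ⟨by omega, t, by omega, ?_⟩
    rw [InsDel.symbol, List.getElem?_eq_getElem hi]
    exact he
  · rw [decide_eq_false_iff_not] at hp
    have h0 : InsDel.symbol S p.1 p.2 = 0 := by
      rw [InsDel.symbol, List.getElem?_eq_none (by rw [hlen]; omega)]
      rfl
    rw [h0]
    exact ⟨by simp, 1, by simp, .const _ _⟩

variable {s ρ n : α → ℕ} (hs : PolyTime s) (hρ : PolyTime ρ) (hn : PolyTime n)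
include hs hρ hn

omit hs hρ in
theorem word (hS : IsEfficientFamily S) (hlen : ∀ N, (S N).length = N) {k : α → ℕ}
    (hk : PolyTime k) : PolyTime (fun a => (scheme S (s a) (ρ a) (n a)).word (k a)) :=
  ((hn.symbol hS hlen hk).replicate (const true)).append
    (((const q).sub (hn.symbol hS hlen hk)).replicate (const false))

omit hn in
theorem schemeData : PolyTime (fun a => (scheme S (s a) (ρ a) (n a)).data) :=
  hρ.sub ((const (q + 1)).add hs)

omit hn in
theorem isData {x : α → ℕ} (hx : PolyTime x) :
    PolyTime (fun a => (scheme S (s a) (ρ a) (n a)).isData (x a)) :=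
  ((const (q + 1)).add hs).le (hx.mod hρ)

theorem headerBit (hS : IsEfficientFamily S) (hlen : ∀ N, (S N).length = N) {x : α → ℕ}
    (hx : PolyTime x) : PolyTime (fun a => (scheme S (s a) (ρ a) (n a)).headerBit (x a)) :=
  getD (hx.mod hρ) (cons (const true) ((word hn hS hlen (hx.div hρ)).append
    (cons (const true) (hs.pred.replicate (const false)))))

omit hn in
theorem receiverStep {r : α → Receiver} {b : α → Bool} (hr : PolyTime r) (hb : PolyTime b) :
    PolyTime (fun a => (r a).step (scheme S (s a) (ρ a) (n a)) (b a)) := by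
  have hr' : PolyTime fun a => ((r a).buf, (r a).wait, (r a).words) := hr.of_code fun _ => rfl
  have hbuf := hr'.fst'
  have hwait := hr'.snd'.fst'
  have hwords := hr'.snd'.snd'
  have hacc : PolyTime fun a => (r a).accepts (scheme S (s a) (ρ a) (n a)) (b a) :=
    (hρ.le hwait.succ).and ((hs.take (cons hb hbuf)).listEq
      ((hs.pred.replicate (const false)).append (const [true])))
  have h1 : PolyTime fun a => (⟨b a :: (r a).buf, 0,
      (((b a :: (r a).buf).drop (s a)).take q).reverse :: (r a).words⟩ : Receiver) :=
    ((cons hb hbuf).pair ((const 0).pair (cons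
      ((const q).take (hs.drop (cons hb hbuf))).reverse hwords))).of_code fun _ => rfl
  have h2 : PolyTime fun a => (⟨b a :: (r a).buf, (r a).wait + 1, (r a).words⟩ : Receiver) :=
    ((cons hb hbuf).pair (hwait.succ.pair hwords)).of_code fun _ => rfl
  exact cond hacc h1 h2

omit hn in
theorem receiver {bits : α → List Bool} (hbits : PolyTime bits) :
    PolyTime (fun a => (bits a).foldl (Receiver.step (scheme S (s a) (ρ a) (n a)))
      (.init (scheme S (s a) (ρ a) (n a)))) := by
  refine foldl (i := fun a => Receiver.init (scheme S (s a) (ρ a) (n a)))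
    (st := fun a r b => Receiver.step (scheme S (s a) (ρ a) (n a)) r b) hbits
    (((const ([] : List Bool)).pair (hρ.pair (const ([] : List (List Bool))))).of_code
      fun _ => rfl)
    (receiverStep (S := S) (n := fun p => n p.1) (hs.comp fst) (hρ.comp fst) snd.fst' snd.snd')
    ((2 * q + 10 : ℕ) : Polynomial ℕ) fun a r b => ?_
  rw [Polynomial.eval_natCast, Nat.cast_id, codeSize_receiver, codeSize_receiver]
  have hb := codeSize_bool b
  unfold Receiver.step
  split_ifs
  · have h1 : codeSize (((b :: r.buf).drop (s a)).take q) ≤ q * 2 := by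
      refine (codeSize_le_of_forall (B := 1) fun x _ => codeSize_bool x).trans ?_
      exact Nat.mul_le_mul_right _ (List.length_take_le _ _)
    have h2 : codeSize (((b :: r.buf).drop (scheme S (s a) (ρ a) (n a)).s).take
        (scheme S (s a) (ρ a) (n a)).len) ≤ q * 2 := h1
    simp only [codeSize_cons, codeSize_reverse]
    omega
  · simp only [codeSize_cons]
    omega

theorem decode (hS : IsEfficientFamily S) (hlen : ∀ N, (S N).length = N) {N : α → ℕ}
    {r : α → Receiver} (hN : PolyTime N) (hr : PolyTime r) :
    PolyTime (fun a => decode (scheme S (s a) (ρ a) (n a)) (N a) (r a)) := by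
  have hr' : PolyTime fun a => ((r a).buf, (r a).wait, (r a).words) := hr.of_code fun _ => rfl
  have hbest : PolyTime fun a => InsDel.best (scheme S (s a) (ρ a) (n a)).word (N a) (r a).words :=
    best (word (s := fun p : α × ℕ => s p.1) (ρ := fun p : α × ℕ => ρ p.1) (hn.comp fst) hS hlen snd)
      hN hr'.snd'.snd'
  have hdata := schemeData (S := S) (n := n) hs hρ
  exact ite (hbest.eq (const 0)) (const 0)
    ((hbest.pred.mul hdata).add (hr'.snd'.fst'.min hdata))

theorem target (hS : IsEfficientFamily S) (hlen : ∀ N, (S N).length = N) {N m F : α → ℕ}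
    {bits : α → List Bool} (hN : PolyTime N) (hm : PolyTime m) (hF : PolyTime F)
    (hbits : PolyTime bits) :
    PolyTime (fun a => target (scheme S (s a) (ρ a) (n a)) (N a) (m a) (F a) (bits a)) :=
  ite (hF.le hbits.length) hm (decode hs hρ hn hS hlen hN (receiver hs hρ hbits))

end

end PolyTime
end InsDel

namespace InsDel
open Code (code)

/-! ### The simulation and its running time -/

/-- Half of the number of simulated rounds. -/
def dataLength (q s ρ n : ℕ) : ℕ := n * (ρ - 10 * (q + 1 + s)) / (2 * ρ)

/-- The intermediaries of the simulation; if `n < n₀` there are no errors. -/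
def simulation {q : ℕ} (S : ℕ → List (Fin q)) (s ρ n₀ n : ℕ) : Side → Strategy :=
  if n < n₀ then
    strategies (fun _ => true) (fun _ => false) List.length (dataLength q s ρ n)
  else
    strategies (fun a => (scheme S s ρ n).isData a) (scheme S s ρ n).headerBit
      (target (scheme S s ρ n) n (dataLength q s ρ n) (n / 2 - n / ρ)) (dataLength q s ρ n)

theorem dataLength_le (q s ρ n : ℕ) : dataLength q s ρ n ≤ n := by
  unfold dataLength
  rcases Nat.eq_zero_or_pos ρ with rfl | h
  · simp
  refine Nat.div_le_of_le_mul ?_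
  rw [mul_comm]
  exact Nat.mul_le_mul_right _ (by omega)

theorem polyTime_strategies {q : ℕ} {S : ℕ → List (Fin q)} (hS : IsEfficientFamily S)
    (hlen : ∀ N, (S N).length = N) (p : Side) :
    PolyTime (fun x : (ℕ × ℕ) × (ℕ × List Event) =>
      strategies (fun a => (scheme S x.1.1 x.1.2 x.2.1).isData a)
        (scheme S x.1.1 x.1.2 x.2.1).headerBit
        (target (scheme S x.1.1 x.1.2 x.2.1) x.2.1 (dataLength q x.1.1 x.1.2 x.2.1)
          (x.2.1 / 2 - x.2.1 / x.1.2)) (dataLength q x.1.1 x.1.2 x.2.1) p x.2.2) := by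
  have hs : PolyTime fun x : (ℕ × ℕ) × (ℕ × List Event) => x.1.1 := PolyTime.fst.fst'
  have hρ : PolyTime fun x : (ℕ × ℕ) × (ℕ × List Event) => x.1.2 := PolyTime.fst.snd'
  have hn : PolyTime fun x : (ℕ × ℕ) × (ℕ × List Event) => x.2.1 := PolyTime.snd.fst'
  have hh : PolyTime fun x : (ℕ × ℕ) × (ℕ × List Event) => x.2.2 := PolyTime.snd.snd'
  have hm : PolyTime fun x : (ℕ × ℕ) × (ℕ × List Event) => dataLength q x.1.1 x.1.2 x.2.1 :=
    (hn.mul (hρ.sub ((PolyTime.const 10).mul ((PolyTime.const (q + 1)).add hs)))).div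
      ((PolyTime.const 2).mul hρ)
  cases p with
  | A =>
    exact PolyTime.aliceStrategy
      (PolyTime.isData (S := S) (n := fun p => p.1.2.1) (hs.comp .fst) (hρ.comp .fst) .snd)
      (PolyTime.headerBit (hs.comp .fst) (hρ.comp .fst) (hn.comp .fst) hS hlen .snd) hm hh
  | B =>
    exact PolyTime.bobStrategy (PolyTime.target (hs.comp .fst) (hρ.comp .fst) (hn.comp .fst) hS hlen
      (hn.comp .fst) (hm.comp .fst) (((hn.div (.const 2)).sub (hn.div hρ)).comp .fst) .snd) hm hh

theorem polyTime_trivial_strategies (p : Side) :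
    PolyTime (fun x : ℕ × List Event =>
      strategies (fun _ => true) (fun _ => false) List.length x.1 p x.2) := by
  cases p with
  | A =>
    exact PolyTime.aliceStrategy (α := ℕ × List Event) (isData := fun _ _ => true)
      (header := fun _ _ => false) (.const true) (.const false) .fst .snd
  | B =>
    exact PolyTime.bobStrategy (α := ℕ × List Event) (target := fun _ => List.length)
      (PolyTime.length .snd) .fst .snd

/-- The unary number and the table are shortened together, so the n-th entry is found in time O(n),
however long the table is. -/
theorem lookup_eval (n : ℕ) : ∀ table : List (Bool × ℕ), ∃ t ≤ n * 9 + 2,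
    Eval (.loop .tl (.cons (.comp .tl .hd) (.comp .tl .tl))) (code (table, n))
      (code (table.drop n, 0)) t := by
  induction n with
  | zero => exact fun table => ⟨_, le_rfl, .loopDone (.tl _)⟩
  | succ n ih =>
    intro table
    obtain ⟨t, ht, he⟩ : ∃ t ≤ 7, Eval (.cons (.comp .tl .hd) (.comp .tl .tl))
        (code (table, n + 1)) (code (table.tail, n)) t := by
      have htail : Eval .tl (code table) (code table.tail) 1 := by
        rcases table with _ | ⟨x, table⟩ <;> exact .tl _
      exact ⟨_, by omega, .cons (.comp (.hd _) htail) (.comp (.tl _) (.tl _))⟩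
    obtain ⟨t', ht', he'⟩ := ih table.tail
    rw [List.drop_tail] at he'
    exact ⟨_, by omega, .loopNext (.tl _) (by intro h; cases h) he he'⟩

theorem codeSize_events_le (h : List Event) : codeSize h ≤ h.length * 7 :=
  codeSize_le_of_forall fun e _ => codeSize_event e

/-- T must not depend on δ, although s, ρ and n₀ do. From n₀ on, s and ρ are at most n and may count
as input. Below n₀ they can be too large to compute with, so the data length is read off a table
that is a constant of the program. -/
theorem exists_runsInTime {q : ℕ} {S : ℕ → List (Fin q)} (hS : IsEfficientFamily S)
    (hlen : ∀ N, (S N).length = N) (p : Side) :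
    ∃ T : Polynomial ℕ, ∀ s ρ n₀, s ≤ n₀ → ρ ≤ n₀ →
      RunsInTime (fun n => simulation S s ρ n₀ n p) T := by
  obtain ⟨P, T, hP⟩ := polyTime_strategies hS hlen p
  obtain ⟨P', T', hP'⟩ := polyTime_trivial_strategies p
  refine ⟨(T + T').comp (7 * Polynomial.X + 3) + 9 * Polynomial.X + 100, fun s ρ n₀ hs hρ => ?_⟩
  -- The Boolean is a mere filler. An exhausted table is coded by `nil`, which is how the program
  -- notices n ≥ n₀.
  set table : List (Bool × ℕ) := (List.range n₀).map fun i => (false, dataLength q s ρ i) with ht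
  refine ⟨.comp (.ite .hd (.comp P' (.cons (.comp .tl (.comp .hd .hd)) (.comp .tl .tl)))
    (.comp P (.cons (.const (code (s, ρ))) .tl)))
    (.cons (.comp .hd (.comp (.loop .tl (.cons (.comp .tl .hd) (.comp .tl .tl)))
      (.cons (.const (code table)) .hd))) .id), fun n h => ?_⟩
  have hsize := codeSize_events_le h
  obtain ⟨t₀, ht₀, hwalk⟩ : ∃ t ≤ n * 9 + 20,
      Eval (.cons (.comp .hd (.comp (.loop .tl (.cons (.comp .tl .hd) (.comp .tl .tl)))
        (.cons (.const (code table)) .hd))) .id) (code (n, h)) (code (table.drop n, (n, h))) t := by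
    obtain ⟨t, ht, he⟩ := lookup_eval n table
    exact ⟨_, by omega, .cons (.comp (.comp (.cons (.const _ _) (.hd _)) he) (.hd _)) (.id _)⟩
  simp only [Polynomial.eval_add, Polynomial.eval_comp, Polynomial.eval_mul, Polynomial.eval_X,
    Polynomial.eval_ofNat]
  rcases Nat.lt_or_ge n n₀ with hn | hn
  · obtain ⟨-, t, ht', he⟩ := hP' (dataLength q s ρ n, h)
    have hdrop : table.drop n = (false, dataLength q s ρ n) :: table.drop (n + 1) := by
      rw [List.drop_eq_getElem_cons (by simpa [ht] using hn)]
      simp [ht]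
    rw [hdrop] at hwalk
    have hm := dataLength_le q s ρ n
    have hle := eval_mono T' (show codeSize (dataLength q s ρ n, h) ≤ 7 * (n + h.length) + 3 by
      rw [codeSize_pair, codeSize_nat]; omega)
    simp only at hle
    rw [simulation, if_pos hn]
    exact ⟨_, by omega, .comp hwalk (.iteTrue (.hd _) (by intro h; cases h)
      (.comp (.cons (.comp (.comp (.hd _) (.hd _)) (.tl _)) (.comp (.tl _) (.tl _))) he))⟩
  · obtain ⟨-, t, ht', he⟩ := hP ((s, ρ), (n, h))
    have hdrop : table.drop n = [] := by
      rw [List.drop_eq_nil_iff]; simpa [ht] using hn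
    rw [hdrop] at hwalk
    have hle := eval_mono T (show codeSize ((s, ρ), (n, h)) ≤ 7 * (n + h.length) + 3 by
      simp only [codeSize_pair, codeSize_nat]; omega)
    simp only at hle
    rw [simulation, if_neg (by omega)]
    exact ⟨_, by omega, .comp hwalk (.iteFalse (.hd _) (.comp (.cons (.const _ _) (.tl _)) he))⟩

theorem RunsInTime.mono {C : ℕ → Strategy} {T T' : Polynomial ℕ} (h : RunsInTime C T)
    (hT : ∀ x, T.eval x ≤ T'.eval x) : RunsInTime C T' := by
  obtain ⟨P, hP⟩ := h
  refine ⟨P, fun n h => ?_⟩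
  obtain ⟨t, ht, he⟩ := hP n h
  exact ⟨t, ht.trans (hT _), he⟩

end InsDel

namespace InsDel

/-! ### Parameters -/

theorem scheme_valid {q : ℕ} (S : ℕ → List (Fin q)) {s ρ n : ℕ} (h1 : q + 2 ≤ s)
    (h2 : q + 1 + s < ρ) : (scheme S s ρ n).Valid := by
  refine ⟨h1, h2, fun k => ?_⟩
  have := symbol_le S n k
  simp only [scheme, codeword, List.length_append, List.length_replicate]
  omega

theorem codeword_injective {q σ τ : ℕ} (hσ : σ < q) (hτ : τ < q)
    (h : codeword q σ = codeword q τ) : σ = τ := by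
  have key : ∀ σ < q, (codeword q σ).count true = σ := by
    intro σ _
    simp [codeword, List.count_replicate]
  rw [← key σ hσ, h, key τ hτ]

/-- Codewords determine their symbols, so this is the self-matching property divided by 1 + ε.
Decoding needs a constant below 1, and 2ε/(1 + ε) < 1 holds for ε < 1. -/
theorem separated_of_isSyncFamily {q : ℕ} {S : ℕ → List (Fin q)} {ε : ℝ} (hε : 0 ≤ ε)
    (hS : IsSyncFamily ε S) (s ρ n : ℕ) :
    Separated (scheme S s ρ n) n (2 * ε / (1 + ε)) := by
  intro u K k Q hK hk huK huk hQ hmem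
  have hlen := (hS n).1
  have h := (hS n).2.self_matching hε (by rw [hlen]; exact hK) (by rw [hlen]; exact hk) huK huk hQ
    fun p hp => by
      obtain ⟨h1, h2, h3, h4, h5, h6⟩ := hmem p hp
      refine ⟨h1, h2, h3, h4, h5, ?_⟩
      have e1 : p.1 < (S n).length := by omega
      have e2 : p.2 < (S n).length := by omega
      have h7 : symbol S n p.1 = symbol S n p.2 := by
        refine codeword_injective (q := q) ?_ ?_ h6
        · rw [symbol, List.getElem?_eq_getElem e1]; exact Fin.is_lt _
        · rw [symbol, List.getElem?_eq_getElem e2]; exact Fin.is_lt _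
      rw [List.getElem?_eq_getElem e1, List.getElem?_eq_getElem e2]
      rw [symbol, symbol, List.getElem?_eq_getElem e1, List.getElem?_eq_getElem e2] at h7
      exact congrArg some (Fin.ext h7)
  rw [div_mul_eq_mul_div, le_div_iff₀ (by linarith)]
  linarith

/-- δr is the order of the loss from O(nδ) spoilt blocks of length r. -/
theorem lossRate_eq {δ : ℝ} (hδ : 0 < δ) : lossRate δ = δ * blockLength δ := by
  rw [lossRate, blockLength]
  have : δ * Real.logb 2 (1 / δ) = δ ^ 2 * (1 / δ * Real.logb 2 (1 / δ)) := by
    field_simp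
  rw [this, Real.sqrt_mul (sq_nonneg δ), Real.sqrt_sq hδ.le]

/-- log(1/δ)/r is the order of the loss from the headers, so r balances the two losses. -/
theorem lossRate_mul_blockLength {δ : ℝ} (hδ : 0 < δ) (hL : 0 ≤ Real.logb 2 (1 / δ)) :
    lossRate δ * blockLength δ = Real.logb 2 (1 / δ) := by
  rw [lossRate_eq hδ, blockLength, mul_assoc, Real.mul_self_sqrt (by positivity)]
  field_simp

theorem halfRounds_eq {q s ρ : ℕ} (n : ℕ) (hρ : 0 < ρ) (h : 10 * (q + 1 + s) ≤ ρ) :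
    halfRounds n (10 * (q + 1 + s) / ρ) = dataLength q s ρ n := by
  rw [halfRounds, dataLength, ← Nat.floor_div_eq_div (K := ℝ)]
  congr 1
  have : (ρ : ℝ) ≠ 0 := by positivity
  push_cast [Nat.cast_sub h]
  field_simp

/-- For n < 1/δ there is no edit at all. Otherwise n / ρ bounds the number of edits, and F = n / 2 -
n / ρ leaves room for that many bits that never arrive. In θ₂, the summand 1 accounts for the last,
incomplete block, as nδ ≥ 1, and the factor 8 comes from n ≤ 8m. -/
theorem simulation_simulates {q : ℕ} {S : ℕ → List (Fin q)} {ε : ℝ} (hε : 0 ≤ ε)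
    (hS : IsSyncFamily ε S) {C : ℕ} (hC : 88 ≤ C * (1 - 2 * ε / (1 + ε))) (hC3 : 3 ≤ C)
    {c δ : ℝ} (hδ : 0 < δ) {s ρ n₀ : ℕ} (hs : s = ⌈c * Real.logb 2 (1 / δ)⌉₊)
    (hρ : ρ = ⌈blockLength δ⌉₊) (hn₀ : n₀ = ⌈1 / δ⌉₊) (h1 : q + 2 ≤ s)
    (h2 : 40 * (q + 1 + s) ≤ ρ) (h3 : 2 * δ * ρ ≤ 1) (n : ℕ) :
    SimulatesBlockChannel c δ n (10 * (q + 1 + s) / ρ) (8 * (3 * C + 1) * lossRate δ)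
      (simulation S s ρ n₀ n) := by
  have hr0 : 0 < blockLength δ := by
    rw [← Nat.ceil_pos, ← hρ]; omega
  have hρ0 : (0 : ℝ) < ρ := by exact_mod_cast (by omega : 0 < ρ)
  have hhalf := halfRounds_eq (q := q) (s := s) n (by omega : 0 < ρ) (by omega)
  have hm0 : dataLength q s ρ n * (2 * ρ) ≤ n * (ρ - 10 * (q + 1 + s)) := Nat.div_mul_le_self _ _
  have hm1 : n * (ρ - 10 * (q + 1 + s)) < (dataLength q s ρ n + 1) * (2 * ρ) := by
    rw [Nat.add_mul, Nat.one_mul]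
    exact Nat.lt_div_mul_add (a := n * (ρ - 10 * (q + 1 + s))) (b := 2 * ρ) (by omega)
  unfold SimulatesBlockChannel
  rw [hhalf, ← hs, ← hρ]
  set m := dataLength q s ρ n with hm
  have hloss : 0 ≤ lossRate δ := Real.sqrt_nonneg _
  unfold simulation
  split_ifs with hn
  · rw [hn₀, Nat.lt_ceil, lt_div_iff₀ hδ] at hn
    refine simulates_of_no_edits hn ?_ ⟨?_, ∅, ?_, ?_⟩
    · rw [Nat.le_div_iff_mul_le (by omega)]
      have h4 : m * 2 * ρ ≤ n * ρ := by
        refine le_trans (by rw [mul_assoc]; exact hm0) (Nat.mul_le_mul_left _ (Nat.sub_le _ _))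
      exact Nat.le_of_mul_le_mul_right h4 (by omega)
    · rw [Finset.card_empty]; push_cast; positivity
    · rw [Finset.card_empty]; push_cast; positivity
    · simp
  · rw [not_lt, hn₀, Nat.ceil_le, div_le_iff₀ hδ] at hn
    have hnρ : ρ ≤ n := by
      have : δ * (ρ : ℝ) ≤ δ * n := by linarith
      exact_mod_cast le_of_mul_le_mul_left this hδ
    set h := q + 1 + s with hh
    have hhead : (scheme S s ρ n).head = h := rfl
    have hdata : (scheme S s ρ n).data = ρ - h := rfl
    have hper : (scheme S s ρ n).period = ρ := rfl
    have hcast : n / ρ * ρ ≤ n := Nat.div_mul_le_self _ _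
    have hsim := simulates_of_scheme (c := scheme S s ρ n) (n := n) (m := m) (N := n)
      (F := n / 2 - n / ρ) (δ := δ) (θ := 8 * (3 * C + 1) * lossRate δ) (r := blockLength δ)
      (e := n / ρ) (scheme_valid S h1 (by omega)) hC hC3 (separated_of_isSyncFamily hε hS s ρ n)
      (Nat.div_le_self _ _) ?_ ?_ ?_ ?_ (by rw [hper, hρ]) hr0 ?_ ?_
    · rw [← hρ] at hsim
      exact hsim
    -- Rounding n / ρ down costs less than one, for which 2δρ ≤ 1 and nδ ≥ 1 make up.
    · have h4 : (n : ℝ) < ((n / ρ : ℕ) + 1) * ρ := by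
        exact_mod_cast (by rw [Nat.succ_mul]; exact Nat.lt_div_mul_add (by omega) :
          n < (n / ρ + 1) * ρ)
      have h5 : (n : ℝ) * δ * ρ ≤ (n / ρ : ℕ) * ρ := by
        have h6 : n * (2 * δ * ρ) ≤ n * 1 := mul_le_mul_of_nonneg_left h3 (Nat.cast_nonneg n)
        have h7 : 1 * (ρ : ℝ) ≤ n * δ * ρ := mul_le_mul_of_nonneg_right hn hρ0.le
        linarith
      exact le_of_mul_le_mul_right h5 hρ0
    · have h4 : n / ρ ≤ n / 2 := Nat.div_le_div_left (by omega) (by omega)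
      omega
    -- After multiplication by 2ρ, `dataLength` has set aside 10nh. The d + 1 headers take at most
    -- 4nh; the two reserves of n / ρ bits and the roundings take at most 5n, and h ≥ 3.
    · rw [hhead, hdata]
      set d := m / (ρ - h) with hd
      have h4 : d * (ρ - h) ≤ m := Nat.div_mul_le_self _ _
      have h5 : d * ρ ≤ n := by
        have h6 : d * ρ ≤ d * (2 * (ρ - h)) := Nat.mul_le_mul_left _ (by omega)
        have h7 : 2 * m * ρ ≤ n * ρ := by
          refine le_trans (by rw [mul_comm 2, mul_assoc]; exact hm0)
            (Nat.mul_le_mul_left _ (Nat.sub_le _ _))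
        have h8 := Nat.le_of_mul_le_mul_right h7 (by omega)
        have h9 : d * (2 * (ρ - h)) = 2 * (d * (ρ - h)) := by ring
        omega
      have h6 : 2 * m * ρ + 10 * (n * h) ≤ n * ρ := by
        have : n * (ρ - 10 * h) + n * (10 * h) = n * ρ := by
          rw [← Nat.mul_add]; congr 1; omega
        nlinarith
      have h7 : d * ρ * h ≤ n * h := Nat.mul_le_mul_right _ h5
      have h8 : ρ * h ≤ n * h := Nat.mul_le_mul_right _ hnρ
      have h9 : n * 3 ≤ n * h := Nat.mul_le_mul_left _ (by omega)
      have h10 : (2 * (m + (d + 1) * h + n / ρ + n / ρ) + 1) * ρ < n * ρ := by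
        have : (2 * (m + (d + 1) * h + n / ρ + n / ρ) + 1) * ρ =
          2 * m * ρ + 2 * (d * ρ * h) + 2 * (ρ * h) + 4 * (n / ρ * ρ) + ρ := by ring
        omega
      have h11 := Nat.lt_of_mul_lt_mul_right h10
      omega
    · rw [hdata, hper]; omega
    · rw [hdata]
      have h4 := Nat.ceil_lt_add_one hr0.le
      rw [← hρ] at h4
      have h5 : ((ρ - h : ℕ) : ℝ) ≤ ρ - 1 := by
        rw [Nat.cast_sub (by omega)]
        have : (1 : ℝ) ≤ h := by exact_mod_cast (by omega : 1 ≤ h)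
        linarith
      linarith
    · have h4 : n ≤ 8 * m := by
        have h5 : n * (3 * ρ) ≤ n * (4 * (ρ - 10 * h)) := Nat.mul_le_mul_left _ (by omega)
        have h6 : (3 * n) * ρ < (8 * (m + 1)) * ρ := by nlinarith
        have h7 := Nat.lt_of_mul_lt_mul_right h6
        omega
      have h5 : (n : ℝ) ≤ 8 * m := by exact_mod_cast h4
      rw [lossRate_eq hδ]
      have h6 : ((2 * m : ℕ) : ℝ) * (8 * (3 * C + 1) * (δ * blockLength δ)) / blockLength δ =
          2 * ((3 * C + 1) * (8 * m * δ)) := by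
        push_cast; field_simp
      rw [h6]
      have h7 : (n : ℝ) * δ ≤ 8 * m * δ := mul_le_mul_of_nonneg_right h5 hδ.le
      have h8 : (3 * (C : ℝ) + 1) * (n * δ) ≤ (3 * C + 1) * (8 * m * δ) :=
        mul_le_mul_of_nonneg_left h7 (by positivity)
      linarith

end InsDel

/-! ### Asymptotics of the parameters as δ → 0. -/

namespace InsDel

theorem tendsto_logb_inv : Tendsto (fun δ : ℝ => Real.logb 2 (1 / δ)) (𝓝[>] 0) atTop := by
  simp only [one_div]
  exact (Real.tendsto_logb_atTop (by norm_num)).comp tendsto_inv_nhdsGT_zero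

theorem tendsto_lossRate : Tendsto lossRate (𝓝[>] 0) (𝓝 0) := by
  have h1 : Tendsto (fun δ : ℝ => δ * Real.logb 2 (1 / δ)) (𝓝[>] 0) (𝓝 0) := by
    have h2 : (fun δ : ℝ => δ * Real.logb 2 (1 / δ)) =
        fun δ => -(δ * Real.log δ) / Real.log 2 := by
      funext δ
      rw [Real.logb, one_div, Real.log_inv]; ring
    rw [h2]
    have h3 : Tendsto (fun δ : ℝ => δ * Real.log δ) (𝓝[>] 0) (𝓝 (0 * Real.log 0)) :=
      (Real.continuous_mul_log.tendsto 0).mono_left nhdsWithin_le_nhds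
    simpa using (h3.neg).div_const (Real.log 2)
  have := (Real.continuous_sqrt.tendsto 0).comp h1
  rwa [Real.sqrt_zero] at this

/-- For small `δ` the parameters fit. -/
theorem eventually_parameters {c : ℝ} (hc : 0 < c) (q : ℕ) :
    ∀ᶠ δ in 𝓝[>] (0 : ℝ), 0 < δ ∧ 0 < lossRate δ ∧
      q + 2 ≤ ⌈c * Real.logb 2 (1 / δ)⌉₊ ∧
      40 * (q + 1 + ⌈c * Real.logb 2 (1 / δ)⌉₊) ≤ ⌈blockLength δ⌉₊ ∧
      2 * δ * ⌈blockLength δ⌉₊ ≤ 1 ∧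
      10 * (q + 1 + (⌈c * Real.logb 2 (1 / δ)⌉₊ : ℝ)) / ⌈blockLength δ⌉₊ ≤
        10 * (q + 2 + c) * lossRate δ ∧
      5 * c * lossRate δ ≤
        10 * (q + 1 + (⌈c * Real.logb 2 (1 / δ)⌉₊ : ℝ)) / ⌈blockLength δ⌉₊ := by
  have hq : (0 : ℝ) < q + 2 + c := by positivity
  -- log(1/δ) ≥ (q + 2)/c gives s ≥ q + 2. A loss rate below 1/(40(q + 2 + c)) keeps headers within
  -- a fortieth of a block. Loss rate and δ below 1/4 give r ≥ 1 and, in spite of the rounding of r,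
  -- 2δ(r + 1) ≤ 1.
  filter_upwards [self_mem_nhdsWithin, tendsto_logb_inv.eventually_ge_atTop (max 1 ((q + 2) / c)),
    tendsto_lossRate.eventually_lt_const (show (0 : ℝ) < 1 / 4 by norm_num),
    tendsto_lossRate.eventually_lt_const (show (0 : ℝ) < 1 / (40 * (q + 2 + c)) by positivity),
    (tendsto_id.mono_left nhdsWithin_le_nhds : Tendsto id (𝓝[>] (0 : ℝ)) (𝓝 0)).eventually_lt_const
      (show (0 : ℝ) < 1 / 4 by norm_num)] with δ hδ hL h1 h2 h3
  rw [Set.mem_Ioi] at hδ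
  simp only [_root_.id] at h3
  have hL1 := (le_max_left _ _).trans hL
  have hL2 := (le_max_right _ _).trans hL
  rw [div_le_iff₀ hc] at hL2
  have hprod := lossRate_mul_blockLength hδ (by linarith)
  have hloss := lossRate_eq hδ
  set L := Real.logb 2 (1 / δ)
  set r := blockLength δ
  set x := lossRate δ
  have hx0 : 0 < x := by
    have : 0 ≤ x := Real.sqrt_nonneg _
    refine this.lt_of_ne fun h => ?_
    rw [← h, zero_mul] at hprod
    linarith
  have hr0 : 0 < r := by
    by_contra h
    have := mul_nonpos_of_nonneg_of_nonpos hx0.le (not_lt.1 h)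
    linarith
  have hr1 : 1 ≤ r := by
    by_contra h
    have : x * r ≤ 1 / 4 * 1 := mul_le_mul h1.le (not_le.1 h).le hr0.le (by norm_num)
    linarith
  have hs1 := Nat.le_ceil (c * L)
  have hs2 := (Nat.ceil_lt_add_one (show 0 ≤ c * L by positivity)).le
  have hρ1 := Nat.le_ceil r
  have hρ2 := (Nat.ceil_lt_add_one hr0.le).le
  set s := ⌈c * L⌉₊
  set ρ := ⌈r⌉₊
  have hρ0 : (0 : ℝ) < ρ := hr0.trans_le hρ1
  have hh : (q : ℝ) + 1 + s ≤ (q + 2 + c) * L := by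
    have : ((q : ℝ) + 2) * 1 ≤ (q + 2) * L := mul_le_mul_of_nonneg_left hL1 (by positivity)
    linarith
  have hh' : (q : ℝ) + 1 + s ≤ (q + 2 + c) * x * ρ := by
    refine hh.trans ?_
    rw [← hprod, ← mul_assoc]
    exact mul_le_mul_of_nonneg_left hρ1 (by positivity)
  refine ⟨hδ, hx0, ?_, ?_, ?_, ?_, ?_⟩
  · have : (q : ℝ) + 2 ≤ s := by linarith
    exact_mod_cast this
  · have h4 : 40 * (q + 2 + c) * x ≤ 1 := by
      rw [lt_div_iff₀ (by positivity)] at h2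
      linarith
    have h5 : 40 * (q + 2 + c) * x * ρ ≤ 1 * ρ := mul_le_mul_of_nonneg_right h4 hρ0.le
    have : 40 * ((q : ℝ) + 1 + s) ≤ ρ := by linarith
    exact_mod_cast this
  · have : 2 * δ * ρ ≤ 2 * δ * (r + 1) := mul_le_mul_of_nonneg_left hρ2 (by positivity)
    linarith
  · rw [div_le_iff₀ hρ0]
    linarith
  · rw [le_div_iff₀ hρ0]
    have h4 : 5 * c * x * ρ ≤ 5 * c * x * (2 * r) :=
      mul_le_mul_of_nonneg_left (by linarith) (by positivity)
    have h5 : 5 * c * x * (2 * r) = 10 * (c * L) := by rw [← hprod]; ring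
    have : (0 : ℝ) ≤ q := Nat.cast_nonneg q
    linarith

/-- The simulation for a given family of synchronization strings. -/
theorem exists_simulation {c : ℝ} (hc : 0 < c) {q : ℕ} {S : ℕ → List (Fin q)} {ε : ℝ}
    (hε : 0 < ε) (hε1 : ε < 1) (hS : IsSyncFamily ε S) :
    ∃ θ₁ θ₂ : ℝ → ℝ, θ₁ =Θ[𝓝[>] 0] lossRate ∧ θ₂ =Θ[𝓝[>] 0] lossRate ∧
      ∀ᶠ δ in 𝓝[>] (0 : ℝ), ∃ s ρ n₀ : ℕ, s ≤ n₀ ∧ ρ ≤ n₀ ∧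
        ∀ n, SimulatesBlockChannel c δ n (θ₁ δ) (θ₂ δ) (simulation S s ρ n₀ n) := by
  have hε' : 0 < 1 - 2 * ε / (1 + ε) := by
    rw [sub_pos, div_lt_one (by linarith)]
    linarith
  -- C is determined by `Ghost.Inv.best_of_good`, with the separation constant 2ε/(1 + ε) in place
  -- of ε, and by `Ghost.Good.eq_zero`. It depends on ε only, not on δ.
  obtain ⟨C, hC⟩ := exists_nat_ge (max 3 (88 / (1 - 2 * ε / (1 + ε))))
  have hC3 : 3 ≤ C := by exact_mod_cast (le_max_left _ _).trans hC
  have hC88 := (le_max_right _ _).trans hC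
  rw [div_le_iff₀ hε'] at hC88
  refine ⟨fun δ => 10 * (q + 1 + (⌈c * Real.logb 2 (1 / δ)⌉₊ : ℝ)) / ⌈blockLength δ⌉₊,
    fun δ => 8 * (3 * C + 1) * lossRate δ, ⟨?_, ?_⟩, ?_, ?_⟩
  · refine IsBigO.of_bound (10 * (q + 2 + c)) ?_
    filter_upwards [eventually_parameters hc q] with δ h
    rw [Real.norm_of_nonneg (by positivity), Real.norm_of_nonneg h.2.1.le]
    exact h.2.2.2.2.2.1
  · refine IsBigO.of_bound (1 / (5 * c)) ?_
    filter_upwards [eventually_parameters hc q] with δ h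
    rw [Real.norm_of_nonneg h.2.1.le, Real.norm_of_nonneg (by positivity), one_div,
      ← div_eq_inv_mul, le_div_iff₀ (by positivity), mul_comm]
    exact h.2.2.2.2.2.2
  · exact (isTheta_refl lossRate _).const_mul_left (by positivity)
  · filter_upwards [eventually_parameters hc q] with δ h
    obtain ⟨hδ, -, h1, h2, h3, -, -⟩ := h
    have hρ : ⌈blockLength δ⌉₊ ≤ ⌈1 / δ⌉₊ := by
      rw [← Nat.cast_le (α := ℝ)]
      refine le_trans ?_ (Nat.le_ceil _)
      rw [le_div_iff₀ hδ]
      have : (0 : ℝ) ≤ δ * ⌈blockLength δ⌉₊ := by positivity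
      linarith
    exact ⟨_, _, _, by omega, hρ, simulation_simulates hε.le hS hC88 hC3 hδ rfl rfl rfl h1 h2 h3⟩

/-- The simulation is efficient for an efficient family of synchronization strings. -/
theorem exists_efficient_simulation {c : ℝ} (hc : 0 < c) {q : ℕ} {S : ℕ → List (Fin q)} {ε : ℝ}
    (hε : 0 < ε) (hε1 : ε < 1) (hS : IsSyncFamily ε S) (heff : IsEfficientFamily S) :
    ∃ (θ₁ θ₂ : ℝ → ℝ) (T : Polynomial ℕ), θ₁ =Θ[𝓝[>] 0] lossRate ∧ θ₂ =Θ[𝓝[>] 0] lossRate ∧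
      ∀ᶠ δ in 𝓝[>] (0 : ℝ), ∃ C : Side → ℕ → Strategy,
        (∀ n : ℕ, SimulatesBlockChannel c δ n (θ₁ δ) (θ₂ δ) (fun p => C p n)) ∧
          ∀ p, RunsInTime (C p) T := by
  obtain ⟨θ₁, θ₂, h₁, h₂, h⟩ := exists_simulation hc hε hε1 hS
  choose T hT using exists_runsInTime heff fun N => (hS N).1
  refine ⟨θ₁, θ₂, T .A + T .B, h₁, h₂, h.mono fun δ hδ => ?_⟩
  obtain ⟨s, ρ, n₀, hs, hρ, hsim⟩ := hδ
  refine ⟨fun p n => simulation S s ρ n₀ n p, hsim, fun p => ?_⟩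
  refine (hT p s ρ n₀ hs hρ).mono fun x => ?_
  rw [Polynomial.eval_add]
  cases p <;> omega

end InsDel

namespace InsDel

/-! ### Existence of synchronization strings -/

theorem card_biUnion_mul_le {ι β : Type*} [DecidableEq β] {s : Finset ι} {f : ι → Finset β}
    {k n : ℕ} (h : ∀ i ∈ s, (f i).card * k ≤ n) : (s.biUnion f).card * k ≤ s.card * n := by
  calc (s.biUnion f).card * k ≤ (∑ i ∈ s, (f i).card) * k :=
        Nat.mul_le_mul_right _ Finset.card_biUnion_le
    _ = ∑ i ∈ s, (f i).card * k := Finset.sum_mul _ _ _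
    _ ≤ s.card * n := by simpa using Finset.sum_le_card_nsmul _ _ _ h

section
variable {q : ℕ}

/-- The lists that arise by prepending an arbitrary symbol. -/
def prepend (X : Finset (List (Fin q))) : Finset (List (Fin q)) :=
  (Finset.univ ×ˢ X).image fun p => p.1 :: p.2

theorem mem_prepend {X : Finset (List (Fin q))} {l : List (Fin q)} :
    l ∈ prepend X ↔ ∃ a x, x ∈ X ∧ l = a :: x := by
  simp only [prepend, Finset.mem_image, Finset.mem_product, Finset.mem_univ, true_and, Prod.exists]
  exact ⟨fun ⟨a, x, h, h'⟩ => ⟨a, x, h, h'.symm⟩, fun ⟨a, x, h, h'⟩ => ⟨a, x, h, h'.symm⟩⟩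

theorem card_prepend (X : Finset (List (Fin q))) : (prepend X).card = q * X.card := by
  rw [prepend, Finset.card_image_of_injective, Finset.card_product, Finset.card_univ,
    Fintype.card_fin]
  rintro ⟨a, x⟩ ⟨b, y⟩ h
  simpa using h

/-- The words of length `n` that have `w` as a subsequence. -/
def superwords : ℕ → List (Fin q) → Finset (List (Fin q))
  | 0, [] => {[]}
  | 0, _ :: _ => ∅
  | n + 1, [] => prepend (superwords n [])
  | n + 1, a :: w => prepend (superwords n (a :: w)) ∪ (superwords n w).image (a :: ·)

theorem mem_superwords {w l : List (Fin q)} (h : w.Sublist l) : l ∈ superwords l.length w := by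
  induction l generalizing w with
  | nil => rw [List.sublist_nil.1 h]; simp [superwords]
  | cons b l ih =>
    rcases w with _ | ⟨a, w⟩
    · rw [List.length_cons, superwords, mem_prepend]
      exact ⟨b, l, ih (List.nil_sublist _), rfl⟩
    · rw [List.length_cons, superwords, Finset.mem_union, mem_prepend, Finset.mem_image]
      cases h with
      | cons _ h => exact Or.inl ⟨b, l, ih h, rfl⟩
      | cons_cons _ h => exact Or.inr ⟨l, ih h, rfl⟩

theorem length_of_mem_superwords {n : ℕ} {w l : List (Fin q)} (h : l ∈ superwords n w) :
    l.length = n := by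
  induction n generalizing w l with
  | zero =>
    rcases w with _ | ⟨a, w⟩
    · simpa [superwords] using h
    · simp [superwords] at h
  | succ n ih =>
    rcases w with _ | ⟨a, w⟩
    · rw [superwords, mem_prepend] at h
      obtain ⟨a, x, hx, rfl⟩ := h
      rw [List.length_cons, ih hx]
    · rw [superwords, Finset.mem_union, mem_prepend, Finset.mem_image] at h
      rcases h with ⟨a, x, hx, rfl⟩ | ⟨x, hx, rfl⟩ <;> rw [List.length_cons, ih hx]

/-- Each letter is either free or equals the next letter of w, so there are at most 2^n·q^(n - |w|)
superwords; the product form avoids the subtraction. -/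
theorem card_superwords (n : ℕ) (w : List (Fin q)) :
    (superwords n w).card * q ^ w.length ≤ (2 * q) ^ n := by
  induction n generalizing w with
  | zero => rcases w with _ | ⟨a, w⟩ <;> simp [superwords]
  | succ n ih =>
    rcases w with _ | ⟨a, w⟩
    · have h := ih []
      rw [superwords, card_prepend, pow_succ]
      simp only [List.length_nil, pow_zero, mul_one] at h ⊢
      calc q * (superwords n []).card ≤ q * (2 * q) ^ n := Nat.mul_le_mul_left _ h
        _ ≤ (2 * q) ^ n * (2 * q) := by
          rw [mul_comm]; exact Nat.mul_le_mul_left _ (by omega)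
    · have h1 := ih (a :: w)
      have h2 := ih w
      rw [superwords]
      have h3 := Finset.card_union_le (prepend (superwords n (a :: w)))
        ((superwords n w).image (a :: ·))
      rw [card_prepend] at h3
      have h4 := (Nat.mul_le_mul_right (q ^ (a :: w).length)
        (h3.trans (Nat.add_le_add_left Finset.card_image_le _)))
      refine h4.trans ?_
      have h5 : q ^ (a :: w).length = q ^ w.length * q := by rw [List.length_cons, pow_succ]
      calc (q * (superwords n (a :: w)).card + (superwords n w).card) * q ^ (a :: w).length
          = q * ((superwords n (a :: w)).card * q ^ (a :: w).length) +
            q * ((superwords n w).card * q ^ w.length) := by rw [h5]; ring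
        _ ≤ q * (2 * q) ^ n + q * (2 * q) ^ n :=
            Nat.add_le_add (Nat.mul_le_mul_left _ h1) (Nat.mul_le_mul_left _ h2)
        _ = (2 * q) ^ (n + 1) := by ring

/-- Words of length `L` that consist of two parts with a long common subsequence. -/
def repetitive (L : ℕ) : Finset (List (Fin q)) :=
  (Finset.range (L + 1)).biUnion fun i => (superwords (L - i) []).biUnion fun b =>
    (b.sublists.toFinset.filter fun w => L ≤ 4 * w.length).biUnion fun w =>
      (superwords i w).image (· ++ b)

theorem mem_repetitive {a b w : List (Fin q)} (ha : w.Sublist a) (hb : w.Sublist b)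
    (hw : a.length + b.length ≤ 4 * w.length) : a ++ b ∈ repetitive (a.length + b.length) := by
  simp only [repetitive, Finset.mem_biUnion, Finset.mem_range, Finset.mem_filter, List.mem_toFinset,
    List.mem_sublists, Finset.mem_image]
  refine ⟨a.length, by omega, b, ?_, w, ⟨hb, hw⟩, a, mem_superwords ha, rfl⟩
  rw [Nat.add_sub_cancel_left]
  exact mem_superwords (List.nil_sublist _)

/-- Union bound over the cut (L + 1 ≤ 2^L choices), the second part b, its at most 2^|b|
subsequences w, and the superwords of w as first part. Prescribing w saves a factor q^|w| ≥ Q^L,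
because |w| ≥ L/4 and q = Q^4. -/
theorem card_repetitive {Q : ℕ} (hQ : q = Q ^ 4) (hQ0 : 0 < Q) (L : ℕ) :
    (repetitive (q := q) L).card * Q ^ L ≤ (8 * q) ^ L := by
  have hpow : ∀ ℓ, L ≤ 4 * ℓ → Q ^ L ≤ q ^ ℓ := by
    intro ℓ hℓ
    rw [hQ, ← pow_mul]
    exact Nat.pow_le_pow_right hQ0 hℓ
  have h1 : ∀ i ∈ Finset.range (L + 1), ((superwords (q := q) (L - i) []).biUnion fun b =>
      (b.sublists.toFinset.filter fun w => L ≤ 4 * w.length).biUnion fun w =>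
        (superwords i w).image (· ++ b)).card * Q ^ L ≤ (4 * q) ^ L := by
    intro i hi
    rw [Finset.mem_range] at hi
    have h2 : ∀ b ∈ superwords (q := q) (L - i) [],
        ((b.sublists.toFinset.filter fun w => L ≤ 4 * w.length).biUnion fun w =>
          (superwords i w).image (· ++ b)).card * Q ^ L ≤ 2 ^ (L - i) * (2 * q) ^ i := by
      intro b hb
      refine (card_biUnion_mul_le (n := (2 * q) ^ i) fun w hw => ?_).trans
        (Nat.mul_le_mul_right _ ?_)
      · rw [Finset.mem_filter] at hw
        exact le_trans (Nat.mul_le_mul Finset.card_image_le (hpow _ hw.2)) (card_superwords i w)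
      · refine (Finset.card_filter_le _ _).trans ((List.toFinset_card_le _).trans ?_)
        rw [List.length_sublists, length_of_mem_superwords hb]
    refine (card_biUnion_mul_le h2).trans ?_
    have h3 := card_superwords (q := q) (L - i) []
    rw [List.length_nil, pow_zero, mul_one] at h3
    have h4 : (2 * q) ^ i ≤ (4 * q) ^ i := Nat.pow_le_pow_left (by omega) i
    calc (superwords (q := q) (L - i) []).card * (2 ^ (L - i) * (2 * q) ^ i)
        ≤ (2 * q) ^ (L - i) * (2 ^ (L - i) * (4 * q) ^ i) :=
          Nat.mul_le_mul h3 (Nat.mul_le_mul_left _ h4)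
      _ = (4 * q) ^ (L - i) * (4 * q) ^ i := by
          rw [← mul_assoc, ← mul_pow]; congr 2; ring
      _ = (4 * q) ^ L := by rw [← pow_add]; congr 1; omega
  refine (card_biUnion_mul_le h1).trans ?_
  rw [Finset.card_range]
  calc (L + 1) * (4 * q) ^ L ≤ 2 ^ L * (4 * q) ^ L := Nat.mul_le_mul_right _ Nat.lt_two_pow_self
    _ = (8 * q) ^ L := by rw [← mul_pow]; congr 1; ring

/-- No two adjacent factors at the beginning of `x` have a long common subsequence. -/
def NonRepetitive (x : List (Fin q)) : Prop :=
  ∀ a b c w : List (Fin q), x = a ++ b ++ c → w.Sublist a → w.Sublist b → a ≠ [] →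
    4 * w.length < a.length + b.length

open Classical in
/-- The words of length `N` all of whose suffixes are nonrepetitive. -/
noncomputable def goodWords (q : ℕ) : ℕ → Finset (List (Fin q))
  | 0 => {[]}
  | N + 1 => (prepend (goodWords q N)).filter NonRepetitive

theorem mem_goodWords_succ {N : ℕ} {x : List (Fin q)} :
    x ∈ goodWords q (N + 1) ↔ x ∈ prepend (goodWords q N) ∧ NonRepetitive x := by
  classical
  simp only [goodWords, Finset.mem_filter]

theorem goodWords_length {N : ℕ} {x : List (Fin q)} (h : x ∈ goodWords q N) : x.length = N := by
  induction N generalizing x with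
  | zero => simp [goodWords] at h; simp [h]
  | succ N ih =>
    rw [mem_goodWords_succ, mem_prepend] at h
    obtain ⟨⟨a, y, hy, rfl⟩, -⟩ := h
    rw [List.length_cons, ih hy]

theorem drop_mem_goodWords {N : ℕ} {x : List (Fin q)} (h : x ∈ goodWords q N) (i : ℕ) :
    x.drop i ∈ goodWords q (N - i) := by
  induction N generalizing x i with
  | zero => simp [goodWords] at h; simp [h, goodWords]
  | succ N ih =>
    rcases i with _ | i
    · exact h
    · rw [mem_goodWords_succ, mem_prepend] at h
      obtain ⟨⟨a, y, hy, rfl⟩, -⟩ := h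
      rw [Nat.add_sub_add_right]
      exact ih hy i

theorem nonRepetitive_of_mem_goodWords {N : ℕ} {x : List (Fin q)} (h : x ∈ goodWords q N) :
    NonRepetitive x := by
  rcases N with _ | N
  · simp only [goodWords, Finset.mem_singleton] at h
    subst h
    intro a b c w h _ _ ha
    simp at h
    exact absurd h.1 ha
  · exact (mem_goodWords_succ.1 h).2

/-- If prepending a letter spoils a good word, the result is a repetitive word of length L followed
by a good word of length N + 1 - L. With g good words of length N, the induction hypothesis leaves
at most g/(q/2)^(L-1) such tails, and there are at most (q/8)^L repetitive words since Q ≥ 64.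
Summing (q/2)·4^(-L)·g over L ≥ 1 spoils at most half of the q·g extensions. -/
theorem card_goodWords {Q : ℕ} (hQ : q = Q ^ 4) (hQ64 : 64 ≤ Q) (N : ℕ) :
    (q : ℝ) / 2 * (goodWords q N).card ≤ (goodWords q (N + 1)).card := by
  classical
  have hq0 : 0 < q := by rw [hQ]; positivity
  have hq : (0 : ℝ) < q := by exact_mod_cast hq0
  induction N using Nat.strong_induction_on with
  | _ N ih =>
    have hmono : ∀ L, 1 ≤ L → L ≤ N + 1 → ((goodWords q (N + 1 - L)).card : ℝ) *
        (q / 2) ^ (L - 1) ≤ (goodWords q N).card := by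
      intro L hL
      induction L, hL using Nat.le_induction with
      | base => intro _; simp
      | succ L hL ihL =>
        intro hLN
        refine le_trans ?_ (ihL (by omega))
        have h1 := ih (N + 1 - (L + 1)) (by omega)
        rw [show N + 1 - (L + 1) + 1 = N + 1 - L by omega] at h1
        have h2 : (q / 2 : ℝ) ^ (L + 1 - 1) = q / 2 * (q / 2) ^ (L - 1) := by
          rw [← pow_succ']; congr 1; omega
        rw [h2, ← mul_assoc, mul_comm _ ((q : ℝ) / 2)]
        exact mul_le_mul_of_nonneg_right h1 (by positivity)
    have hbad : (prepend (goodWords q N)).filter (fun x => ¬ NonRepetitive x) ⊆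
        (Finset.Icc 1 (N + 1)).biUnion fun L =>
          (repetitive L ×ˢ goodWords q (N + 1 - L)).image fun p => p.1 ++ p.2 := by
      intro x hx
      rw [Finset.mem_filter, mem_prepend] at hx
      obtain ⟨⟨σ, y, hy, rfl⟩, hx⟩ := hx
      unfold NonRepetitive at hx
      push Not at hx
      obtain ⟨a, b, c, w, heq, hwa, hwb, ha, hw⟩ := hx
      have hlen : N + 1 = a.length + b.length + c.length := by
        rw [← goodWords_length hy, ← List.length_cons (a := σ), heq]; simp; omega
      have ha0 : 0 < a.length := List.length_pos_of_ne_nil ha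
      rw [Finset.mem_biUnion]
      refine ⟨a.length + b.length, by rw [Finset.mem_Icc]; omega, ?_⟩
      rw [Finset.mem_image]
      refine ⟨(a ++ b, c), Finset.mem_product.2 ⟨mem_repetitive hwa hwb hw, ?_⟩, heq.symm⟩
      have h1 := drop_mem_goodWords hy (a.length + b.length - 1)
      have h2 : y.drop (a.length + b.length - 1) = c := by
        have : (σ :: y).drop (a.length + b.length) = c := by
          rw [heq, ← List.length_append, List.drop_left]
        rw [← this]
        conv_rhs => rw [show a.length + b.length = a.length + b.length - 1 + 1 by omega]
        rfl
      rw [h2] at h1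
      rwa [show N + 1 - (a.length + b.length) = N - (a.length + b.length - 1) by omega]
    have hrep : ∀ L, 1 ≤ L → L ≤ N + 1 → ((repetitive (q := q) L).card : ℝ) *
        (goodWords q (N + 1 - L)).card ≤ q / 2 * (1 / 4) ^ L * (goodWords q N).card := by
      intro L hL hLN
      have h1 : ((repetitive (q := q) L).card : ℝ) * 64 ^ L ≤ (8 * q) ^ L := by
        have h2 : (repetitive (q := q) L).card * 64 ^ L ≤ (8 * q) ^ L :=
          (Nat.mul_le_mul_left _ (Nat.pow_le_pow_left hQ64 L)).trans
            (card_repetitive hQ (by omega) L)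
        exact_mod_cast h2
      have h2 : ((repetitive (q := q) L).card : ℝ) ≤ (q / 8) ^ L := by
        have h3 : (8 * q : ℝ) ^ L = (q / 8) ^ L * 64 ^ L := by rw [← mul_pow]; congr 1; ring
        rw [h3] at h1
        exact le_of_mul_le_mul_right h1 (by positivity)
      have h4 : (q / 8 : ℝ) ^ L = q / 2 * (1 / 4) ^ L * (q / 2) ^ (L - 1) := by
        have : (q / 2 : ℝ) ^ L = q / 2 * (q / 2) ^ (L - 1) := by
          rw [← pow_succ']; congr 1; omega
        rw [mul_right_comm, ← this, ← mul_pow]; congr 1; ring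
      calc ((repetitive (q := q) L).card : ℝ) * (goodWords q (N + 1 - L)).card
          ≤ (q / 8) ^ L * (goodWords q (N + 1 - L)).card :=
            mul_le_mul_of_nonneg_right h2 (Nat.cast_nonneg _)
        _ = q / 2 * (1 / 4) ^ L * ((goodWords q (N + 1 - L)).card * (q / 2) ^ (L - 1)) := by
            rw [h4]; ring
        _ ≤ _ := mul_le_mul_of_nonneg_left (hmono L hL hLN) (by positivity)
    have hsum : ∀ M : ℕ, ∑ L ∈ Finset.Icc 1 M, (1 / 4 : ℝ) ^ L ≤ 1 := by
      intro M
      have : ∑ L ∈ Finset.Icc 1 M, (1 / 4 : ℝ) ^ L ≤ 1 - (1 / 4) ^ M := by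
        induction M with
        | zero => simp
        | succ M ihM =>
          rw [← Finset.insert_Icc_right_eq_Icc_add_one (by omega), Finset.sum_insert (by simp),
            pow_succ]
          have : (0 : ℝ) ≤ (1 / 4) ^ M := by positivity
          linarith
      have : (0 : ℝ) ≤ (1 / 4) ^ M := by positivity
      linarith
    have hcard : (((prepend (goodWords q N)).filter fun x => ¬ NonRepetitive x).card : ℝ) ≤
        q / 2 * (goodWords q N).card := by
      have h1 : ((prepend (goodWords q N)).filter fun x => ¬ NonRepetitive x).card ≤
          ∑ L ∈ Finset.Icc 1 (N + 1),
            (repetitive (q := q) L).card * (goodWords q (N + 1 - L)).card := by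
        refine (Finset.card_le_card hbad).trans (Finset.card_biUnion_le.trans ?_)
        refine Finset.sum_le_sum fun L _ => Finset.card_image_le.trans ?_
        rw [Finset.card_product]
      have h2 : (((prepend (goodWords q N)).filter fun x => ¬ NonRepetitive x).card : ℝ) ≤
          ∑ L ∈ Finset.Icc 1 (N + 1),
            ((repetitive (q := q) L).card : ℝ) * (goodWords q (N + 1 - L)).card := by
        exact_mod_cast h1
      refine h2.trans ?_
      calc ∑ L ∈ Finset.Icc 1 (N + 1),
            ((repetitive (q := q) L).card : ℝ) * (goodWords q (N + 1 - L)).card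
          ≤ ∑ L ∈ Finset.Icc 1 (N + 1), (q : ℝ) / 2 * (1 / 4) ^ L * (goodWords q N).card := by
            refine Finset.sum_le_sum fun L hL => ?_
            rw [Finset.mem_Icc] at hL
            exact hrep L hL.1 hL.2
        _ = q / 2 * (goodWords q N).card * ∑ L ∈ Finset.Icc 1 (N + 1), (1 / 4 : ℝ) ^ L := by
            rw [Finset.mul_sum]
            exact Finset.sum_congr rfl fun L _ => by ring
        _ ≤ q / 2 * (goodWords q N).card * 1 :=
            mul_le_mul_of_nonneg_left (hsum _) (by positivity)
        _ = _ := mul_one _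
    have htotal := Finset.card_filter_add_card_filter_not (s := prepend (goodWords q N)) NonRepetitive
    rw [card_prepend] at htotal
    have htotal' : (((prepend (goodWords q N)).filter NonRepetitive).card : ℝ) +
        ((prepend (goodWords q N)).filter fun x => ¬ NonRepetitive x).card =
          q * (goodWords q N).card := by exact_mod_cast htotal
    have hgoal : (goodWords q (N + 1)).card =
        ((prepend (goodWords q N)).filter NonRepetitive).card := by
      rw [goodWords]
    rw [hgoal]
    linarith

/-- The edit distance of adjacent factors u and v is |u| + |v| - 2|w| for some common subsequence w,
and 4|w| < |u| + |v| puts it above half of |u| + |v|. -/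
theorem isSyncString_of_mem_goodWords {N : ℕ} {x : List (Fin q)} (h : x ∈ goodWords q N) :
    IsSyncString (1 / 2) x := by
  intro i j k hij hjk hk
  have hnr := nonRepetitive_of_mem_goodWords (drop_mem_goodWords h i)
  set u := (x.drop i).take (j - i) with hu
  set v := (x.drop j).take (k - j) with hv
  have hul : u.length = j - i := by rw [hu, List.length_take, List.length_drop]; omega
  have hvl : v.length = k - j := by rw [hv, List.length_take, List.length_drop]; omega
  have hx : x.drop i = u ++ v ++ x.drop k := by
    have h1 : x.drop k = (x.drop j).drop (k - j) := by rw [List.drop_drop]; congr 1; omega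
    have h2 : x.drop j = (x.drop i).drop (j - i) := by rw [List.drop_drop]; congr 1; omega
    rw [List.append_assoc, h1, List.take_append_drop]
    conv_rhs => rw [h2]
    rw [List.take_append_drop]
  obtain ⟨w, hwu, hwv, hd⟩ := Nat.sInf_mem (s := {d | ∃ w : List (Fin q), w.Sublist u ∧
    w.Sublist v ∧ d = (u.length - w.length) + (v.length - w.length)})
    ⟨_, [], List.nil_sublist _, List.nil_sublist _, rfl⟩
  change editDist u v = _ at hd
  have h1 := hnr u v _ w hx hwu hwv (by intro h0; rw [h0] at hul; simp at hul; omega)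
  have h2 := hwu.length_le
  have h3 := hwv.length_le
  have h4 : k - i < 2 * editDist u v := by omega
  have h5 : (((k - i : ℕ) : ℝ)) < 2 * editDist u v := by exact_mod_cast h4
  rw [Nat.cast_sub (by omega)] at h5
  linarith

end

theorem exists_isSyncFamily : ∃ (q : ℕ) (S : ℕ → List (Fin q)), IsSyncFamily (1 / 2) S := by
  -- 64 is the least fourth root that `card_goodWords` admits. The power is kept behind an equation
  -- so that it is not evaluated.
  obtain ⟨q, hq⟩ : ∃ q : ℕ, q = 64 ^ 4 := ⟨_, rfl⟩
  have hpos : ∀ N, (goodWords q N).Nonempty := by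
    intro N
    induction N with
    | zero => exact ⟨[], by simp [goodWords]⟩
    | succ N ih =>
      have h1 := card_goodWords hq le_rfl N
      have h2 : (0 : ℝ) < q := by rw [hq]; norm_num
      have h3 : (0 : ℝ) < (goodWords q N).card := by exact_mod_cast ih.card_pos
      have h4 : (0 : ℝ) < (goodWords q (N + 1)).card := lt_of_lt_of_le (by positivity) h1
      exact Finset.card_pos.1 (by exact_mod_cast h4)
  choose S hS using hpos
  exact ⟨q, S, fun N => ⟨goodWords_length (hS N), isSyncString_of_mem_goodWords (hS N)⟩⟩

end InsDel

/-! ### The theorem. -/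

theorem mainTheorem1 (c : ℝ) (hc : 0 < c) :
    (∃ θ₁ θ₂ : ℝ → ℝ,
      θ₁ =Θ[𝓝[>] 0] InsDel.lossRate ∧ θ₂ =Θ[𝓝[>] 0] InsDel.lossRate ∧
      ∀ᶠ δ in 𝓝[>] (0 : ℝ), ∀ n : ℕ, ∃ C : InsDel.Side → InsDel.Strategy,
        InsDel.SimulatesBlockChannel c δ n (θ₁ δ) (θ₂ δ) C) ∧
    (∀ (ε : ℝ) (q : ℕ) (S : ℕ → List (Fin q)), 0 < ε → ε < 1 →
      InsDel.IsSyncFamily ε S → InsDel.IsEfficientFamily S →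
      ∃ (θ₁ θ₂ : ℝ → ℝ) (T : Polynomial ℕ),
        θ₁ =Θ[𝓝[>] 0] InsDel.lossRate ∧ θ₂ =Θ[𝓝[>] 0] InsDel.lossRate ∧
        ∀ᶠ δ in 𝓝[>] (0 : ℝ), ∃ C : InsDel.Side → ℕ → InsDel.Strategy,
          (∀ n : ℕ, InsDel.SimulatesBlockChannel c δ n (θ₁ δ) (θ₂ δ) (fun p => C p n)) ∧
          ∀ p, InsDel.RunsInTime (C p) T) := by
  refine ⟨?_, fun ε q S hε hε1 hS heff => InsDel.exists_efficient_simulation hc hε hε1 hS heff⟩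
  -- The first claim asks for no program, so any synchronization strings will do.
  obtain ⟨q, S, hS⟩ := InsDel.exists_isSyncFamily
  obtain ⟨θ₁, θ₂, h₁, h₂, h⟩ := InsDel.exists_simulation hc (by norm_num) (by norm_num) hS
  refine ⟨θ₁, θ₂, h₁, h₂, h.mono fun δ hδ n => ?_⟩
  obtain ⟨s, ρ, n₀, -, -, hsim⟩ := hδ
  exact ⟨_, hsim n⟩
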